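/- Let $L,M\ge 0$ be integers, $k\in\mathbb Z$, and let $\beta$, $c_1,\dots,c_L$, $d_1,\dots,d_M$ be nonzero complex numbers such that $\frac1{\beta c_l}\notin\{n\in\mathbb Z: n<\max(k,1)\}$ for all $l$ and $\frac1{\beta d_m}\notin\{0,1,2,\dots\}$ for all $m$. Put $$G_{\mathbf c,\mathbf d}(z)=\frac{\prod_{l=1}^L(1+c_lz)}{\prod_{m=1}^M(1-d_mz)},\qquad \rho_j=\beta^j\prod_{i=1}^jG_{\mathbf c,\mathbf d}(i\beta)\ (j\ge0),\qquad \rho_{-j}=\beta^{-j}\prod_{i=1}^{j-1}\frac1{G_{\mathbf c,\mathbf d}(-i\beta)}\ (j\ge1)$$ (with $1/G_{\mathbf c,\mathbf d}=0$ at poles of $G_{\mathbf c,\mathbf d}$), and let $\phi_k$ be the (formal or convergent) series $$\phi_k(x)=\beta x^{1-k}\sum_{j=0}^\infty\frac{\rho_{j-k}}{j!}\Big(\frac x\beta\Big)^j .$$ Put $$\kappa=(-1)^M\frac{\prod_l\beta c_l}{\prod_m\beta d_m},\qquad C_k=\frac{\prod_{m}\Gamma(-\frac1{\beta d_m})}{(-\beta)^{k-1}\prod_{l}\Gamma(\frac1{\beta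 c_l})}.$$ The Meijer $G$-function $\mathsf G(x):=G^{1,L}_{L,M+1}\Big({1-\frac1{\beta c_1},\dots,1-\frac1{\beta c_L}\atop 1-k,\,1+\frac1{\beta d_1},\dots,1+\frac1{\beta d_M}}\Big|-\kappa x\Big)$ is considered for $x\ne0$ as a function of a chosen value $w$ of $\log(-\kappa x)$; write $\arg(-\kappa x)=\operatorname{Im}w$ and $(-\kappa x)^s=e^{sw}$. It is defined by its Mellin–Barnes integral over a piecewise $C^1$ contour that has the poles $1-k,2-k,\dots$ on its right and the poles $-i-\frac1{\beta c_l}$ ($i\ge0$, $1\le l\le L$) on its left, left and right being understood through the index of the contour about these points. The contour is either (i) a contour from $-i\infty$ to $+i\infty$, vertical near both ends, allowed if $|\arg(-\kappa x)|<\frac{(L-M+1)\pi}2$; or (ii) a loop from $+\infty$ to $+\infty$, horizontal near both ends, encircling $1-k,2-k,\dots$ once in the negative sense and none of the other poles, allowed if $L\le M$, or if $L=M+1$ and $|\kappa x|<1$. Then: 1. Whenever (i) or (ii) is allowed, an allowed contour exists, and for every allowed contour $\mathcal C_k$ the following integral converges absolutely and $$\mathsf G(x)=\frac1{2\pi i}\int_{\mathcal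 C_k}\frac{\Gamma(1-k-s)\prod_{l=1}^L\Gamma\big(s+\frac1{\beta c_l}\big)}{\prod_{m=1}^M\Gamma\big(s-\frac1{\beta d_m}\big)}(-\kappa x)^s\,ds .$$ 2. If $L\le M$, or if $L=M+1$ and $|\kappa x|<1$, then the series $\phi_k(x)$ converges absolutely and $\phi_k(x)=C_k\,\mathsf G(x)$. 3. If $L\ge M+1$, then $\mathsf G$ is holomorphic (in $w$) in the sector $|\arg(-\kappa x)|<\frac{(L-M+1)\pi}2$; so for $L=M+1$ the function $C_k\mathsf G$ continues $\phi_k$ analytically. 4. If $L>M+1$, then $\phi_k$ is the asymptotic series of $C_k\mathsf G$ at $x=0$: for all $\theta<\frac{(L-M+1)\pi}2$ and all $N\ge0$ there is a constant $K$ such that $$\Big|C_k\,\mathsf G(x)-\beta x^{1-k}\sum_{j<N}\frac{\rho_{j-k}}{j!}\Big(\frac x\beta\Big)^j\Big|\le K\,|x^{1-k+N}|\qquad\text{if } |\arg(-\kappa x)|\le\theta,\ 0<|\kappa x|\le1 .$$ 5. If moreover no $1-k-\frac1{\beta d_m}$ is an integer $\le 0$, then, term by term, $$\phi_k(x)=\beta\rho_{-k}\,x^{1-k}\;{}_LF_M\Big({1-k+\frac1{\beta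 c_1},\dots,1-k+\frac1{\beta c_L}\atop 1-k-\frac1{\beta d_1},\dots,1-k-\frac1{\beta d_M}}\Big|\kappa x\Big).$$ -/

import Mathlib

open Complex Filter Topology MeasureTheory

noncomputable section

/-! ### Contours in the complex plane -/

/-- A continuous curve `γ : ℝ → ℂ` that is `C¹` on the closed pieces cut out by finitely many
points of the parameter line. -/
def IsPiecewiseC1 (γ : ℝ → ℂ) : Prop :=
  Continuous γ ∧ ∃ S : Finset ℝ, ∀ a b : ℝ, a < b → (∀ t ∈ S, t ∉ Set.Ioo a b) →
    ContDiffOn ℝ 1 γ (Set.Icc a b)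

/-- The (principal value) index of an unbounded curve about a point `p` that is not on it. -/
def HasContourIndex (γ : ℝ → ℂ) (p ν : ℂ) : Prop :=
  p ∉ Set.range γ ∧
    Tendsto (fun R : ℝ => (2 * (Real.pi : ℂ) * I)⁻¹ * ∫ t in (-R)..R, deriv γ t / (γ t - p))
      atTop (𝓝 ν)

/-- A contour from `-i∞` to `+i∞` (vertical near both ends) that has all points of `P` on its left
and all points of `Q` on its right. The argument of `γ t - p` changes by `π` in total if `p` is on
the left, and by `-π` if `p` is on the right, so that the index is `1/2` or `-1/2`. -/
def IsVerticalContour (P Q : Set ℂ) (γ : ℝ → ℂ) : Prop :=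
  IsPiecewiseC1 γ ∧
  (∃ x₁ x₂ T : ℝ, (∀ t, T ≤ t → γ t = x₁ + t * I) ∧ (∀ t, t ≤ -T → γ t = x₂ + t * I)) ∧
  (∀ p ∈ P, HasContourIndex γ p (1 / 2)) ∧ (∀ p ∈ Q, HasContourIndex γ p (-1 / 2))

/-- A loop that starts and ends at `+∞`, on lines parallel to the positive real axis, encircles all
points of `Q` once in the negative sense (they are on its right), and none of the points of `P`
(they are on its left). -/
def IsLoopContour (P Q : Set ℂ) (γ : ℝ → ℂ) : Prop :=
  IsPiecewiseC1 γ ∧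
  (∃ y₁ y₂ T : ℝ, (∀ t, T ≤ t → γ t = t + y₁ * I) ∧ (∀ t, t ≤ -T → γ t = -t + y₂ * I)) ∧
  (∀ p ∈ P, HasContourIndex γ p 0) ∧ (∀ p ∈ Q, HasContourIndex γ p (-1))

/-- `(2πi)⁻¹ ∫_γ f(s) ds`. -/
def contourIntegral (f : ℂ → ℂ) (γ : ℝ → ℂ) : ℂ :=
  (2 * (Real.pi : ℂ) * I)⁻¹ * ∫ t : ℝ, f (γ t) * deriv γ t

/-- The integral of `f` along `γ` converges absolutely. -/
def ContourIntegrable (f : ℂ → ℂ) (γ : ℝ → ℂ) : Prop :=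
  Integrable (fun t : ℝ => f (γ t) * deriv γ t)

/-! ### Meijer `G`-functions -/

/-- The Mellin–Barnes integrand
`∏_{j≤m} Γ(b_j-s) ∏_{j≤n} Γ(1-a_j+s) / (∏_{j>m} Γ(1-b_j+s) ∏_{j>n} Γ(a_j-s)) · z^s`
of `G^{m,n}_{p,q}(a; b | z)`. The power `z^s` is `exp (s * w)`, where `w` is the chosen
logarithm of `z`. -/
def meijerIntegrand (m n : ℕ) {p q : ℕ} (a : Fin p → ℂ) (b : Fin q → ℂ) (w s : ℂ) : ℂ :=
  (∏ j : Fin q, if (j : ℕ) < m then Gamma (b j - s) else (Gamma (1 - b j + s))⁻¹) *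
  (∏ j : Fin p, if (j : ℕ) < n then Gamma (1 - a j + s) else (Gamma (a j - s))⁻¹) *
  exp (s * w)

/-- The poles of the factors `Γ(1-a_j+s)`, `j ≤ n`. -/
def meijerLeftPoles (n : ℕ) {p : ℕ} (a : Fin p → ℂ) : Set ℂ :=
  {s | ∃ j : Fin p, (j : ℕ) < n ∧ ∃ i : ℕ, s = a j - 1 - i}

/-- The poles of the factors `Γ(b_j-s)`, `j ≤ m`. -/
def meijerRightPoles (m : ℕ) {q : ℕ} (b : Fin q → ℂ) : Set ℂ :=
  {s | ∃ j : Fin q, (j : ℕ) < m ∧ ∃ i : ℕ, s = b j + i}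

/-- The contours that define `G^{m,n}_{p,q}(a; b | z)` at `z = exp w`: contours from `-i∞` to `+i∞`
if `|arg z| < (m + n - (p + q) / 2) π`, where `arg z = Im w`, and loops from `+∞` to `+∞` if `p < q`,
or if `p = q ≥ 1` and `|z| < 1`. In both cases they separate the two families of poles. -/
def IsMeijerContour (m n : ℕ) {p q : ℕ} (a : Fin p → ℂ) (b : Fin q → ℂ) (w : ℂ) (γ : ℝ → ℂ) :
    Prop :=
  (|w.im| < ((m : ℝ) + n - ((p : ℝ) + q) / 2) * Real.pi ∧
    IsVerticalContour (meijerLeftPoles n a) (meijerRightPoles m b) γ) ∨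
  ((p < q ∨ (p = q ∧ 1 ≤ q ∧ w.re < 0)) ∧
    IsLoopContour (meijerLeftPoles n a) (meijerRightPoles m b) γ)

open Classical in
/-- The Meijer function `G^{m,n}_{p,q}(a; b | exp w)`, as a function of the logarithm `w` of its
argument (that is, on the Riemann surface of the logarithm). -/
def meijerG (m n : ℕ) {p q : ℕ} (a : Fin p → ℂ) (b : Fin q → ℂ) (w : ℂ) : ℂ :=
  if h : ∃ γ, IsMeijerContour m n a b w γ then
    contourIntegral (meijerIntegrand m n a b w) h.choose
  else 0

/-! ### Generalized hypergeometric series -/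

/-- The `j`-th term of the series `_pF_q(a; b | z)`, with `(a)_j` the rising factorial. -/
def hypergeometricTerm {p q : ℕ} (a : Fin p → ℂ) (b : Fin q → ℂ) (z : ℂ) (j : ℕ) : ℂ :=
  (∏ i, (ascPochhammer ℂ j).eval (a i)) / (∏ i, (ascPochhammer ℂ j).eval (b i)) *
    (z ^ j / (j.factorial : ℂ))

/-! ### Rational weights and the adapted basis -/

section Rational

variable {L M : ℕ} (c : Fin L → ℂ) (d : Fin M → ℂ) (β : ℂ)

/-- The rational weight generating function `G_{c,d}`. -/
def rationalWeight (z : ℂ) : ℂ := (∏ l, (1 + c l * z)) / ∏ m, (1 - d m * z)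

/-- `ρ_j = β^j ∏_{i=1}^j G(iβ)` and `ρ_{-j} = β^{-j} ∏_{i=1}^{j-1} 1/G(-iβ)` for `j ≥ 1`. -/
def rho : ℤ → ℂ
  | Int.ofNat j => β ^ j * ∏ i ∈ Finset.Icc 1 j, rationalWeight c d (i * β)
  | Int.negSucc j =>
      (β ^ (j + 1))⁻¹ * ∏ i ∈ Finset.Icc 1 j, (rationalWeight c d (-(i * β)))⁻¹

/-- The `j`-th term of the series `φ_k(x) = β x^{1-k} ∑_{j ≥ 0} ρ_{j-k} / j! (x/β)^j`. -/
def phiTerm (k : ℤ) (x : ℂ) (j : ℕ) : ℂ :=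
  β * x ^ (1 - k) * (rho c d β (j - k) / (j.factorial : ℂ) * (x / β) ^ j)

/-- The adapted basis function `φ_k`, where its series converges. -/
def phi (k : ℤ) (x : ℂ) : ℂ := ∑' j : ℕ, phiTerm c d β k x j

/-- `κ_{c,d} = (-1)^M ∏ (β c_l) / ∏ (β d_m)`. -/
def kappa : ℂ := (-1) ^ M * (∏ l, β * c l) / ∏ m, β * d m

/-- The constant `C_k`. -/
def constC (k : ℤ) : ℂ :=
  (∏ m, Gamma (-(1 / (β * d m)))) / ((-β) ^ (k - 1) * ∏ l, Gamma (1 / (β * c l)))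

/-- The upper parameters `1 - 1/(β c_l)`. -/
def upperParam : Fin L → ℂ := fun l => 1 - 1 / (β * c l)

/-- The lower parameters `1 - k, 1 + 1/(β d_1), …, 1 + 1/(β d_M)`. -/
def lowerParam (k : ℤ) : Fin (M + 1) → ℂ := Fin.cons (1 - (k : ℂ)) (fun m => 1 + 1 / (β * d m))

/-- The explicit integrand `Γ(1-k-s) ∏ Γ(s + 1/(β c_l)) / ∏ Γ(s - 1/(β d_m)) · exp(s w)`. -/
def barnesIntegrand (k : ℤ) (w s : ℂ) : ℂ :=
  Gamma (1 - k - s) * (∏ l, Gamma (s + 1 / (β * c l))) * exp (s * w) /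
    ∏ m, Gamma (s - 1 / (β * d m))

end Rational

end

/-! Write α_l = 1/(βc_l), δ_m = 1/(βd_m), e^w = -κx and f(s) = Γ(1-k-s) ∏ Γ(s+α_l) / ∏ Γ(s-δ_m) ·
e^{sw}. The series φ_k is a series of residues of f. Indeed ρ_n = β G(nβ) ρ_{n-1}, and Γ(z+1) =
zΓ(z) turns this recursion into a closed form for n ≥ -k: a constant times β^n κ^{n+1} ∏ Γ(n+1+α_l)
/ ∏ Γ(n+1-δ_m) (`rho_eq`). Hence -C_k times the residue of f at the simple pole 1-k+j is the j-th
term of φ_k (`tendsto_sub_mul_barnes`, `phiTerm_eq`). The hypothesis on c keeps these poles apart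
from those of the Γ(s+α_l); the factors 1/Γ(s-δ_m) are entire.

Two estimates control f. In vertical strips the Gamma factors together decay like e^{-η|Im s|} for
every η < (L-M+1)π/2 (`exists_norm_barnes_le`), which beats e^{sw} exactly in the stated sector.
Towards the right, f(s+1)/f(s) behaves like -e^w s^{L-M-1}, so f decays geometrically if L ≤ M, or
if L = M+1 and |κx| < 1 (`exists_norm_barnesRatio_le`).

The contours are arbitrary curves known only through their indices. On a convex strip, which
contains finitely many poles, f - ∑ r_p/(s-p) has a single-valued primitive
(`exists_primitive_sub_residues`), so the integral along a truncated curve depends only on its end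
points and on its integrals of 1/(s-p). A vertical contour is thereby compared with the line Re s =
n-k+1/2: the integral is the sum of the first n terms plus the line integral
(`contourIntegral_vertical`). A loop truncated at that abscissa differs from the partial sum by an
integral over a short closing segment, which tends to 0 (`contourIntegral_loop`). The poles on the
left, possibly multiple, have the same index for both curves or index 0, so their residues are never
computed. If both kinds of contour are allowed, the line integral tends to 0 as n grows and the
values agree; so the choice of contour in `meijerG` is immaterial.

The loop formula gives C_k G = φ_k. The vertical formula gives holomorphy, since the line integral
is holomorphic in w, and the asymptotic expansion, since the line integral is O(|κx|^{n-k+1/2}).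
Separating contours are built from a line or loop to the right of all left poles, with lassos around
the finitely many right poles that it misses. The hypergeometric form follows by comparing ratios of
consecutive terms. -/

noncomputable section

/-! ### Piecewise `C¹` curves -/

/-- Around every parameter there is an interval such that the points of `S` other than the
parameter are not in it. -/
lemma exists_pos_forall_notMem_Ioo (S : Finset ℝ) (t : ℝ) :
    ∃ ε > 0, ∀ s ∈ S, s ≠ t → s ∉ Set.Ioo (t - ε) (t + ε) := by
  have h : ((S.erase t : Finset ℝ) : Set ℝ)ᶜ ∈ 𝓝 t :=
    (S.erase t).finite_toSet.isClosed.isOpen_compl.mem_nhds (by simp)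
  obtain ⟨ε, hε, h⟩ := Metric.mem_nhds_iff.1 h
  refine ⟨ε, hε, fun s hs hst hs' => ?_⟩
  have : s ∈ Metric.ball t ε := by rwa [Real.ball_eq_Ioo]
  exact h this (by simp [hs, hst])

/-- On the open interval `deriv γ` agrees with `derivWithin`, which is continuous on the compact
interval. At the end points the curve may have corners, where `deriv γ` carries no information. -/
lemma ContDiffOn.integrableOn_deriv_Ioo {γ : ℝ → ℂ} {a b : ℝ} (hab : a < b)
    (h : ContDiffOn ℝ 1 γ (Set.Icc a b)) : IntegrableOn (deriv γ) (Set.Ioo a b) := by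
  have hc := (h.continuousOn_derivWithin (uniqueDiffOn_Icc hab) le_rfl).integrableOn_Icc
    (μ := volume)
  refine (hc.mono_set Set.Ioo_subset_Icc_self).congr_fun (fun t ht => ?_) measurableSet_Ioo
  exact derivWithin_of_mem_nhds (Icc_mem_nhds ht.1 ht.2)

namespace IsPiecewiseC1

variable {γ : ℝ → ℂ}

lemma locallyIntegrable_deriv (h : IsPiecewiseC1 γ) : LocallyIntegrable (deriv γ) := by
  obtain ⟨-, S, hS⟩ := h
  intro t
  obtain ⟨ε, hε, he⟩ := exists_pos_forall_notMem_Ioo S t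
  refine ⟨Set.Ioo (t - ε) (t + ε), Ioo_mem_nhds (by linarith) (by linarith), ?_⟩
  have h1 := (hS (t - ε) t (by linarith) fun s hs hs' =>
    he s hs hs'.2.ne ⟨hs'.1, by linarith [hs'.2]⟩).integrableOn_deriv_Ioo (by linarith)
  have h2 := (hS t (t + ε) (by linarith) fun s hs hs' =>
    he s hs hs'.1.ne' ⟨by linarith [hs'.1], hs'.2⟩).integrableOn_deriv_Ioo (by linarith)
  refine ((h1.union h2).union (integrableOn_singleton (x := t) (hx := by simp))).mono_set
    fun s hs => ?_
  rcases lt_trichotomy s t with h | h | h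
  · exact Or.inl (Or.inl ⟨hs.1, h⟩)
  · exact Or.inr h
  · exact Or.inl (Or.inr ⟨h, hs.2⟩)

lemma exists_finset_differentiableAt (h : IsPiecewiseC1 γ) :
    ∃ S : Finset ℝ, ∀ t ∉ S, DifferentiableAt ℝ γ t := by
  obtain ⟨-, S, hS⟩ := h
  refine ⟨S, fun t ht => ?_⟩
  obtain ⟨ε, hε, he⟩ := exists_pos_forall_notMem_Ioo S t
  exact ((hS (t - ε) (t + ε) (by linarith) fun s hs => he s hs
    (fun h => ht (h ▸ hs))).differentiableOn (by simp)).differentiableAt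
    (Icc_mem_nhds (by linarith) (by linarith))

lemma intervalIntegrable (h : IsPiecewiseC1 γ) {f : ℂ → ℂ} {a b : ℝ}
    (hf : ContinuousOn f (γ '' Set.uIcc a b)) :
    IntervalIntegrable (fun t => f (γ t) * deriv γ t) volume a b := by
  have h1 : IntervalIntegrable (deriv γ) volume a b :=
    (h.locallyIntegrable_deriv.integrableOn_isCompact isCompact_uIcc).intervalIntegrable
  exact h1.continuousOn_mul (hf.comp h.1.continuousOn (Set.mapsTo_image _ _))

/-- The fundamental theorem of calculus along a piecewise `C¹` curve. -/
lemma integral_eq_sub (h : IsPiecewiseC1 γ) {f F : ℂ → ℂ} {a b : ℝ} (hab : a ≤ b)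
    (hf : ContinuousOn f (γ '' Set.uIcc a b))
    (hF : ∀ t ∈ Set.Icc a b, HasDerivAt F (f (γ t)) (γ t)) :
    ∫ t in a..b, f (γ t) * deriv γ t = F (γ b) - F (γ a) := by
  obtain ⟨S, hS⟩ := h.exists_finset_differentiableAt
  refine integral_eq_of_hasDerivAt_off_countable_of_le (F ∘ γ) _ hab
    (S.countable_toSet) ?_ ?_ (h.intervalIntegrable hf)
  · intro t ht
    exact ((hF t ht).continuousAt.comp h.1.continuousAt).continuousWithinAt
  · intro t ht
    exact (hF t ⟨ht.1.1.le, ht.1.2.le⟩).comp_of_eq t (hS t ht.2).hasDerivAt rfl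

lemma of_contDiff (h : ContDiff ℝ 1 γ) : IsPiecewiseC1 γ :=
  ⟨h.continuous, ∅, fun _ _ _ _ => h.contDiffOn⟩

/-- Following a curve up to the parameter `a` and another curve from there on. -/
lemma glue {γ' : ℝ → ℂ} {a : ℝ} (h : IsPiecewiseC1 γ) (h' : IsPiecewiseC1 γ') (ha : γ a = γ' a) :
    IsPiecewiseC1 (fun t => if t ≤ a then γ t else γ' t) := by
  classical
  obtain ⟨hc, S, hS⟩ := h
  obtain ⟨hc', S', hS'⟩ := h'
  refine ⟨hc.if_le hc' continuous_id continuous_const (by rintro x rfl; exact ha),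
    insert a (S ∪ S'), fun x y hxy hs => ?_⟩
  have ha' := hs a (by simp)
  rcases le_or_gt y a with hy | hy
  · refine (hS x y hxy fun t ht => hs t (by simp [ht])).congr fun t ht => ?_
    rw [if_pos (ht.2.trans hy)]
  · have hx : a ≤ x := by
      by_contra! hx
      exact ha' ⟨hx, hy⟩
    refine (hS' x y hxy fun t ht => hs t (by simp [ht])).congr fun t ht => ?_
    rcases (hx.trans ht.1).eq_or_lt with h | h
    · rw [if_pos h.symm.le, ← h, ha]
    · rw [if_neg h.not_ge]

end IsPiecewiseC1

/-- The two integrands agree except possibly at the corner `a`, a null set. -/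
lemma integral_glue_left {γ γ' : ℝ → ℂ} {a x y : ℝ} (f : ℂ → ℂ) (hx : x ≤ a) (hy : y ≤ a) :
    ∫ t in x..y, f (if t ≤ a then γ t else γ' t) * deriv (fun t => if t ≤ a then γ t else γ' t) t =
      ∫ t in x..y, f (γ t) * deriv γ t := by
  refine intervalIntegral.integral_congr_ae ?_
  have h : ∀ᵐ t : ℝ, t ≠ a := by simp [ae_iff]
  filter_upwards [h] with t ht hxy
  have hta : t < a := lt_of_le_of_ne (hxy.2.trans (max_le hx hy)) ht
  rw [if_pos hta.le]
  congr 1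
  refine Filter.EventuallyEq.deriv_eq ?_
  filter_upwards [Iio_mem_nhds hta] with s hs
  rw [if_pos (le_of_lt hs)]

lemma integral_glue_right {γ γ' : ℝ → ℂ} {a x y : ℝ} (f : ℂ → ℂ) (hx : a ≤ x) (hy : a ≤ y) :
    ∫ t in x..y, f (if t ≤ a then γ t else γ' t) * deriv (fun t => if t ≤ a then γ t else γ' t) t =
      ∫ t in x..y, f (γ' t) * deriv γ' t := by
  refine intervalIntegral.integral_congr_ae ?_
  filter_upwards with t hxy
  have hta : a < t := lt_of_le_of_lt (le_min hx hy) hxy.1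
  rw [if_neg hta.not_ge]
  congr 1
  refine Filter.EventuallyEq.deriv_eq ?_
  filter_upwards [Ioi_mem_nhds hta] with s hs
  rw [if_neg (not_le.2 hs)]

/-! ### Residues and primitives -/

lemma tendsto_sub_mul_of_continuousAt {q : ℂ → ℂ} {p : ℂ} (hq : ContinuousAt q p) :
    Tendsto (fun s => (s - p) * q s) (𝓝[≠] p) (𝓝 0) := by
  have h : ContinuousAt (fun s => (s - p) * q s) p := by fun_prop
  simpa [ContinuousAt] using h.tendsto.mono_left nhdsWithin_le_nhds

/-- A function with a pole at `p` is the sum of a principal part, whose primitive away from `p` is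
single valued after subtraction of `r / (s - p)`, and a function that is analytic at `p`. -/
lemma exists_principalPart_aux (p : ℂ) (n : ℕ) : ∀ (f g : ℂ → ℂ), AnalyticAt ℂ g p →
    (∀ᶠ s in 𝓝[≠] p, (s - p) ^ n * f s = g s) →
    ∃ (r : ℂ) (q Q g : ℂ → ℂ), (∀ s ≠ p, HasDerivAt Q (q s - r / (s - p)) s) ∧
      (∀ s ≠ p, DifferentiableAt ℂ q s) ∧ AnalyticAt ℂ g p ∧
      (∀ᶠ s in 𝓝[≠] p, f s - q s = g s) ∧
      ∀ a, Tendsto (fun s => (s - p) * f s) (𝓝[≠] p) (𝓝 a) → r = a := by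
  induction n with
  | zero =>
    intro f g hg hfg
    refine ⟨0, 0, 0, g, ?_, ?_, hg, ?_, ?_⟩
    · intro s _
      simp
    · intro s _
      exact differentiableAt_const _
    · simpa using hfg
    · intro a ha
      refine tendsto_nhds_unique ((tendsto_sub_mul_of_continuousAt hg.continuousAt).congr' ?_) ha
      filter_upwards [hfg] with s hs
      rw [← hs, pow_zero, one_mul]
  | succ n ih =>
    intro f g hg hfg
    have hne : ∀ᶠ s in 𝓝[≠] p, s ≠ p := eventually_mem_nhdsWithin
    -- Subtracting the leading term c/(s-p)^(n+1) lowers the order of the pole by one, with `dslope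
    -- g p` in the role of `g`.
    set c := g p with hc
    obtain ⟨r, q, Q, g', hQ, hq, hg', hfq, hr⟩ := ih (fun s => f s - c / (s - p) ^ (n + 1))
      (dslope g p) (by
        obtain ⟨P, hP⟩ := hg
        exact ⟨_, hP.has_fpower_series_dslope_fslope⟩) (by
        filter_upwards [hfg, hne] with s hs hsp
        have : s - p ≠ 0 := sub_ne_zero.2 hsp
        rw [dslope_of_ne _ hsp, slope_def_field, ← hs]
        field_simp
        ring)
    have hlim : Tendsto (fun s => (s - p) ^ (n + 1) * f s) (𝓝[≠] p) (𝓝 c) :=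
      (hg.continuousAt.tendsto.mono_left nhdsWithin_le_nhds).congr' (by
        filter_upwards [hfg] with s hs using hs.symm)
    -- A leading term of order one contributes to the residue; one of higher order has a
    -- single-valued primitive and goes into `Q`.
    rcases n with _ | n
    · refine ⟨r + c, fun s => q s + c / (s - p), Q, g', ?_, ?_, hg', ?_, ?_⟩
      · intro s hs
        convert hQ s hs using 1
        ring
      · intro s hs
        have : s - p ≠ 0 := sub_ne_zero.2 hs
        have := hq s hs
        fun_prop (disch := assumption)
      · filter_upwards [hfq] with s hs
        rw [← hs]
        ring
      · intro a ha
        have hca : c = a := tendsto_nhds_unique hlim (by simpa using ha)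
        have hr0 : r = 0 := by
          refine hr 0 ?_
          have h0 : Tendsto (fun s => (s - p) * f s - c) (𝓝[≠] p) (𝓝 0) := by
            have := ha.sub_const a
            rwa [sub_self, ← hca] at this
          refine h0.congr' ?_
          filter_upwards [hne] with s hs
          have : s - p ≠ 0 := sub_ne_zero.2 hs
          field_simp
          ring
        rw [hr0, hca, zero_add]
    · refine ⟨r, fun s => q s + c / (s - p) ^ (n + 2),
        fun s => Q s + c * (-(1 / (n + 1 : ℂ))) * ((s - p) ^ (n + 1))⁻¹, g', ?_, ?_, hg', ?_, ?_⟩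
      · intro s hs
        have hsp : s - p ≠ 0 := sub_ne_zero.2 hs
        have hn : (n + 1 : ℂ) ≠ 0 := Nat.cast_add_one_ne_zero n
        have h1 : HasDerivAt (fun s => (s - p) ^ (n + 1)) ((n + 1 : ℂ) * (s - p) ^ n) s := by
          simpa using ((hasDerivAt_id s).sub_const p).fun_pow (n + 1)
        have h2 := (h1.fun_inv (pow_ne_zero _ hsp)).const_mul (c * (-(1 / (n + 1 : ℂ))))
        refine ((hQ s hs).fun_add h2).congr_deriv ?_
        field_simp
        ring
      · intro s hs
        have : (s - p) ^ (n + 2) ≠ 0 := pow_ne_zero _ (sub_ne_zero.2 hs)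
        have := hq s hs
        fun_prop (disch := assumption)
      · filter_upwards [hfq] with s hs
        rw [← hs]
        ring
      · intro a ha
        -- If (s-p) f(s) has a limit, the pole is at most simple and the coefficient of order n + 2
        -- vanishes.
        have hca : c = 0 := by
          refine tendsto_nhds_unique hlim ?_
          have h0 : Tendsto (fun s => (s - p) ^ (n + 1)) (𝓝[≠] p) (𝓝 0) := by
            have : ContinuousAt (fun s => (s - p) ^ (n + 1)) p := by fun_prop
            simpa [ContinuousAt] using this.tendsto.mono_left nhdsWithin_le_nhds
          have := h0.mul ha
          rw [zero_mul] at this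
          exact this.congr fun s => by ring
        exact hr a (by simpa [hca] using ha)

/-- The last clause identifies `r` only for a pole that is at most simple. This suffices: the right
poles of the integrand are simple, and the residues at the left poles cancel later. -/
lemma MeromorphicAt.exists_principalPart {f : ℂ → ℂ} {p : ℂ} (hf : MeromorphicAt f p) :
    ∃ (r : ℂ) (q Q g : ℂ → ℂ), (∀ s ≠ p, HasDerivAt Q (q s - r / (s - p)) s) ∧
      (∀ s ≠ p, DifferentiableAt ℂ q s) ∧ AnalyticAt ℂ g p ∧
      (∀ᶠ s in 𝓝[≠] p, f s - q s = g s) ∧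
      ∀ a, Tendsto (fun s => (s - p) * f s) (𝓝[≠] p) (𝓝 a) → r = a := by
  obtain ⟨n, hn⟩ := hf
  exact exists_principalPart_aux p n f _ hn (by simp)

/-- Principal parts are removed one pole at a time; the part `q` removed at `p` is holomorphic at
the other poles and does not affect their residues. -/
lemma exists_sub_principalPart (F : Finset ℂ) {U : Set ℂ} (hU : IsOpen U) : ∀ (f : ℂ → ℂ),
    DifferentiableOn ℂ f (U \ F) → (∀ p ∈ F, MeromorphicAt f p) →
    ∃ (r : ℂ → ℂ) (Q g : ℂ → ℂ), DifferentiableOn ℂ g U ∧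
      (∀ s ∈ U \ F, HasDerivAt Q (f s - g s - ∑ p ∈ F, r p / (s - p)) s) ∧
      ∀ p ∈ F, ∀ a, Tendsto (fun s => (s - p) * f s) (𝓝[≠] p) (𝓝 a) → r p = a := by
  classical
  induction F using Finset.induction_on with
  | empty =>
    intro f hf _
    exact ⟨0, 0, f, by simpa using hf, fun s _ => by simp, by simp⟩
  | insert p F hp ih =>
    intro f hf hmer
    obtain ⟨r₀, q, Q₀, g₀, hQ₀, hq, hg₀, hfq, hr₀⟩ :=
      (hmer p (Finset.mem_insert_self _ _)).exists_principalPart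
    -- The value of `f` at the pole is arbitrary, so the difference is redefined there to make it
    -- holomorphic at `p`.
    set f₁ := Function.update (fun s => f s - q s) p (g₀ p) with hf₁
    have hf₁s : ∀ s ≠ p, f₁ s = f s - q s := fun s hs => by simp [hf₁, hs]
    have hf₁n : ∀ s ≠ p, f₁ =ᶠ[𝓝 s] fun s => f s - q s := fun s hs => by
      filter_upwards [isOpen_ne.mem_nhds hs] with z hz using hf₁s z hz
    have hq_an : ∀ s ≠ p, AnalyticAt ℂ q s := fun s hs =>
      analyticAt_iff_eventually_differentiableAt.2 (by
        filter_upwards [isOpen_ne.mem_nhds hs] with z hz using hq z hz)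
    have hf₁p : f₁ =ᶠ[𝓝 p] g₀ := by
      rw [eventually_nhdsWithin_iff] at hfq
      filter_upwards [hfq] with s hs
      rcases eq_or_ne s p with rfl | h
      · simp [hf₁]
      · rw [hf₁s s h, hs h]
    obtain ⟨r, Q, g, hg, hQ, hr⟩ := ih f₁ (by
        intro s hs
        rcases eq_or_ne s p with rfl | h
        · exact (hg₀.differentiableAt.congr_of_eventuallyEq hf₁p).differentiableWithinAt
        · have hfs : DifferentiableAt ℂ f s :=
            (hf s ⟨hs.1, by simpa [h] using hs.2⟩).differentiableAt
              ((hU.sdiff (insert p F).finite_toSet.isClosed).mem_nhds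
                ⟨hs.1, by simpa [h] using hs.2⟩)
          exact ((hfs.sub (hq s h)).congr_of_eventuallyEq (hf₁n s h)).differentiableWithinAt)
      (by
        intro s hs
        have h : s ≠ p := fun h => hp (h ▸ hs)
        exact ((hmer s (Finset.mem_insert_of_mem hs)).sub (hq_an s h).meromorphicAt).congr
          ((hf₁n s h).symm.filter_mono nhdsWithin_le_nhds))
    refine ⟨Function.update r p r₀, fun s => Q₀ s + Q s, g, hg, ?_, ?_⟩
    · intro s hs
      have hsp : s ≠ p := fun h => hs.2 (by simp [h])
      have hsF : s ∉ F := fun h => hs.2 (by simp [h])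
      refine ((hQ₀ s hsp).fun_add (hQ s ⟨hs.1, hsF⟩)).congr_deriv ?_
      rw [Finset.sum_insert hp, Function.update_self, hf₁s s hsp]
      have : ∑ x ∈ F, Function.update r p r₀ x / (s - x) = ∑ x ∈ F, r x / (s - x) :=
        Finset.sum_congr rfl fun x hx => by
          rw [Function.update_of_ne (ne_of_mem_of_not_mem hx hp)]
      rw [this]
      ring
    · intro s hs a ha
      rcases eq_or_ne s p with rfl | h
      · rw [Function.update_self]
        exact hr₀ a ha
      · rw [Function.update_of_ne h]
        refine hr s (Finset.mem_of_mem_insert_of_ne hs h) a ?_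
        have := ha.sub (tendsto_sub_mul_of_continuousAt (hq s h).continuousAt)
        rw [sub_zero] at this
        refine this.congr' ?_
        filter_upwards [(hf₁n s h).filter_mono nhdsWithin_le_nhds] with z hz
        rw [hz]
        ring

/-- On a convex open set, a meromorphic function with finitely many poles has a primitive after
subtraction of the terms `r / (s - p)`, with `r` the residue. -/
theorem exists_primitive_sub_residues {U : Set ℂ} (hU : IsOpen U) (hUc : Convex ℝ U)
    (F : Finset ℂ) {f : ℂ → ℂ} (hf : DifferentiableOn ℂ f (U \ F))
    (hmer : ∀ p ∈ F, MeromorphicAt f p) :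
    ∃ r H : ℂ → ℂ, (∀ s ∈ U \ F, HasDerivAt H (f s - ∑ p ∈ F, r p / (s - p)) s) ∧
      ∀ p ∈ F, ∀ a, Tendsto (fun s => (s - p) * f s) (𝓝[≠] p) (𝓝 a) → r p = a := by
  obtain ⟨r, Q, g, hg, hQ, hr⟩ := exists_sub_principalPart F hU f hf hmer
  obtain ⟨G, hG⟩ := hUc.exists_forall_hasDerivWithinAt hg
  refine ⟨r, fun s => Q s + G s, fun s hs => ?_, hr⟩
  refine ((hQ s hs).fun_add ((hG s hs.1).hasDerivAt (hU.mem_nhds hs.1))).congr_deriv ?_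
  ring

/-- The integral of a meromorphic function along a curve, in terms of the residues and a
primitive. -/
lemma integral_eq_sum_residues_add_sub {U : Set ℂ} {F : Finset ℂ} {f r H : ℂ → ℂ}
    (hf : DifferentiableOn ℂ f (U \ F))
    (hH : ∀ s ∈ U \ F, HasDerivAt H (f s - ∑ p ∈ F, r p / (s - p)) s) {γ : ℝ → ℂ}
    (hγ : IsPiecewiseC1 γ) {a b : ℝ} (hab : a ≤ b) (hγU : ∀ t ∈ Set.Icc a b, γ t ∈ U \ F) :
    ∫ t in a..b, f (γ t) * deriv γ t =
      ∑ p ∈ F, r p * (∫ t in a..b, deriv γ t / (γ t - p)) + (H (γ b) - H (γ a)) := by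
  have himg : γ '' Set.uIcc a b ⊆ U \ F := by
    rw [Set.uIcc_of_le hab]
    rintro _ ⟨t, ht, rfl⟩
    exact hγU t ht
  have hfc : ContinuousOn f (γ '' Set.uIcc a b) := hf.continuousOn.mono himg
  have hpc : ∀ p ∈ F, ContinuousOn (fun s => 1 / (s - p)) (γ '' Set.uIcc a b) := fun p hp =>
    continuousOn_const.div (by fun_prop) fun s hs =>
      sub_ne_zero.2 fun h => (himg hs).2 (by simpa [h] using hp)
  have hsc : ContinuousOn (fun s => ∑ p ∈ F, r p / (s - p)) (γ '' Set.uIcc a b) :=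
    continuousOn_finsetSum _ fun p hp =>
      ((hpc p hp).const_smul (r p)).congr fun s _ => by simp [div_eq_mul_inv]
  have h1 := hγ.integral_eq_sub (f := fun s => f s - ∑ p ∈ F, r p / (s - p)) hab
    (hfc.sub hsc) fun t ht => hH _ (hγU t ht)
  have h2 : ∑ p ∈ F, r p * (∫ t in a..b, deriv γ t / (γ t - p)) =
      ∫ t in a..b, (∑ p ∈ F, r p / (γ t - p)) * deriv γ t := by
    have : ∀ t, (∑ p ∈ F, r p / (γ t - p)) * deriv γ t =
        ∑ p ∈ F, r p * (1 / (γ t - p) * deriv γ t) := fun t => by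
      rw [Finset.sum_mul]
      exact Finset.sum_congr rfl fun p _ => by ring
    simp_rw [this]
    rw [intervalIntegral.integral_finsetSum fun p hp =>
      (hγ.intervalIntegrable (hpc p hp)).const_mul (r p)]
    refine Finset.sum_congr rfl fun p _ => ?_
    rw [intervalIntegral.integral_const_mul]
    congr 1
    exact intervalIntegral.integral_congr fun t _ => by ring
  rw [h2, ← h1, ← intervalIntegral.integral_add (hγ.intervalIntegrable hsc)
    (hγ.intervalIntegrable (f := fun s => f s - ∑ p ∈ F, r p / (s - p)) (hfc.sub hsc))]
  exact intervalIntegral.integral_congr fun t _ => by ring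

/-! ### Decay of the Gamma function in vertical strips -/

/-- Differentiation of a Laplace type integral with respect to its complex parameter. -/
lemma differentiableAt_integral_mul_exp {μ : Measure ℝ} {φ u : ℝ → ℂ}
    (hφ : AEStronglyMeasurable φ μ) (hu : AEStronglyMeasurable u μ) {w₀ : ℂ} {S : Set ℂ}
    (hS : S ∈ 𝓝 w₀) {bound : ℝ → ℝ}
    (hb : ∀ᵐ a ∂μ, ∀ w ∈ S, ‖φ a‖ * ‖u a‖ * Real.exp (u a * w).re ≤ bound a)
    (hbi : Integrable bound μ) (hi : Integrable (fun a => φ a * exp (u a * w₀)) μ) :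
    DifferentiableAt ℂ (fun w => ∫ a, φ a * exp (u a * w) ∂μ) w₀ := by
  have hm : ∀ w : ℂ, AEStronglyMeasurable (fun a => φ a * exp (u a * w)) μ := fun w =>
    hφ.mul (continuous_exp.comp_aestronglyMeasurable (hu.mul_const w))
  refine (hasDerivAt_integral_of_dominated_loc_of_deriv_le
    (F' := fun w a => φ a * (exp (u a * w) * u a)) hS (.of_forall hm) hi
    (hφ.mul ((continuous_exp.comp_aestronglyMeasurable (hu.mul_const w₀)).mul hu))
    ?_ hbi (.of_forall fun a w _ => ?_)).2.differentiableAt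
  · filter_upwards [hb] with a ha w hw
    rw [norm_mul, norm_mul, norm_exp, mul_comm (Real.exp _), ← mul_assoc]
    exact ha w hw
  · have := ((hasDerivAt_id w).const_mul (u a)).cexp.const_mul (φ a)
    simpa using this

namespace Complex

/-- The Gamma integral along a rotated ray. -/
lemma integral_cpow_mul_exp_neg_complex_mul_Ioi {s r : ℂ} (hs : 0 < s.re) (hr : 0 < r.re) :
    ∫ t : ℝ in Set.Ioi 0, (t : ℂ) ^ (s - 1) * exp (-(r * t)) = (1 / r) ^ s * Gamma s := by
  set U : Set ℂ := {r | 0 < r.re} with hU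
  have hUo : IsOpen U := isOpen_lt continuous_const continuous_re
  have hslit : ∀ r ∈ U, r ∈ slitPlane := fun r hr => Or.inl hr
  have hcpow : ContinuousOn (fun t : ℝ => (t : ℂ) ^ (s - 1)) (Set.Ioi 0) := fun t ht =>
    (continuousAt_ofReal_cpow_const t (s - 1) (Or.inr (ne_of_gt ht))).continuousWithinAt
  have hφ := hcpow.aestronglyMeasurable (μ := volume) measurableSet_Ioi
  have hu : AEStronglyMeasurable (fun t : ℝ => -(t : ℂ)) (volume.restrict (Set.Ioi 0)) := by
    fun_prop
  have hbound : ∀ (b p : ℝ), 0 < b → -1 < p →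
      IntegrableOn (fun t : ℝ => t ^ p * Real.exp (-b * t)) (Set.Ioi 0) := fun b p hb hp => by
    simpa using integrableOn_rpow_mul_exp_neg_mul_rpow hp one_pos hb
  have hdiff : DifferentiableOn ℂ
      (fun r => ∫ t : ℝ in Set.Ioi 0, (t : ℂ) ^ (s - 1) * exp (-(t : ℂ) * r)) U := by
    intro r₀ hr₀
    have hr₀' : 0 < r₀.re := hr₀
    refine (differentiableAt_integral_mul_exp (S := {r | r₀.re / 2 < r.re}) hφ hu
      ((isOpen_lt continuous_const continuous_re).mem_nhds (half_lt_self hr₀'))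
      (bound := fun t => t ^ s.re * Real.exp (-(r₀.re / 2) * t)) ?_
      (hbound _ _ (half_pos hr₀') (by linarith)) ?_).differentiableWithinAt
    · filter_upwards [ae_restrict_mem measurableSet_Ioi] with t ht r hr
      have ht' : (0 : ℝ) < t := ht
      have hr' : r₀.re / 2 < r.re := hr
      rw [norm_cpow_eq_rpow_re_of_pos ht', norm_neg, norm_real, Real.norm_of_nonneg ht'.le]
      nth_rw 2 [← Real.rpow_one t]
      rw [← Real.rpow_add ht']
      simp only [sub_re, one_re, sub_add_cancel]
      gcongr
      simp only [neg_mul, neg_re, mul_re, ofReal_re, ofReal_im, zero_mul, sub_zero, neg_le_neg_iff]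
      nlinarith
    · refine Integrable.mono' (hbound r₀.re (s.re - 1) hr₀' (by linarith))
        (hφ.mul (continuous_exp.comp_aestronglyMeasurable (hu.mul_const r₀))) ?_
      filter_upwards [ae_restrict_mem measurableSet_Ioi] with t ht
      have ht' : (0 : ℝ) < t := ht
      rw [norm_mul, norm_cpow_eq_rpow_re_of_pos ht', norm_exp]
      simp [mul_comm]
  have hdiff' : DifferentiableOn ℂ (fun r : ℂ => (1 / r) ^ s * Gamma s) U := by
    intro r hr
    have hr0 : r ≠ 0 := slitPlane_ne_zero (hslit r hr)
    refine DifferentiableAt.differentiableWithinAt ?_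
    refine (DifferentiableAt.cpow (by fun_prop (disch := assumption)) (by fun_prop) ?_).mul_const _
    rw [one_div]
    refine Or.inl ?_
    rw [inv_re]
    exact div_pos hr (normSq_pos.2 hr0)
  have hconv : Convex ℝ U := convex_halfSpace_re_gt 0
  -- Identity theorem in the right half-plane: both sides are holomorphic in r and agree for real r
  -- near 1.
  have key := (hdiff.analyticOnNhd hUo).eqOn_of_preconnected_of_frequently_eq
    (hdiff'.analyticOnNhd hUo) hconv.isPreconnected (z₀ := 1) (by simp [hU]) (by
      have h1 : Tendsto (fun x : ℝ => (x : ℂ)) (𝓝[≠] 1) (𝓝[≠] 1) := by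
        refine tendsto_nhdsWithin_of_tendsto_nhds_of_eventually_within _ ?_ ?_
        · exact (continuous_ofReal.tendsto' 1 1 (by simp)).mono_left nhdsWithin_le_nhds
        · filter_upwards [self_mem_nhdsWithin] with x hx
          simpa using hx
      refine h1.frequently (Eventually.frequently ?_)
      filter_upwards [nhdsWithin_le_nhds (Ioi_mem_nhds (zero_lt_one' ℝ))] with x hx
      rw [← integral_cpow_mul_exp_neg_mul_Ioi hs hx]
      refine setIntegral_congr_fun measurableSet_Ioi fun t _ => ?_
      ring_nf) hr
  refine Eq.trans (setIntegral_congr_fun measurableSet_Ioi fun t _ => ?_) key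
  ring_nf

/-- Rotating the ray of Euler's integral by θ produces the factor e^{-iθs}, of modulus e^{θ Im s},
beside Γ(s), while the absolute value of the integrand becomes t^(Re s - 1) e^{-t cos θ}. -/
lemma norm_Gamma_le_of_re_pos {s : ℂ} (hs : 0 < s.re) {θ : ℝ} (hθ : |θ| < Real.pi / 2) :
    ‖Gamma s‖ ≤ Real.Gamma s.re * (1 / Real.cos θ) ^ s.re * Real.exp (-(θ * s.im)) := by
  have hcos : 0 < Real.cos θ := Real.cos_pos_of_mem_Ioo (by rwa [abs_lt] at hθ)
  have hre : (exp (θ * I)).re = Real.cos θ := by simp [exp_ofReal_mul_I_re]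
  have h1 := integral_cpow_mul_exp_neg_complex_mul_Ioi hs (r := exp (θ * I)) (by rwa [hre])
  have h2 : ((1 : ℂ) / exp (θ * I)) ^ s = exp (-(θ * s * I)) := by
    have hlog : log (exp (-(θ * I))) = -(θ * I) := by
      rw [log_exp] <;> simp <;> linarith [abs_lt.1 hθ, Real.pi_pos, (abs_lt.1 hθ).1, (abs_lt.1 hθ).2]
    rw [one_div, ← exp_neg, cpow_def_of_ne_zero (exp_ne_zero _), hlog]
    ring_nf
  rw [h2] at h1
  have h3 : ‖exp (-(θ * s * I))‖ = Real.exp (θ * s.im) := by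
    rw [norm_exp]
    simp
  have h4 : ‖∫ t : ℝ in Set.Ioi 0, (t : ℂ) ^ (s - 1) * exp (-(exp (θ * I) * t))‖ ≤
      (1 / Real.cos θ) ^ s.re * Real.Gamma s.re := by
    rw [← Real.integral_rpow_mul_exp_neg_mul_Ioi hs hcos]
    refine (norm_integral_le_integral_norm _).trans (le_of_eq ?_)
    refine setIntegral_congr_fun measurableSet_Ioi fun t ht => ?_
    have ht' : (0 : ℝ) < t := ht
    simp only [norm_mul]
    rw [norm_cpow_eq_rpow_re_of_pos ht', norm_exp]
    congr 2
    simp [← exp_ofReal_mul_I_re]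
  rw [h1, norm_mul, h3] at h4
  rw [Real.exp_neg, ← div_eq_mul_inv, le_div_iff₀ (Real.exp_pos _), mul_comm]
  linarith

/-- Each factor s + i of Γ(s+n)/Γ(s) has modulus at least |Im s| ≥ 1. This moves a strip into the
right half-plane. -/
lemma norm_Gamma_le_norm_Gamma_add_nat {s : ℂ} (hs : 1 ≤ |s.im|) (n : ℕ) :
    ‖Gamma s‖ ≤ ‖Gamma (s + n)‖ := by
  induction n with
  | zero => simp
  | succ n ih =>
    have h1 : 1 ≤ ‖s + n‖ := by
      have := abs_im_le_norm (s + n)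
      simp only [add_im, natCast_im, add_zero] at this
      linarith
    have h2 : s + n ≠ 0 := norm_pos_iff.1 (by linarith)
    push_cast
    rw [← add_assoc, Gamma_add_one _ h2, norm_mul]
    nlinarith [norm_nonneg (Gamma (s + n))]

/-- Exponential decay of `Γ` in vertical strips. -/
lemma exists_norm_Gamma_le (B : ℝ) {θ : ℝ} (hθ₀ : 0 ≤ θ) (hθ : θ < Real.pi / 2) :
    ∃ C, 0 ≤ C ∧ ∀ s : ℂ, |s.re| ≤ B → 1 ≤ |s.im| → ‖Gamma s‖ ≤ C * Real.exp (-(θ * |s.im|)) := by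
  have hcos : 0 < Real.cos θ := Real.cos_pos_of_mem_Ioo ⟨by linarith [Real.pi_pos], hθ⟩
  -- Adding N moves the strip |Re s| ≤ B into a compact range of positive real parts.
  obtain ⟨N, hN⟩ := exists_nat_gt B
  have hcont : ContinuousOn (fun σ : ℝ => Real.Gamma σ * (1 / Real.cos θ) ^ σ)
      (Set.Icc (N - B) (N + B)) := by
    refine ContinuousOn.mul (fun σ hσ => ?_) ?_
    · refine (Real.differentiableAt_Gamma fun m hm => ?_).continuousAt.continuousWithinAt
      have : (0 : ℝ) ≤ m := Nat.cast_nonneg m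
      linarith [hσ.1]
    · exact fun σ _ => (Real.continuousAt_const_rpow (by positivity)).continuousWithinAt
  obtain ⟨C, hC⟩ := isCompact_Icc.exists_bound_of_continuousOn hcont
  refine ⟨max C 0, le_max_right _ _, fun s hs hs' => ?_⟩
  refine (norm_Gamma_le_norm_Gamma_add_nat hs' N).trans ?_
  have hre : (s + N).re = s.re + N := by simp
  have him : (s + N).im = s.im := by simp
  obtain ⟨h1, h2⟩ := abs_le.1 hs
  have hpos : 0 < (s + N).re := by rw [hre]; linarith
  have hCs := (Real.le_norm_self _).trans
    (hC (s + N).re ⟨by rw [hre]; linarith, by rw [hre]; linarith⟩)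
  -- The ray is rotated by θ or -θ according to the sign of Im s, so that the exponent is -θ|Im s|
  -- in both cases.
  have key : ∀ θ' : ℝ, |θ'| < Real.pi / 2 → Real.cos θ' = Real.cos θ → θ' * s.im = θ * |s.im| →
      ‖Gamma (s + N)‖ ≤ max C 0 * Real.exp (-(θ * |s.im|)) := by
    intro θ' h1 h2 h3
    have := norm_Gamma_le_of_re_pos hpos h1
    rw [h2, him, h3] at this
    exact this.trans (mul_le_mul_of_nonneg_right (hCs.trans (le_max_left _ _))
      (Real.exp_pos _).le)
  rcases le_total 0 s.im with h | h
  · exact key θ (by rwa [abs_of_nonneg hθ₀]) rfl (by rw [abs_of_nonneg h])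
  · exact key (-θ) (by rwa [abs_neg, abs_of_nonneg hθ₀]) (Real.cos_neg θ)
      (by rw [abs_of_nonpos h]; ring)

lemma norm_sin_le_exp (z : ℂ) : ‖sin z‖ ≤ Real.exp |z.im| := by
  have h1 : ‖exp (-z * I)‖ ≤ Real.exp |z.im| := by
    rw [norm_exp]
    refine Real.exp_le_exp.2 ?_
    simpa using le_abs_self z.im
  have h2 : ‖exp (z * I)‖ ≤ Real.exp |z.im| := by
    rw [norm_exp]
    refine Real.exp_le_exp.2 ?_
    simpa using neg_le_abs z.im
  rw [sin, norm_div, norm_mul, norm_I, mul_one]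
  have := norm_sub_le (exp (-z * I)) (exp (z * I))
  simp only [Complex.norm_ofNat]
  linarith

/-- Growth of `1 / Γ` in vertical strips. -/
lemma exists_norm_inv_Gamma_le (B : ℝ) {θ : ℝ} (hθ₀ : 0 ≤ θ) (hθ : θ < Real.pi / 2) :
    ∃ C, 0 ≤ C ∧ ∀ s : ℂ, |s.re| ≤ B → 1 ≤ |s.im| →
      ‖(Gamma s)⁻¹‖ ≤ C * Real.exp ((Real.pi - θ) * |s.im|) := by
  obtain ⟨C, hC₀, hC⟩ := exists_norm_Gamma_le (1 + B) hθ₀ hθ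
  refine ⟨C, hC₀, fun s hs hs' => ?_⟩
  have him : s.im ≠ 0 := fun h => by norm_num [h] at hs'
  have hsin : sin (Real.pi * s) ≠ 0 := by
    intro h
    obtain ⟨n, hn⟩ := sin_eq_zero_iff.1 h
    have : (Real.pi : ℂ) ≠ 0 := by exact_mod_cast Real.pi_ne_zero
    rw [mul_comm] at hn
    have := congrArg im (mul_right_cancel₀ this hn)
    simp at this
    exact him this
  have hrefl := Gamma_mul_Gamma_one_sub s
  have hpi : (Real.pi : ℂ) ≠ 0 := by exact_mod_cast Real.pi_ne_zero
  have hG : Gamma s ≠ 0 := fun h => by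
    rw [h, zero_mul] at hrefl
    exact div_ne_zero hpi hsin hrefl.symm
  -- The reflection formula: Γ(1-s) decays with rate θ and sin(πs) grows with rate π.
  have h1 : (Gamma s)⁻¹ = Gamma (1 - s) * sin (Real.pi * s) / Real.pi := by
    rw [eq_div_iff hpi, inv_mul_eq_iff_eq_mul₀ hG, ← mul_assoc, hrefl, div_mul_cancel₀ _ hsin]
  have h2 := hC (1 - s) (by
    rw [sub_re, one_re, abs_le] 
    rw [abs_le] at hs
    constructor <;> linarith) (by simpa using hs')
  have h3 := norm_sin_le_exp (Real.pi * s)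
  have h4 : |((Real.pi : ℂ) * s).im| = Real.pi * |s.im| := by
    simp [abs_mul, abs_of_pos Real.pi_pos]
  have h5 : |(1 - s).im| = |s.im| := by simp
  rw [h4] at h3
  rw [h5] at h2
  rw [h1, norm_div, norm_mul, norm_real, Real.norm_of_nonneg Real.pi_pos.le]
  have h6 : Real.exp ((Real.pi - θ) * |s.im|) =
      Real.exp (-(θ * |s.im|)) * Real.exp (Real.pi * |s.im|) := by
    rw [← Real.exp_add]
    ring_nf
  rw [h6, ← mul_assoc]
  refine (div_le_self (by positivity) (by linarith [Real.pi_gt_three])).trans ?_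
  gcongr

lemma exists_norm_Gamma_add_le (a : ℂ) (B : ℝ) {θ : ℝ} (hθ₀ : 0 ≤ θ) (hθ : θ < Real.pi / 2) :
    ∃ C T, 0 ≤ C ∧ ∀ s : ℂ, |s.re| ≤ B → T ≤ |s.im| →
      ‖Gamma (s + a)‖ ≤ C * Real.exp (-(θ * |s.im|)) := by
  obtain ⟨C, hC₀, hC⟩ := exists_norm_Gamma_le (B + |a.re|) hθ₀ hθ
  -- The threshold keeps |Im(s+a)| ≥ 1, and the constant absorbs the difference between |Im(s+a)|
  -- and |Im s|.
  refine ⟨C * Real.exp (θ * |a.im|), 1 + |a.im|, by positivity, fun s hs hT => ?_⟩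
  have h1 : |s.im| - |a.im| ≤ |(s + a).im| := by
    simpa using abs_sub_abs_le_abs_sub s.im (-a.im)
  refine (hC (s + a) ?_ (by linarith)).trans ?_
  · rw [add_re]
    exact (abs_add_le _ _).trans (by linarith)
  · rw [mul_assoc, ← Real.exp_add]
    gcongr
    nlinarith

lemma exists_norm_Gamma_sub_le (a : ℂ) (B : ℝ) {θ : ℝ} (hθ₀ : 0 ≤ θ) (hθ : θ < Real.pi / 2) :
    ∃ C T, 0 ≤ C ∧ ∀ s : ℂ, |s.re| ≤ B → T ≤ |s.im| →
      ‖Gamma (a - s)‖ ≤ C * Real.exp (-(θ * |s.im|)) := by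
  obtain ⟨C, T, hC₀, hC⟩ := exists_norm_Gamma_add_le a B hθ₀ hθ
  refine ⟨C, T, hC₀, fun s hs hT => ?_⟩
  have := hC (-s) (by simpa using hs) (by simpa using hT)
  rw [neg_add_eq_sub] at this
  simpa using this

lemma exists_norm_inv_Gamma_add_le (a : ℂ) (B : ℝ) {θ : ℝ} (hθ₀ : 0 ≤ θ)
    (hθ : θ < Real.pi / 2) :
    ∃ C T, 0 ≤ C ∧ ∀ s : ℂ, |s.re| ≤ B → T ≤ |s.im| →
      ‖(Gamma (s + a))⁻¹‖ ≤ C * Real.exp ((Real.pi - θ) * |s.im|) := by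
  obtain ⟨C, hC₀, hC⟩ := exists_norm_inv_Gamma_le (B + |a.re|) hθ₀ hθ
  have hpos : 0 ≤ Real.pi - θ := by linarith [Real.pi_pos]
  refine ⟨C * Real.exp ((Real.pi - θ) * |a.im|), 1 + |a.im|, by positivity, fun s hs hT => ?_⟩
  have h1 : |s.im| - |a.im| ≤ |(s + a).im| := by
    simpa using abs_sub_abs_le_abs_sub s.im (-a.im)
  have h2 : |(s + a).im| ≤ |s.im| + |a.im| := abs_add_le _ _
  refine (hC (s + a) ?_ (by linarith)).trans ?_
  · rw [add_re]
    exact (abs_add_le _ _).trans (by linarith)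
  · rw [mul_assoc, ← Real.exp_add]
    gcongr
    nlinarith

end Complex

/-- Bounds for the factors of a finite product on a set `{s | |Re s| ≤ B, T ≤ |Im s|}` multiply. -/
lemma exists_norm_prod_le {ι : Type*} (S : Finset ι) (f : ι → ℂ → ℂ) (B η : ℝ)
    (h : ∀ i ∈ S, ∃ C T, 0 ≤ C ∧ ∀ s : ℂ, |s.re| ≤ B → T ≤ |s.im| →
      ‖f i s‖ ≤ C * Real.exp (η * |s.im|)) :
    ∃ C T, 0 ≤ C ∧ ∀ s : ℂ, |s.re| ≤ B → T ≤ |s.im| →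
      ‖∏ i ∈ S, f i s‖ ≤ C * Real.exp (S.card * η * |s.im|) := by
  classical
  induction S using Finset.induction_on with
  | empty => exact ⟨1, 0, by simp, by simp⟩
  | insert a S ha ih =>
    obtain ⟨C₁, T₁, h₁, h₁'⟩ := h a (by simp)
    obtain ⟨C₂, T₂, h₂, h₂'⟩ := ih fun i hi => h i (by simp [hi])
    refine ⟨C₁ * C₂, max T₁ T₂, by positivity, fun s hs hT => ?_⟩
    rw [Finset.prod_insert ha, norm_mul, Finset.card_insert_of_notMem ha]
    have := mul_le_mul (h₁' s hs ((le_max_left _ _).trans hT))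
      (h₂' s hs ((le_max_right _ _).trans hT)) (norm_nonneg _) (by positivity)
    refine this.trans (le_of_eq ?_)
    rw [mul_mul_mul_comm, ← Real.exp_add]
    push_cast
    ring_nf

/-! ### The Mellin–Barnes integrand -/

/-- The Mellin–Barnes integrand with parameters `α = 1/(βc)`, `δ = 1/(βd)`. -/
def barnes {L M : ℕ} (α : Fin L → ℂ) (δ : Fin M → ℂ) (k : ℤ) (w s : ℂ) : ℂ :=
  Gamma (1 - k - s) * (∏ l, Gamma (s + α l)) * exp (s * w) / ∏ m, Gamma (s - δ m)

/-- The factor of the Mellin–Barnes integrand that is regular at the points `1 - k + j`. -/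
def barnesRegular {L M : ℕ} (α : Fin L → ℂ) (δ : Fin M → ℂ) (w s : ℂ) : ℂ :=
  (∏ l, Gamma (s + α l)) * exp (s * w) / ∏ m, Gamma (s - δ m)

/-- The sum of these terms is the sum of the residues, with negative sign, at the points
`1 - k + j`. -/
def barnesTerm {L M : ℕ} (α : Fin L → ℂ) (δ : Fin M → ℂ) (k : ℤ) (w : ℂ) (j : ℕ) : ℂ :=
  (-1) ^ j / (j.factorial : ℂ) * barnesRegular α δ w (1 - k + j)

/-- The poles of the factors `Γ(s + α_l)`. -/
def gammaLeftPoles {L : ℕ} (α : Fin L → ℂ) : Set ℂ := {s | ∃ l, ∃ i : ℕ, s = -α l - i}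

/-- The poles of the factor `Γ(1 - k - s)`. -/
def gammaRightPoles (k : ℤ) : Set ℂ := {s | ∃ i : ℕ, s = 1 - k + i}

/-- The factor by which `barnes` changes from `s` to `s + 1`. -/
def barnesRatio {L M : ℕ} (α : Fin L → ℂ) (δ : Fin M → ℂ) (k : ℤ) (w s : ℂ) : ℂ :=
  exp w * (∏ l, (s + α l)) / (∏ m, (s - δ m)) / (-k - s)

/-- Since Γ(z) = Γ(z+1)/z, the residue of Γ at -(n+1) is the one at -n divided by -(n+1). -/
lemma Complex.tendsto_add_nat_mul_Gamma (n : ℕ) :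
    Tendsto (fun z => (z + n) * Gamma z) (𝓝[≠] (-n : ℂ)) (𝓝 ((-1) ^ n / (n.factorial : ℂ))) := by
  induction n with
  | zero => simpa using tendsto_self_mul_Gamma_nhds_zero
  | succ n ih =>
    have h1 : Tendsto (fun z : ℂ => z + 1) (𝓝[≠] (-(n + 1 : ℕ) : ℂ)) (𝓝[≠] (-n : ℂ)) := by
      refine tendsto_nhdsWithin_of_tendsto_nhds_of_eventually_within _ ?_ ?_
      · exact ((continuous_add_const 1).tendsto' _ _ (by push_cast; ring)).mono_left
          nhdsWithin_le_nhds
      · filter_upwards [self_mem_nhdsWithin] with z hz h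
        refine hz ?_
        have : z + 1 = -n := h
        simp only [Set.mem_singleton_iff]
        push_cast
        linear_combination this
    have hn : (-(n + 1 : ℕ) : ℂ) ≠ 0 := by
      rw [neg_ne_zero]
      exact_mod_cast Nat.succ_ne_zero n
    have h2 : Tendsto (fun z : ℂ => z⁻¹) (𝓝[≠] (-(n + 1 : ℕ) : ℂ)) (𝓝 (-(n + 1 : ℕ) : ℂ)⁻¹) :=
      (tendsto_inv₀ hn).mono_left nhdsWithin_le_nhds
    have h3 := (ih.comp h1).mul h2
    have h4 : (-1) ^ n / (n.factorial : ℂ) * (-(n + 1 : ℕ) : ℂ)⁻¹ =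
        (-1) ^ (n + 1) / ((n + 1).factorial : ℂ) := by
      have : (n.factorial : ℂ) ≠ 0 := by exact_mod_cast n.factorial_ne_zero
      have : (n + 1 : ℂ) ≠ 0 := Nat.cast_add_one_ne_zero n
      rw [Nat.factorial_succ]
      push_cast
      field_simp
      ring
    rw [h4] at h3
    refine h3.congr' ?_
    filter_upwards [nhdsWithin_le_nhds (isOpen_ne.mem_nhds hn)] with z hz
    have : z ≠ 0 := hz
    simp only [Function.comp]
    rw [Gamma_add_one z this]
    push_cast
    field_simp
    ring

section Barnes

variable {L M : ℕ} {α : Fin L → ℂ} {δ : Fin M → ℂ} {k : ℤ}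

/-- `Gamma` takes the value 0 at its poles, so its inverse is the true value of the entire function
1/Γ there. The denominator therefore never creates poles. -/
lemma differentiable_inv_prod_Gamma (δ : Fin M → ℂ) :
    Differentiable ℂ (fun s => (∏ m, Gamma (s - δ m))⁻¹) := by
  simp_rw [← Finset.prod_inv_distrib]
  refine Differentiable.fun_finsetProd fun m _ => ?_
  exact differentiable_one_div_Gamma.comp (f := fun s => s - δ m) (by fun_prop)

lemma differentiableAt_barnesRegular (w : ℂ) {s : ℂ} (hs : s ∉ gammaLeftPoles α) :
    DifferentiableAt ℂ (barnesRegular α δ w) s := by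
  unfold barnesRegular
  simp_rw [div_eq_mul_inv]
  refine DifferentiableAt.mul (DifferentiableAt.mul ?_ (by fun_prop))
    (differentiable_inv_prod_Gamma δ s)
  refine DifferentiableAt.fun_finsetProd fun l _ => ?_
  refine (differentiableAt_Gamma (s + α l) fun i hi => hs ⟨l, i, ?_⟩).comp s (by fun_prop)
  linear_combination hi

lemma barnes_eq_Gamma_mul (w s : ℂ) :
    barnes α δ k w s = Gamma (1 - k - s) * barnesRegular α δ w s := by
  unfold barnes barnesRegular
  ring

lemma differentiableAt_barnes (w : ℂ) {s : ℂ} (hs : s ∉ gammaLeftPoles α)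
    (hs' : s ∉ gammaRightPoles k) : DifferentiableAt ℂ (barnes α δ k w) s := by
  rw [funext (barnes_eq_Gamma_mul w)]
  refine DifferentiableAt.mul ?_ (differentiableAt_barnesRegular w hs)
  refine (differentiableAt_Gamma (1 - k - s) fun i hi => hs' ⟨i, ?_⟩).comp s (by fun_prop)
  linear_combination -hi

/-- Needed at the left poles too, whose order is arbitrary because the α_l may coincide modulo
integers. -/
lemma meromorphicAt_barnes (w s : ℂ) : MeromorphicAt (barnes α δ k w) s := by
  have hG : ∀ {g : ℂ → ℂ}, AnalyticAt ℂ g s → MeromorphicAt (fun s => Gamma (g s)) s := fun {g} hg =>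
    (Meromorphic.Gamma (g s)).comp_analyticAt hg
  rw [funext (barnes_eq_Gamma_mul w)]
  refine MeromorphicAt.fun_mul (hG (by fun_prop)) ?_
  unfold barnesRegular
  refine MeromorphicAt.fun_div (MeromorphicAt.fun_mul ?_ ?_) ?_
  · exact MeromorphicAt.fun_prod fun l _ => hG (by fun_prop)
  · exact AnalyticAt.meromorphicAt (by fun_prop)
  · exact MeromorphicAt.fun_prod fun l _ => hG (by fun_prop)

/-- The residue of the integrand at the pole `1 - k + j`. -/
lemma tendsto_sub_mul_barnes (w : ℂ) (j : ℕ) (hj : (1 - k + j : ℂ) ∉ gammaLeftPoles α) :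
    Tendsto (fun s => (s - (1 - k + j)) * barnes α δ k w s) (𝓝[≠] (1 - k + j : ℂ))
      (𝓝 (-barnesTerm α δ k w j)) := by
  have h1 : Tendsto (fun s : ℂ => 1 - k - s) (𝓝[≠] (1 - k + j : ℂ)) (𝓝[≠] (-j : ℂ)) := by
    refine tendsto_nhdsWithin_of_tendsto_nhds_of_eventually_within _ ?_ ?_
    · have : Continuous fun s : ℂ => 1 - k - s := by fun_prop
      exact (this.tendsto' _ _ (by ring)).mono_left nhdsWithin_le_nhds
    · filter_upwards [self_mem_nhdsWithin] with z hz h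
      refine hz ?_
      have : 1 - k - z = -j := h
      simp only [Set.mem_singleton_iff]
      linear_combination -this
  have h2 := ((Complex.tendsto_add_nat_mul_Gamma j).comp h1).neg
  have h3 := ((differentiableAt_barnesRegular (δ := δ) w hj).continuousAt.tendsto).mono_left
    (nhdsWithin_le_nhds (s := {(1 - k + j : ℂ)}ᶜ))
  have h4 := h2.mul h3
  have h5 : -((-1) ^ j / (j.factorial : ℂ)) * barnesRegular α δ w (1 - k + j) =
      -barnesTerm α δ k w j := by
    unfold barnesTerm
    ring
  rw [h5] at h4
  refine h4.congr fun s => ?_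
  rw [barnes_eq_Gamma_mul]
  simp only [Function.comp]
  ring

lemma barnesRegular_add_one (w : ℂ) {s : ℂ} (h1 : ∀ l, s + α l ≠ 0) (h2 : ∀ m, s - δ m ≠ 0) :
    barnesRegular α δ w (s + 1) =
      barnesRegular α δ w s * (exp w * (∏ l, (s + α l)) / (∏ m, (s - δ m))) := by
  have e1 : ∏ l, Gamma (s + 1 + α l) = (∏ l, (s + α l)) * ∏ l, Gamma (s + α l) := by
    rw [← Finset.prod_mul_distrib]
    refine Finset.prod_congr rfl fun l _ => ?_
    rw [← Gamma_add_one _ (h1 l)]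
    ring_nf
  have e2 : ∏ m, Gamma (s + 1 - δ m) = (∏ m, (s - δ m)) * ∏ m, Gamma (s - δ m) := by
    rw [← Finset.prod_mul_distrib]
    refine Finset.prod_congr rfl fun m _ => ?_
    rw [← Gamma_add_one _ (h2 m)]
    ring_nf
  unfold barnesRegular
  rw [e1, e2, add_mul, one_mul, exp_add]
  simp only [div_eq_mul_inv, mul_inv]
  ring

lemma barnes_add_one (w : ℂ) {s : ℂ} (h1 : ∀ l, s + α l ≠ 0) (h2 : ∀ m, s - δ m ≠ 0)
    (h3 : (-k - s : ℂ) ≠ 0) :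
    barnes α δ k w (s + 1) = barnes α δ k w s * barnesRatio α δ k w s := by
  have e : Gamma (1 - k - s) = (-k - s) * Gamma (-k - s) := by
    rw [← Gamma_add_one _ h3]
    ring_nf
  rw [barnes_eq_Gamma_mul, barnes_eq_Gamma_mul, barnesRegular_add_one w h1 h2, e, barnesRatio]
  have : (1 - k - (s + 1) : ℂ) = -k - s := by ring
  rw [this]
  field_simp

lemma barnesTerm_succ (w : ℂ) {j : ℕ} (h1 : ∀ l, (1 - k + j : ℂ) + α l ≠ 0)
    (h2 : ∀ m, (1 - k + j : ℂ) - δ m ≠ 0) :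
    barnesTerm α δ k w (j + 1) = barnesTerm α δ k w j * barnesRatio α δ k w (1 - k + j) := by
  have e : (1 - k + (j + 1 : ℕ) : ℂ) = 1 - k + j + 1 := by push_cast; ring
  have e' : (-k - (1 - k + j) : ℂ) = -(j + 1) := by ring
  rw [barnesTerm, barnesTerm, e, barnesRegular_add_one w h1 h2, barnesRatio, Nat.factorial_succ, e']
  have : (j + 1 : ℂ) ≠ 0 := Nat.cast_add_one_ne_zero j
  have : (j.factorial : ℂ) ≠ 0 := by exact_mod_cast j.factorial_ne_zero
  push_cast
  rw [pow_succ]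
  field_simp

/-- The ratio behaves like -e^w s^{L-M-1} at infinity. Its modulus tends to 0 if L ≤ M, and to |e^w|
= e^{Re w} < 1 in the boundary case L = M + 1. -/
lemma exists_norm_barnesRatio_le (α : Fin L → ℂ) (δ : Fin M → ℂ) (k : ℤ) {w : ℂ}
    (h : L ≤ M ∨ (L = M + 1 ∧ w.re < 0)) :
    ∃ A r : ℝ, 0 < r ∧ r < 1 ∧ ∀ s : ℂ, A ≤ s.re →
      (∀ l, s + α l ≠ 0) ∧ (∀ m, s - δ m ≠ 0) ∧ (-k - s : ℂ) ≠ 0 ∧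
        ‖barnesRatio α δ k w s‖ ≤ r := by
  have hlin : ∀ a : ℂ, Tendsto (fun s => (s + a) / s) (Bornology.cobounded ℂ) (𝓝 1) := fun a => by
    have h0 : Tendsto (fun s : ℂ => 1 + a * s⁻¹) (Bornology.cobounded ℂ) (𝓝 (1 + a * 0)) :=
      (tendsto_inv₀_cobounded.const_mul a).const_add 1
    rw [mul_zero, add_zero] at h0
    refine h0.congr' ?_
    filter_upwards [Bornology.eventually_ne_cobounded (0 : ℂ)] with s hs
    field_simp
  have hne : ∀ a : ℂ, ∀ᶠ s in Bornology.cobounded ℂ, s + a ≠ 0 := fun a => by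
    filter_upwards [Bornology.eventually_ne_cobounded (-a)] with s hs h
    exact hs (by linear_combination h)
  have hLM : L ≤ M + 1 := by omega
  obtain ⟨ℓ, hℓ, hℓ'⟩ : ∃ ℓ : ℂ, ‖exp w * ℓ‖ < 1 ∧
      Tendsto (fun s : ℂ => (s⁻¹) ^ (M + 1 - L)) (Bornology.cobounded ℂ) (𝓝 ℓ) := by
    rcases h with h | ⟨h, hw⟩
    · refine ⟨0, by simp, ?_⟩
      have := (tendsto_inv₀_cobounded (α := ℂ)).pow (M + 1 - L)
      rwa [zero_pow (by omega)] at this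
    · refine ⟨1, ?_, ?_⟩
      · rw [mul_one, norm_exp]
        simpa using Real.exp_lt_exp.2 hw
      · simp [h]
  have hq : Tendsto (fun s : ℂ => exp w * (s⁻¹) ^ (M + 1 - L) * (∏ l, ((s + α l) / s)) /
      (∏ m, ((s + -δ m) / s)) / (-((s + k) / s))) (Bornology.cobounded ℂ)
      (𝓝 (exp w * ℓ * (∏ _l : Fin L, 1) / (∏ _m : Fin M, 1) / (-1))) := by
    refine Tendsto.div (Tendsto.div ((hℓ'.const_mul _).mul
      (tendsto_finsetProd _ fun l _ => hlin _)) (tendsto_finsetProd _ fun m _ => hlin _)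
      (by simp)) (hlin _).neg (by simp)
  have hq' := hq.norm
  -- The maximum with 0 makes r positive, so that log r can be used later.
  obtain ⟨r, hr1, hr2⟩ := exists_between (max_lt hℓ zero_lt_one)
  have hlim : ‖exp w * ℓ * (∏ _l : Fin L, (1 : ℂ)) / (∏ _m : Fin M, (1 : ℂ)) / (-1)‖ < r := by
    simpa using lt_of_le_of_lt (le_max_left _ _) hr1
  have hev : ∀ᶠ s in Bornology.cobounded ℂ, (∀ l, s + α l ≠ 0) ∧ (∀ m, s - δ m ≠ 0) ∧
      (-k - s : ℂ) ≠ 0 ∧ ‖barnesRatio α δ k w s‖ ≤ r := by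
    filter_upwards [hq'.eventually_lt_const hlim, eventually_all.2 fun l => hne (α l),
      eventually_all.2 fun m => hne (-δ m), hne k, Bornology.eventually_ne_cobounded (0 : ℂ)]
      with s h1 h2 h3 h4 h5
    refine ⟨h2, fun m => by simpa [sub_eq_add_neg] using h3 m, fun h => h4 (by
      linear_combination -h), ?_⟩
    refine le_of_eq_of_le ?_ h1.le
    congr 1
    have e : s ^ (M + 1) = s ^ (M + 1 - L) * s ^ L := by
      rw [← pow_add, Nat.sub_add_cancel hLM]
    have h3' : ∏ m, (s + -δ m) ≠ 0 := Finset.prod_ne_zero_iff.2 fun m _ => h3 m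
    have hk : (-k - s : ℂ) = -(s + k) := by ring
    rw [barnesRatio, Finset.prod_div_distrib, Finset.prod_div_distrib, hk]
    simp only [Finset.prod_const, Finset.card_univ, Fintype.card_fin, sub_eq_add_neg]
    have hinv : (1 / s) ^ (M + 1 - L) * s ^ (M + 1 - L) = 1 := by
      rw [← mul_pow, one_div_mul_cancel h5, one_pow]
    field_simp
    generalize M + 1 - L = n at e hinv ⊢
    generalize (1 / s) ^ n = x at hinv ⊢
    linear_combination (∏ l, (s + α l)) * x * e + (∏ l, (s + α l)) * s ^ L * hinv
  rw [← comap_norm_atTop, (atTop_basis.comap _).eventually_iff] at hev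
  obtain ⟨A, -, hA⟩ := hev
  refine ⟨A, r, (le_max_right _ _).trans_lt hr1, hr2, fun s hs => hA ?_⟩
  exact hs.trans ((le_abs_self _).trans (abs_re_le_norm s))

/-- Exponential decay of the integrand in vertical strips. -/
lemma exists_norm_barnes_le (α : Fin L → ℂ) (δ : Fin M → ℂ) (k : ℤ) (B : ℝ) {η : ℝ}
    (hη : η < ((L : ℝ) - M + 1) * Real.pi / 2) :
    ∃ C T, 0 ≤ C ∧ ∀ s w : ℂ, |s.re| ≤ B → T ≤ |s.im| →
      ‖barnes α δ k w s‖ ≤ C * Real.exp (-(η * |s.im|)) * Real.exp (s * w).re := by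
  -- Each Gamma factor decays with rate θ = π/2 - ε, each inverse one grows with rate π - θ. The
  -- total rate is (L-M+1)π/2 - ε(L+M+1), and ε is chosen so that this is at least η; the minimum
  -- keeps θ ≥ 0.
  set ε := min (Real.pi / 2) ((((L : ℝ) - M + 1) * Real.pi / 2 - η) / (L + M + 1)) with hε
  have hpos : (0 : ℝ) < L + M + 1 := by positivity
  have hε₀ : 0 < ε := lt_min (by positivity) (div_pos (by linarith) hpos)
  have hε₁ : ε ≤ Real.pi / 2 := min_le_left _ _
  have hε₂ : ε * (L + M + 1) ≤ ((L : ℝ) - M + 1) * Real.pi / 2 - η := by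
    rw [← le_div_iff₀ hpos]
    exact min_le_right _ _
  set θ := Real.pi / 2 - ε with hθ
  have hθ₀ : 0 ≤ θ := by linarith
  have hθ₁ : θ < Real.pi / 2 := by linarith
  obtain ⟨C₁, T₁, h₁, h₁'⟩ := exists_norm_Gamma_sub_le (1 - k) B hθ₀ hθ₁
  obtain ⟨C₂, T₂, h₂, h₂'⟩ := exists_norm_prod_le Finset.univ (fun l s => Gamma (s + α l)) B (-θ)
    fun l _ => by
      simpa only [neg_mul] using exists_norm_Gamma_add_le (α l) B hθ₀ hθ₁
  obtain ⟨C₃, T₃, h₃, h₃'⟩ := exists_norm_prod_le Finset.univ (fun m s => (Gamma (s - δ m))⁻¹) B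
    (Real.pi - θ) fun m _ => by
      simpa only [← sub_eq_add_neg] using exists_norm_inv_Gamma_add_le (-δ m) B hθ₀ hθ₁
  refine ⟨C₁ * C₂ * C₃, max T₁ (max T₂ T₃), by positivity, fun s w hs hT => ?_⟩
  simp only [max_le_iff] at hT
  have e : barnes α δ k w s = Gamma (1 - k - s) * (∏ l, Gamma (s + α l)) *
      (∏ m, (Gamma (s - δ m))⁻¹) * exp (s * w) := by
    rw [barnes, Finset.prod_inv_distrib]
    ring
  rw [e, norm_mul, norm_mul, norm_mul, norm_exp]
  simp only [Finset.card_univ, Fintype.card_fin] at h₂' h₃'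
  have hG := mul_le_mul (mul_le_mul (h₁' s hs hT.1) (h₂' s hs hT.2.1) (norm_nonneg _)
    (by positivity)) (h₃' s hs hT.2.2) (norm_nonneg _) (by positivity)
  refine mul_le_mul_of_nonneg_right (hG.trans ?_) (Real.exp_pos _).le
  have e2 : C₁ * Real.exp (-(θ * |s.im|)) * (C₂ * Real.exp (L * -θ * |s.im|)) *
      (C₃ * Real.exp (M * (Real.pi - θ) * |s.im|)) = C₁ * C₂ * C₃ *
      Real.exp (-(θ * |s.im|) + L * -θ * |s.im| + M * (Real.pi - θ) * |s.im|) := by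
    rw [Real.exp_add, Real.exp_add]
    ring
  rw [e2]
  refine mul_le_mul_of_nonneg_left (Real.exp_le_exp.2 ?_) (by positivity)
  have hfac : -(θ * |s.im|) + L * -θ * |s.im| + M * (Real.pi - θ) * |s.im| =
      -((((L : ℝ) - M + 1) * Real.pi / 2 - ε * (L + M + 1)) * |s.im|) := by
    rw [hθ]
    ring
  rw [hfac, neg_le_neg_iff]
  exact mul_le_mul_of_nonneg_right (by linarith) (abs_nonneg _)

end Barnes

/-! ### The coefficients `ρ_j` -/

section Rho

variable {L M : ℕ} {c : Fin L → ℂ} {d : Fin M → ℂ} {β : ℂ} {k : ℤ}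

lemma barnesIntegrand_eq (c : Fin L → ℂ) (d : Fin M → ℂ) (β : ℂ) (k : ℤ) (w : ℂ) :
    barnesIntegrand c d β k w =
      barnes (fun l => 1 / (β * c l)) (fun m => 1 / (β * d m)) k w := rfl

lemma kappa_ne_zero (hβ : β ≠ 0) (hc0 : ∀ l, c l ≠ 0) (hd0 : ∀ m, d m ≠ 0) :
    kappa c d β ≠ 0 :=
  div_ne_zero (mul_ne_zero (pow_ne_zero _ (by norm_num))
    (Finset.prod_ne_zero_iff.2 fun l _ => mul_ne_zero hβ (hc0 l)))
    (Finset.prod_ne_zero_iff.2 fun m _ => mul_ne_zero hβ (hd0 m))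

/-- Pulling βc_l and -βd_m out of the linear factors leaves monic factors, and κ collects the
constants. -/
lemma rationalWeight_mul (hβ : β ≠ 0) (hc0 : ∀ l, c l ≠ 0) (hd0 : ∀ m, d m ≠ 0) (z : ℂ) :
    rationalWeight c d (z * β) =
      kappa c d β * (∏ l, (z + 1 / (β * c l))) / ∏ m, (z - 1 / (β * d m)) := by
  have h1 : ∏ l, (1 + c l * (z * β)) = (∏ l, β * c l) * ∏ l, (z + 1 / (β * c l)) := by
    rw [← Finset.prod_mul_distrib]
    refine Finset.prod_congr rfl fun l _ => ?_
    have := hc0 l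
    field_simp
    ring
  have h2 : ∏ m, (1 - d m * (z * β)) =
      (-1) ^ M * (∏ m, β * d m) * ∏ m, (z - 1 / (β * d m)) := by
    have : ((-1 : ℂ)) ^ M = ∏ _m : Fin M, (-1 : ℂ) := by simp
    rw [this, ← Finset.prod_mul_distrib, ← Finset.prod_mul_distrib]
    refine Finset.prod_congr rfl fun m _ => ?_
    have := hd0 m
    field_simp
    ring
  have h3 : ((-1 : ℂ) ^ M)⁻¹ = (-1) ^ M := by
    rw [← inv_pow]
    norm_num
  rw [rationalWeight, h1, h2, kappa]
  simp only [div_eq_mul_inv, mul_inv, h3]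
  ring

lemma rho_ofNat (n : ℕ) :
    rho c d β (n : ℤ) = β ^ n * ∏ i ∈ Finset.Icc 1 n, rationalWeight c d (i * β) := rfl

lemma rho_negSucc (n : ℕ) :
    rho c d β (-(n + 1 : ℕ) : ℤ) =
      (β ^ (n + 1))⁻¹ * ∏ i ∈ Finset.Icc 1 n, (rationalWeight c d (-(i * β)))⁻¹ := rfl

/-- `∏ Γ(z + 1 + α_l) / ∏ Γ(z + 1 - δ_m)`. -/
def gammaQuotient (α : Fin L → ℂ) (δ : Fin M → ℂ) (z : ℂ) : ℂ :=
  (∏ l, Gamma (z + 1 + α l)) / ∏ m, Gamma (z + 1 - δ m)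

/-- Only the numerator needs nonvanishing factors: 1/Γ(z) = z/Γ(z+1) also holds at the poles of Γ.
-/
lemma gammaQuotient_mul {α : Fin L → ℂ} (δ : Fin M → ℂ) {z : ℂ} (h : ∀ l, z + 1 + α l ≠ 0) :
    gammaQuotient α δ z * ∏ l, (z + 1 + α l) =
      gammaQuotient α δ (z + 1) * ∏ m, (z + 1 - δ m) := by
  have h1 : ∏ l, Gamma (z + 1 + 1 + α l) = (∏ l, (z + 1 + α l)) * ∏ l, Gamma (z + 1 + α l) := by
    rw [← Finset.prod_mul_distrib]
    refine Finset.prod_congr rfl fun l _ => ?_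
    rw [← Gamma_add_one _ (h l)]
    ring_nf
  have h2 : (∏ m, Gamma (z + 1 - δ m))⁻¹ =
      (∏ m, (z + 1 - δ m)) * (∏ m, Gamma (z + 1 + 1 - δ m))⁻¹ := by
    rw [← Finset.prod_inv_distrib, ← Finset.prod_inv_distrib, ← Finset.prod_mul_distrib]
    refine Finset.prod_congr rfl fun m _ => ?_
    rw [one_div_Gamma_eq_self_mul_one_div_Gamma_add_one]
    ring_nf
  rw [gammaQuotient, gammaQuotient, h1, div_eq_mul_inv, h2, div_eq_mul_inv]
  ring

/-- Both sides satisfy ρ_n = β G(nβ) ρ_{n-1} and agree at n = -1, so induction runs upwards and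
downwards from there. The bound -k ≤ n and the hypothesis on c keep the numerator Gamma functions
away from their poles; the hypothesis on d keeps G(jβ) finite for j ≥ 0. -/
lemma rho_eq (hβ : β ≠ 0) (hc0 : ∀ l, c l ≠ 0) (hd0 : ∀ m, d m ≠ 0)
    (hc : ∀ l, ∀ n : ℤ, n < max k 1 → 1 / (β * c l) ≠ (n : ℂ))
    (hd : ∀ m, ∀ n : ℕ, 1 / (β * d m) ≠ (n : ℂ)) (n : ℤ) (hn : -k ≤ n) :
    rho c d β n = β ^ n * kappa c d β ^ (n + 1) *
      gammaQuotient (fun l => 1 / (β * c l)) (fun m => 1 / (β * d m)) n *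
      ((∏ m, Gamma (-(1 / (β * d m)))) / ∏ l, Gamma (1 / (β * c l))) := by
  have hκ := kappa_ne_zero hβ hc0 hd0
  have hΓc : ∏ l, Gamma (1 / (β * c l)) ≠ 0 := Finset.prod_ne_zero_iff.2 fun l _ =>
    Gamma_ne_zero fun m h => hc l (-m) (by
      have : (1 : ℤ) ≤ max k 1 := le_max_right _ _
      omega) (by rw [h]; push_cast; ring)
  have hΓd : ∏ m, Gamma (-(1 / (β * d m))) ≠ 0 := Finset.prod_ne_zero_iff.2 fun m _ =>
    Gamma_ne_zero fun i h => hd m i (neg_injective h)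
  have hα : ∀ z : ℤ, -(max k 1) ≤ z → ∀ l, (z : ℂ) + 1 + 1 / (β * c l) ≠ 0 := by
    intro z hz l h
    refine hc l (-z - 1) (by omega) ?_
    push_cast
    linear_combination h
  -- At n = -1 the Gamma quotient ∏ Γ(α_l) / ∏ Γ(-δ_m) cancels against the normalizing constant,
  -- leaving ρ_{-1} = 1/β.
  have hbase : rho c d β (-1) = β ^ (-1 : ℤ) * kappa c d β ^ ((-1 : ℤ) + 1) *
      gammaQuotient (fun l => 1 / (β * c l)) (fun m => 1 / (β * d m)) (-1 : ℤ) *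
      ((∏ m, Gamma (-(1 / (β * d m)))) / ∏ l, Gamma (1 / (β * c l))) := by
    have := rho_negSucc (c := c) (d := d) (β := β) 0
    simp only [zero_add, Nat.cast_one] at this
    rw [this, gammaQuotient]
    have h1 : ((-1 : ℤ) : ℂ) + 1 = 0 := by norm_num
    simp only [h1, zero_add, zero_sub]
    rw [neg_add_cancel, zpow_zero, zpow_neg_one]
    field_simp
    simp
  rcases le_total (-1) n with h | h
  · clear hn
    induction n, h using Int.leInduction with
    | base => exact hbase
    | succ n h ih =>
      obtain ⟨j, rfl⟩ : ∃ j : ℕ, n = j - 1 := ⟨(n + 1).toNat, by omega⟩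
      have hδ : ∏ m, ((j : ℂ) - 1 / (β * d m)) ≠ 0 := Finset.prod_ne_zero_iff.2 fun m _ h =>
        hd m j (by linear_combination -h)
      have hrec : rho c d β (j : ℤ) = rho c d β ((j : ℤ) - 1) * β * rationalWeight c d (j * β) := by
        -- The recursion also holds across the change of definition from ρ_{-1} to ρ_0, because G(0)
        -- = 1.
        rcases j with _ | j
        · have := rho_negSucc (c := c) (d := d) (β := β) 0
          simp only [zero_add, Nat.cast_one] at this
          have h0 : ((0 : ℕ) : ℤ) - 1 = -1 := by norm_num
          rw [h0, this, rho_ofNat]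
          simp [rationalWeight, hβ]
        · have : ((j + 1 : ℕ) : ℤ) - 1 = j := by push_cast; ring
          rw [this, rho_ofNat, rho_ofNat, Finset.prod_Icc_succ_top (by omega), pow_succ]
          ring
      have hq := gammaQuotient_mul (α := fun l => 1 / (β * c l)) (fun m => 1 / (β * d m))
        (hα ((j : ℤ) - 1) (by
          have : (1 : ℤ) ≤ max k 1 := le_max_right _ _
          omega))
      have e : (((j : ℤ) - 1 : ℤ) : ℂ) + 1 = j := by push_cast; ring
      simp only [e] at hq
      rw [sub_add_cancel, hrec, ih, rationalWeight_mul hβ hc0 hd0, sub_add_cancel,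
        zpow_add_one₀ hκ, zpow_sub_one₀ hβ]
      rw [← div_eq_iff hδ] at hq
      simp only [Int.cast_natCast]
      rw [← hq]
      field_simp
  · induction n, h using Int.leInductionDown with
    | base => exact hbase
    | pred n h ih =>
      obtain ⟨j, rfl⟩ : ∃ j : ℕ, n = -(j + 1 : ℕ) := ⟨(-n - 1).toNat, by omega⟩
      have hrec : rho c d β (-(j + 1 : ℕ) - 1 : ℤ) = rho c d β (-(j + 1 : ℕ) : ℤ) * β⁻¹ *
          (rationalWeight c d ((-(j + 1 : ℕ) : ℤ) * β))⁻¹ := by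
        have : (-(j + 1 : ℕ) - 1 : ℤ) = -((j + 1) + 1 : ℕ) := by push_cast; ring
        rw [this, rho_negSucc, rho_negSucc, Finset.prod_Icc_succ_top (by omega), pow_succ, mul_inv]
        push_cast
        rw [neg_mul]
        ring
      have hα' := hα (-(j + 1 : ℕ) - 1) (by
        have : k ≤ max k 1 := le_max_left _ _
        omega)
      have hq := gammaQuotient_mul (α := fun l => 1 / (β * c l)) (fun m => 1 / (β * d m)) hα'
      have e : ((-(j + 1 : ℕ) - 1 : ℤ) : ℂ) + 1 = ((-(j + 1 : ℕ) : ℤ) : ℂ) := by push_cast; ring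
      simp only [e] at hq hα'
      -- Only the factors n + α_l have to be nonzero here. If some n - δ_m vanishes, then nβ is a
      -- pole of G, and both sides are 0 by the convention 1/G = 0.
      have hα'' : ∏ l, (((-(j + 1 : ℕ) : ℤ) : ℂ) + 1 / (β * c l)) ≠ 0 :=
        Finset.prod_ne_zero_iff.2 fun l _ => hα' l
      rw [← eq_div_iff hα''] at hq
      rw [hrec, ih (by omega), rationalWeight_mul hβ hc0 hd0, sub_add_cancel, zpow_sub_one₀ hβ,
        zpow_add_one₀ hκ, hq]
      rw [inv_div]
      field_simp

/-- The terms of `φ_k` are, up to the factor `C_k`, the residues of the integrand. -/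
lemma phiTerm_eq (hβ : β ≠ 0) (hc0 : ∀ l, c l ≠ 0) (hd0 : ∀ m, d m ≠ 0)
    (hc : ∀ l, ∀ n : ℤ, n < max k 1 → 1 / (β * c l) ≠ (n : ℂ))
    (hd : ∀ m, ∀ n : ℕ, 1 / (β * d m) ≠ (n : ℂ)) {x w : ℂ}
    (hw : exp w = -(kappa c d β * x)) (j : ℕ) :
    phiTerm c d β k x j = constC c d β k *
      barnesTerm (fun l => 1 / (β * c l)) (fun m => 1 / (β * d m)) k w j := by
  have hκ := kappa_ne_zero hβ hc0 hd0
  have hx : x ≠ 0 := by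
    rintro rfl
    simp at hw
  have hexp : exp ((1 - k + j) * w) = (-(kappa c d β * x)) ^ ((j : ℤ) - k + 1) := by
    rw [← hw, ← exp_int_mul]
    push_cast
    ring_nf
  have e1 : (1 - k + j : ℂ) = (((j : ℤ) - k : ℤ) : ℂ) + 1 := by push_cast; ring
  -- The sign (-1)^j of the residue of Γ and the sign of (-κx)^(j-k+1) combine to one that does not
  -- depend on j; the factor (-β)^(k-1) in C_k absorbs it.
  have hneg : ((-1 : ℂ)) ^ j * (-1) ^ ((j : ℤ) - k + 1) = (-1) ^ (k - 1) := by
    have h1 : ((-1 : ℂ)) ^ ((j : ℤ) - k + 1) = (-1) ^ j * ((-1) ^ (k - 1))⁻¹ := by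
      rw [← zpow_natCast, ← zpow_neg, ← zpow_add₀ (by norm_num)]
      ring_nf
    rw [h1, ← mul_assoc, ← mul_pow]
    simp [← inv_zpow]
  have hβ1 : β ^ ((j : ℤ) - k) * β ^ (k - 1) * β = β ^ j := by
    rw [← zpow_add₀ hβ, ← zpow_add_one₀ hβ, ← zpow_natCast]
    ring_nf
  have hx1 : x ^ ((j : ℤ) - k + 1) = x ^ (1 - k) * x ^ j := by
    rw [← zpow_natCast x j, ← zpow_add₀ hx]
    ring_nf
  rw [phiTerm, rho_eq hβ hc0 hd0 hc hd _ (by omega), constC, barnesTerm, barnesRegular,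
    gammaQuotient, hexp, e1, ← neg_one_mul β, ← neg_one_mul (kappa c d β * x), mul_zpow, mul_zpow, mul_zpow, hx1,
    ← hneg, div_pow, ← hβ1]
  have h3 : β ^ ((j : ℤ) - k) ≠ 0 := zpow_ne_zero _ hβ
  have h4 : β ^ (k - 1) ≠ 0 := zpow_ne_zero _ hβ
  have h5 : ((-1 : ℂ)) ^ ((j : ℤ) - k + 1) ≠ 0 := zpow_ne_zero _ (by norm_num)
  have h6 : ((-1 : ℂ)) ^ j ≠ 0 := pow_ne_zero _ (by norm_num)
  generalize β ^ ((j : ℤ) - k) = b1 at *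
  generalize β ^ (k - 1) = b2 at *
  generalize ((-1 : ℂ)) ^ ((j : ℤ) - k + 1) = b3 at *
  generalize ((-1 : ℂ)) ^ j = b4 at *
  generalize kappa c d β ^ ((j : ℤ) - k + 1) = b5
  simp only [div_eq_mul_inv, mul_inv]
  field_simp

/-- The terms j = 0 agree, and both sides have the ratio κx/(j+1) · ∏(j-k+1+α_l) / ∏(j-k+1-δ_m) of
consecutive terms. The extra hypothesis on d makes the denominators nonzero. -/
lemma phiTerm_eq_hypergeometricTerm (hβ : β ≠ 0) (hc0 : ∀ l, c l ≠ 0) (hd0 : ∀ m, d m ≠ 0)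
    (hc : ∀ l, ∀ n : ℤ, n < max k 1 → 1 / (β * c l) ≠ (n : ℂ))
    (hd : ∀ m, ∀ n : ℕ, 1 / (β * d m) ≠ (n : ℂ))
    (hk : ∀ m, ∀ n : ℕ, 1 - (k : ℂ) - 1 / (β * d m) ≠ -(n : ℂ)) (x : ℂ) (j : ℕ) :
    phiTerm c d β k x j =
      β * rho c d β (-k) * x ^ (1 - k) *
        hypergeometricTerm (fun l => 1 - (k : ℂ) + 1 / (β * c l))
          (fun m => 1 - (k : ℂ) - 1 / (β * d m)) (kappa c d β * x) j := by
  induction j with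
  | zero =>
    simp [phiTerm, hypergeometricTerm]
    ring
  | succ j ih =>
    have hκ := kappa_ne_zero hβ hc0 hd0
    have hα : ∀ l, (((j : ℤ) - k : ℤ) : ℂ) + 1 + 1 / (β * c l) ≠ 0 := fun l h =>
      hc l (k - j - 1) (by
        have : k ≤ max k 1 := le_max_left _ _
        omega) (by
        push_cast at h ⊢
        linear_combination h)
    have hδ : ∏ m, ((((j : ℤ) - k : ℤ) : ℂ) + 1 - 1 / (β * d m)) ≠ 0 :=
      Finset.prod_ne_zero_iff.2 fun m _ h => hk m j (by
        push_cast at h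
        linear_combination h)
    have hq := gammaQuotient_mul (α := fun l => 1 / (β * c l)) (fun m => 1 / (β * d m)) hα
    rw [← div_eq_iff hδ] at hq
    have hrho : rho c d β ((j + 1 : ℕ) - k : ℤ) = rho c d β ((j : ℤ) - k) * β * kappa c d β *
        ((∏ l, ((((j : ℤ) - k : ℤ) : ℂ) + 1 + 1 / (β * c l))) /
          ∏ m, ((((j : ℤ) - k : ℤ) : ℂ) + 1 - 1 / (β * d m))) := by
      have e : ((j + 1 : ℕ) - k : ℤ) = (j : ℤ) - k + 1 := by push_cast; ring
      have e' : (((j : ℤ) - k + 1 : ℤ) : ℂ) = (((j : ℤ) - k : ℤ) : ℂ) + 1 := by push_cast; ring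
      rw [rho_eq hβ hc0 hd0 hc hd _ (by omega), rho_eq hβ hc0 hd0 hc hd _ (by omega), e, e', ← hq,
        zpow_add_one₀ hκ, zpow_add_one₀ hβ]
      ring
    have hphi : phiTerm c d β k x (j + 1) = phiTerm c d β k x j * (kappa c d β * x / (j + 1)) *
        ((∏ l, ((((j : ℤ) - k : ℤ) : ℂ) + 1 + 1 / (β * c l))) /
          ∏ m, ((((j : ℤ) - k : ℤ) : ℂ) + 1 - 1 / (β * d m))) := by
      rw [phiTerm, phiTerm, hrho, Nat.factorial_succ, pow_succ]
      push_cast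
      field_simp
    have hhyp : hypergeometricTerm (fun l => 1 - (k : ℂ) + 1 / (β * c l))
          (fun m => 1 - (k : ℂ) - 1 / (β * d m)) (kappa c d β * x) (j + 1) =
        hypergeometricTerm (fun l => 1 - (k : ℂ) + 1 / (β * c l))
          (fun m => 1 - (k : ℂ) - 1 / (β * d m)) (kappa c d β * x) j *
          (kappa c d β * x / (j + 1)) *
        ((∏ l, ((((j : ℤ) - k : ℤ) : ℂ) + 1 + 1 / (β * c l))) /
          ∏ m, ((((j : ℤ) - k : ℤ) : ℂ) + 1 - 1 / (β * d m))) := by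
      have e1 : ∀ l, (((j : ℤ) - k : ℤ) : ℂ) + 1 + 1 / (β * c l) =
          1 - (k : ℂ) + 1 / (β * c l) + j := fun l => by push_cast; ring
      have e2 : ∀ m, (((j : ℤ) - k : ℤ) : ℂ) + 1 - 1 / (β * d m) =
          1 - (k : ℂ) - 1 / (β * d m) + j := fun m => by push_cast; ring
      simp_rw [e1, e2, hypergeometricTerm, ascPochhammer_succ_eval, Finset.prod_mul_distrib]
      rw [Nat.factorial_succ, pow_succ]
      push_cast
      simp only [div_eq_mul_inv, mul_inv]
      ring
    rw [hphi, ih, hhyp]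
    ring

end Rho

/-! ### Integrability and estimates along contours -/

lemma integrable_exp_neg_mul_abs {ε : ℝ} (hε : 0 < ε) :
    Integrable (fun t : ℝ => Real.exp (-(ε * |t|))) := by
  have h1 : IntegrableOn (fun t : ℝ => Real.exp (-(ε * |t|))) (Set.Ioi 0) := by
    refine (integrableOn_exp_mul_Ioi (neg_lt_zero.2 hε) 0).congr_fun (fun t ht => ?_)
      measurableSet_Ioi
    simp [abs_of_pos (Set.mem_Ioi.1 ht)]
  have h2 : IntegrableOn (fun t : ℝ => Real.exp (-(ε * |t|))) (Set.Iic 0) := by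
    refine (integrableOn_exp_mul_Iic hε 0).congr_fun (fun t ht => ?_) measurableSet_Iic
    simp [abs_of_nonpos (Set.mem_Iic.1 ht)]
  have := h2.union h1
  rwa [Set.Iic_union_Ioi, integrableOn_univ] at this

lemma LocallyIntegrable.integrable_of_norm_le_exp {g : ℝ → ℂ} (hg : LocallyIntegrable g)
    {C ε T : ℝ} (hε : 0 < ε) (h : ∀ t, T ≤ |t| → ‖g t‖ ≤ C * Real.exp (-(ε * |t|))) :
    Integrable g := by
  have h1 : IntegrableOn g (Set.Icc (-T) T) := hg.integrableOn_isCompact isCompact_Icc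
  have h2 : IntegrableOn g (Set.Icc (-T) T)ᶜ := by
    refine Integrable.mono' ((integrable_exp_neg_mul_abs hε).const_mul C).integrableOn
      hg.aestronglyMeasurable.restrict ?_
    filter_upwards [ae_restrict_mem measurableSet_Icc.compl] with t ht
    refine h t ?_
    by_contra! hT
    exact ht ⟨(abs_lt.1 hT).1.le, (abs_lt.1 hT).2.le⟩
  have := h1.union h2
  rwa [Set.union_compl_self, integrableOn_univ] at this

lemma IsPiecewiseC1.locallyIntegrable {γ : ℝ → ℂ} (h : IsPiecewiseC1 γ) {f : ℂ → ℂ}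
    (hf : ContinuousOn f (Set.range γ)) :
    LocallyIntegrable (fun t => f (γ t) * deriv γ t) := fun t =>
  ⟨Set.uIoc (t - 1) (t + 1), by
    rw [Set.uIoc_of_le (by linarith)]
    exact Ioc_mem_nhds (by linarith) (by linarith),
    intervalIntegrable_iff.1 (h.intervalIntegrable (hf.mono (Set.image_subset_range _ _)))⟩

lemma norm_sub_le_of_hasDerivAt_segment {H g : ℂ → ℂ} {K : ℝ} {z z' : ℂ}
    (hH : ∀ s ∈ segment ℝ z z', HasDerivAt H (g s) s) (hg : ∀ s ∈ segment ℝ z z', ‖g s‖ ≤ K) :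
    ‖H z' - H z‖ ≤ K * ‖z' - z‖ :=
  Convex.norm_image_sub_le_of_norm_hasDerivWithin_le (fun s hs => (hH s hs).hasDerivWithinAt) hg
    (convex_segment z z') (left_mem_segment ℝ z z') (right_mem_segment ℝ z z')

lemma im_eq_of_mem_segment {z z' s : ℂ} (h : z.im = z'.im) (hs : s ∈ segment ℝ z z') :
    s.im = z.im := by
  obtain ⟨a, b, -, -, hab, rfl⟩ := hs
  simp only [real_smul, add_im, mul_im, ofReal_re, ofReal_im, zero_mul, add_zero, ← h]
  rw [← add_mul, hab, one_mul]

lemma re_eq_of_mem_segment {z z' s : ℂ} (h : z.re = z'.re) (hs : s ∈ segment ℝ z z') :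
    s.re = z.re := by
  obtain ⟨a, b, -, -, hab, rfl⟩ := hs
  simp only [real_smul, add_re, mul_re, ofReal_re, ofReal_im, zero_mul, sub_zero, ← h]
  rw [← add_mul, hab, one_mul]

lemma re_mem_uIcc_of_mem_segment {z z' s : ℂ} (hs : s ∈ segment ℝ z z') :
    s.re ∈ Set.uIcc z.re z'.re := by
  obtain ⟨a, b, ha, hb, hab, rfl⟩ := hs
  rw [← segment_eq_uIcc]
  exact ⟨a, b, ha, hb, hab, by simp⟩

lemma im_mem_uIcc_of_mem_segment {z z' s : ℂ} (hs : s ∈ segment ℝ z z') :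
    s.im ∈ Set.uIcc z.im z'.im := by
  obtain ⟨a, b, ha, hb, hab, rfl⟩ := hs
  rw [← segment_eq_uIcc]
  exact ⟨a, b, ha, hb, hab, by simp⟩

lemma convex_re_Ioo (A B : ℝ) : Convex ℝ {s : ℂ | A < s.re ∧ s.re < B} :=
  (convex_halfSpace_re_gt A).inter (convex_halfSpace_re_lt B)

lemma isOpen_re_Ioo (A B : ℝ) : IsOpen {s : ℂ | A < s.re ∧ s.re < B} :=
  (isOpen_lt continuous_const continuous_re).inter (isOpen_lt continuous_re continuous_const)

/-! ### The index of vertical lines -/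

/-- Dividing both arguments by R > 0 cancels in the difference, and the quotients tend to i and -i,
where the principal logarithm is continuous. -/
lemma tendsto_log_add_sub_log (z z' : ℂ) :
    Tendsto (fun R : ℝ => log (z' + R * I) - log (z - R * I)) atTop (𝓝 (Real.pi * I)) := by
  have h0 : ∀ a u : ℂ, Tendsto (fun R : ℝ => a * ((R⁻¹ : ℝ) : ℂ) + u) atTop (𝓝 u) := fun a u => by
    have : Tendsto (fun R : ℝ => ((R⁻¹ : ℝ) : ℂ)) atTop (𝓝 ((0 : ℝ) : ℂ)) :=
      (continuous_ofReal.tendsto _).comp tendsto_inv_atTop_zero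
    simpa using (this.const_mul a).add_const u
  have h1 := (continuousAt_clog (x := I) (by simp [slitPlane])).tendsto.comp (h0 z' I)
  have h2 := (continuousAt_clog (x := -I) (by simp [slitPlane])).tendsto.comp (h0 z (-I))
  have h3 := h1.sub h2
  rw [log_I, log_neg_I] at h3
  have e : (Real.pi / 2 * I - -(Real.pi / 2) * I : ℂ) = Real.pi * I := by ring
  rw [e] at h3
  refine h3.congr' ?_
  filter_upwards [eventually_gt_atTop 0, (h0 z' I).eventually_ne I_ne_zero,
    (h0 z (-I)).eventually_ne (neg_ne_zero.2 I_ne_zero)] with R hR h4 h5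
  have hR' : (R : ℂ) ≠ 0 := by exact_mod_cast hR.ne'
  have e1 : z' + R * I = R * (z' * ((R⁻¹ : ℝ) : ℂ) + I) := by
    push_cast
    field_simp
  have e2 : z - R * I = R * (z * ((R⁻¹ : ℝ) : ℂ) + -I) := by
    push_cast
    field_simp
    ring
  rw [e1, e2, log_ofReal_mul hR h4, log_ofReal_mul hR h5]
  simp only [Function.comp]
  ring

lemma contDiff_verticalLine (X : ℝ) : ContDiff ℝ 1 (fun t : ℝ => (X : ℂ) + t * I) := by
  have : ContDiff ℝ 1 (fun t : ℝ => (t : ℂ)) := ofRealCLM.contDiff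
  fun_prop

lemma deriv_verticalLine (X t : ℝ) : deriv (fun t : ℝ => (X : ℂ) + t * I) t = I := by
  have := ((ofRealCLM.hasDerivAt (x := t)).mul_const I).const_add (X : ℂ)
  simpa using this.deriv

/-- A primitive of 1/(s-p) on the line is log(s-p) or log(p-s), chosen so that the argument has
positive real part and stays off the cut. -/
lemma tendsto_integral_verticalLine (X : ℝ) {p : ℂ} (hp : p.re ≠ X) :
    Tendsto (fun R : ℝ => ∫ t in (-R)..R, deriv (fun t : ℝ => (X : ℂ) + t * I) t / (X + t * I - p))
      atTop (𝓝 (2 * Real.pi * I * (if p.re < X then 1 / 2 else -1 / 2))) := by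
  have hγ : IsPiecewiseC1 (fun t : ℝ => (X : ℂ) + t * I) := .of_contDiff (contDiff_verticalLine X)
  have hne : ∀ t : ℝ, (X : ℂ) + t * I - p ≠ 0 := fun t h => hp (by
    have := congrArg re h
    simp at this
    linarith)
  have hcont : ∀ R : ℝ, ContinuousOn (fun s => 1 / (s - p))
      ((fun t : ℝ => (X : ℂ) + t * I) '' Set.uIcc (-R) R) := fun R => by
    refine continuousOn_const.div (by fun_prop) ?_
    rintro _ ⟨t, -, rfl⟩
    exact hne t
  have hint : ∀ R : ℝ, ∫ t in (-R)..R, deriv (fun t : ℝ => (X : ℂ) + t * I) t / (X + t * I - p) =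
      ∫ t in (-R)..R, 1 / ((X : ℂ) + t * I - p) * deriv (fun t : ℝ => (X : ℂ) + t * I) t :=
    fun R => intervalIntegral.integral_congr fun t _ => by ring
  rcases hp.lt_or_gt with h | h
  · rw [if_pos h]
    have e : (2 * Real.pi * I * (1 / 2) : ℂ) = Real.pi * I := by ring
    rw [e]
    refine (tendsto_log_add_sub_log (X - p) (X - p)).congr' ?_
    filter_upwards [eventually_ge_atTop 0] with R hR
    rw [hint, hγ.integral_eq_sub (F := fun s => log (s - p)) (by linarith) (hcont R)]
    · push_cast
      ring_nf
    · intro t _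
      have := ((hasDerivAt_id ((X : ℂ) + t * I)).sub_const p).clog (Or.inl (by simp [h]))
      simpa using this
  · rw [if_neg h.not_gt]
    have e : (2 * Real.pi * I * (-1 / 2) : ℂ) = -(Real.pi * I) := by ring
    rw [e]
    refine (tendsto_log_add_sub_log (p - X) (p - X)).neg.congr' ?_
    filter_upwards [eventually_ge_atTop 0] with R hR
    rw [hint, hγ.integral_eq_sub (F := fun s => log (p - s)) (by linarith) (hcont R)]
    · push_cast
      ring_nf
    · intro t _
      have := ((hasDerivAt_id ((X : ℂ) + t * I)).const_sub p).clog (Or.inl (by simp [h]))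
      refine this.congr_deriv ?_
      have h1 := hne t
      have h2 : p - (X + t * I) ≠ 0 := by rw [← neg_sub, neg_ne_zero]; exact h1
      simp only [id]
      rw [← neg_sub, neg_div, div_neg, neg_neg]

lemma HasContourIndex.tendsto_integral {γ : ℝ → ℂ} {p ν : ℂ} (h : HasContourIndex γ p ν) :
    Tendsto (fun R : ℝ => ∫ t in (-R)..R, deriv γ t / (γ t - p)) atTop
      (𝓝 (2 * Real.pi * I * ν)) := by
  have := h.2.const_mul (2 * (Real.pi : ℂ) * I)
  refine this.congr fun R => ?_
  rw [← mul_assoc, mul_inv_cancel₀ Complex.two_pi_I_ne_zero, one_mul]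

/-! ### The poles of the integrand -/

section Poles

variable {L : ℕ} (α : Fin L → ℂ) (k : ℤ)

/-- Left poles move left and right poles move right by unit steps, so a strip of finite width meets
only finitely many of them. -/
lemma finite_poles (A B : ℝ) :
    ((gammaLeftPoles α ∪ gammaRightPoles k) ∩ {s | A < s.re ∧ s.re < B}).Finite := by
  obtain ⟨N, hN⟩ := exists_nat_gt (|B| + |(k : ℝ)|)
  obtain ⟨N', hN'⟩ := exists_nat_gt (∑ l, |(α l).re| + |A|)
  have h1 : (⋃ l : Fin L, (fun i : ℕ => -α l - i) '' Set.Iio N').Finite :=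
    Set.finite_iUnion fun l => (Set.finite_Iio N').image _
  have h2 : ((fun i : ℕ => (1 - k + i : ℂ)) '' Set.Iio N).Finite := (Set.finite_Iio N).image _
  refine (h1.union h2).subset ?_
  rintro s ⟨⟨l, i, rfl⟩ | ⟨i, rfl⟩, hA, hB⟩
  · refine Or.inl (Set.mem_iUnion.2 ⟨l, i, ?_, rfl⟩)
    have h3 : |(α l).re| ≤ ∑ l, |(α l).re| :=
      Finset.single_le_sum (f := fun l => |(α l).re|) (fun _ _ => abs_nonneg _) (Finset.mem_univ l)
    simp only [sub_re, neg_re, natCast_re] at hA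
    have := neg_abs_le (α l).re
    have := neg_abs_le A
    have : (i : ℝ) < N' := by linarith
    exact_mod_cast this
  · refine Or.inr ⟨i, ?_, rfl⟩
    simp only [add_re, sub_re, one_re, intCast_re, natCast_re] at hB
    have := le_abs_self (k : ℝ)
    have := le_abs_self B
    have : (i : ℝ) < N := by linarith
    exact_mod_cast this

lemma exists_forall_re_lt : ∃ A : ℝ, ∀ p ∈ gammaLeftPoles α, p.re < A := by
  refine ⟨∑ l, |(α l).re| + 1, ?_⟩
  rintro _ ⟨l, i, rfl⟩
  have h3 : |(α l).re| ≤ ∑ l, |(α l).re| :=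
    Finset.single_le_sum (f := fun l => |(α l).re|) (fun _ _ => abs_nonneg _) (Finset.mem_univ l)
  simp only [sub_re, neg_re, natCast_re]
  have := neg_abs_le (α l).re
  have : (0 : ℝ) ≤ i := Nat.cast_nonneg i
  linarith

variable {α k}

/-- In the applications `c p` is an index integral or a difference of two. It vanishes at the left
poles and at the right poles with j ≥ n, so only the known simple residues survive. -/
lemma sum_residues_eq {M : ℕ} {δ : Fin M → ℂ} {w : ℂ} {F : Finset ℂ} {r c : ℂ → ℂ} {n : ℕ} {a : ℂ}
    (hF : ∀ p ∈ F, p ∈ gammaLeftPoles α ∪ gammaRightPoles k) (hn : ∀ j < n, (1 - k + j : ℂ) ∈ F)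
    (hr : ∀ j < n, r (1 - k + j) = -barnesTerm α δ k w j)
    (hc1 : ∀ p ∈ gammaLeftPoles α, c p = 0) (hc2 : ∀ j < n, c (1 - k + j) = a)
    (hc3 : ∀ j, n ≤ j → c (1 - k + j) = 0) :
    ∑ p ∈ F, r p * c p = -a * ∑ j ∈ Finset.range n, barnesTerm α δ k w j := by
  classical
  have hinj : Function.Injective (fun j : ℕ => (1 - k + j : ℂ)) := fun i j h => by simpa using h
  have h1 : (Finset.range n).image (fun j : ℕ => (1 - k + j : ℂ)) ⊆ F := by
    intro p hp
    obtain ⟨j, hj, rfl⟩ := Finset.mem_image.1 hp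
    exact hn j (Finset.mem_range.1 hj)
  rw [← Finset.sum_subset h1, Finset.sum_image hinj.injOn, Finset.mul_sum]
  · refine Finset.sum_congr rfl fun j hj => ?_
    rw [hr j (Finset.mem_range.1 hj), hc2 j (Finset.mem_range.1 hj)]
    ring
  · intro p hp hp'
    rcases hF p hp with h | ⟨j, rfl⟩
    · rw [hc1 p h, mul_zero]
    · rw [hc3 j, mul_zero]
      by_contra! hj
      exact hp' (Finset.mem_image.2 ⟨j, Finset.mem_range.2 hj, rfl⟩)

end Poles

/-! ### Evaluation of the integral along vertical contours -/

section Vertical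

variable {L M : ℕ} {α : Fin L → ℂ} {δ : Fin M → ℂ} {k : ℤ} {w : ℂ}

/-- The factor e^{sw} costs at most e^{B|Re w|} e^{|Im s||Im w|}, and in the sector there is a decay
rate η > |Im w| of the Gamma factors. -/
lemma exists_norm_barnes_le_exp (α : Fin L → ℂ) (δ : Fin M → ℂ) (k : ℤ)
    (hw : |w.im| < ((L : ℝ) - M + 1) * Real.pi / 2) (B : ℝ) :
    ∃ C T ε : ℝ, 0 ≤ C ∧ 0 < ε ∧ ∀ s : ℂ, |s.re| ≤ B → T ≤ |s.im| →
      ‖barnes α δ k w s‖ ≤ C * Real.exp (-(ε * |s.im|)) := by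
  obtain ⟨η, hη₁, hη₂⟩ := exists_between hw
  obtain ⟨C, T, hC, h⟩ := exists_norm_barnes_le α δ k B hη₂
  refine ⟨C * Real.exp (B * |w.re|), T, η - |w.im|, by positivity, by linarith,
    fun s hs hT => (h s w hs hT).trans ?_⟩
  rw [mul_assoc, mul_assoc, ← Real.exp_add, ← Real.exp_add]
  refine mul_le_mul_of_nonneg_left (Real.exp_le_exp.2 ?_) hC
  rw [mul_re]
  have h1 : s.re * w.re ≤ B * |w.re| :=
    (le_abs_self _).trans ((abs_mul _ _).trans_le (by gcongr))
  have h2 : -(s.im * w.im) ≤ |s.im| * |w.im| := (neg_le_abs _).trans (abs_mul _ _).le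
  nlinarith

lemma continuousOn_barnes (δ : Fin M → ℂ) (w : ℂ) {S : Set ℂ}
    (h : ∀ s ∈ S, s ∉ gammaLeftPoles α ∧ s ∉ gammaRightPoles k) :
    ContinuousOn (barnes α δ k w) S := fun s hs =>
  (differentiableAt_barnes w (h s hs).1 (h s hs).2).continuousAt.continuousWithinAt

lemma IsPiecewiseC1.bounded_re {γ : ℝ → ℂ} (h : IsPiecewiseC1 γ) {x₁ x₂ T : ℝ}
    (h₁ : ∀ t, T ≤ t → γ t = x₁ + t * I) (h₂ : ∀ t, t ≤ -T → γ t = x₂ + t * I) :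
    ∃ B, ∀ t, |(γ t).re| ≤ B := by
  obtain ⟨B, hB⟩ := isCompact_Icc.exists_bound_of_continuousOn
    (h.1.continuousOn (s := Set.Icc (-T) T))
  refine ⟨max B (max |x₁| |x₂|), fun t => ?_⟩
  rcases le_total T t with ht | ht
  · simp [h₁ t ht]
  rcases le_total t (-T) with ht' | ht'
  · simp [h₂ t ht']
  · exact (abs_re_le_norm _).trans ((hB t ⟨ht', ht⟩).trans (le_max_left _ _))

lemma deriv_eq_I_of_eventuallyEq {γ : ℝ → ℂ} {x t : ℝ} (h : ∀ᶠ t in 𝓝 t, γ t = x + t * I) :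
    deriv γ t = I :=
  (Filter.EventuallyEq.deriv_eq h).trans (deriv_verticalLine x t)

lemma integrable_barnes_of_vertical {γ : ℝ → ℂ} (hγ : IsPiecewiseC1 γ) {x₁ x₂ T : ℝ}
    (h₁ : ∀ t, T ≤ t → γ t = x₁ + t * I) (h₂ : ∀ t, t ≤ -T → γ t = x₂ + t * I)
    (hP : ∀ t, γ t ∉ gammaLeftPoles α ∧ γ t ∉ gammaRightPoles k)
    (hw : |w.im| < ((L : ℝ) - M + 1) * Real.pi / 2) :
    ContourIntegrable (barnes α δ k w) γ := by
  obtain ⟨B, hB⟩ := hγ.bounded_re h₁ h₂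
  obtain ⟨C, T', ε, -, hε, h⟩ := exists_norm_barnes_le_exp α δ k hw B
  refine LocallyIntegrable.integrable_of_norm_le_exp (C := C) (ε := ε) (T := max T' (|T| + 1))
    (hγ.locallyIntegrable (continuousOn_barnes δ w (by rintro _ ⟨t, rfl⟩; exact hP t))) hε ?_
  intro t ht
  have htT : |T| < |t| := by linarith [(le_max_right T' (|T| + 1)).trans ht]
  have key : deriv γ t = I ∧ (γ t).im = t := by
    rcases lt_abs.1 ((le_abs_self T).trans_lt htT) with h | h
    · exact ⟨deriv_eq_I_of_eventuallyEq (x := x₁) (by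
        filter_upwards [Ioi_mem_nhds h] with s hs using h₁ s (le_of_lt hs)), by simp [h₁ t h.le]⟩
    · have h' : t < -T := by linarith
      exact ⟨deriv_eq_I_of_eventuallyEq (x := x₂) (by
        filter_upwards [Iio_mem_nhds h'] with s hs using h₂ s (le_of_lt hs)), by simp [h₂ t h'.le]⟩
  have := h (γ t) (hB t) (by rw [key.2]; exact (le_max_left _ _).trans ht)
  rw [key.2] at this
  rw [norm_mul, key.1, norm_I, mul_one]
  exact this

/-- The difference of a primitive along horizontal segments tends to `0` far up and far down. -/
lemma tendsto_primitive_sub {F : Finset ℂ} {r H : ℂ → ℂ} {A B : ℝ}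
    (hw : |w.im| < ((L : ℝ) - M + 1) * Real.pi / 2)
    (hH : ∀ s ∈ {s : ℂ | A < s.re ∧ s.re < B} \ F,
      HasDerivAt H (barnes α δ k w s - ∑ p ∈ F, r p / (s - p)) s) {x x' : ℝ} {ι : Type*}
    {l : Filter ι} {y : ι → ℝ}
    (hy : Tendsto (fun i => |y i|) l atTop) (hx : x ∈ Set.Ioo A B) (hx' : x' ∈ Set.Ioo A B) :
    Tendsto (fun i => H (x' + y i * I) - H (x + y i * I)) l (𝓝 0) := by
  obtain ⟨C, T, ε, hC, hε, h⟩ := exists_norm_barnes_le_exp α δ k hw (max |A| |B|)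
  -- Beyond the height T₀ horizontal segments avoid `F`, and each r_p/(s-p) is at most |r_p|/(|y| -
  -- T₀).
  set T₀ := ∑ p ∈ F, |p.im| with hT₀
  have hT₀' : ∀ p ∈ F, |p.im| ≤ T₀ := fun p hp =>
    Finset.single_le_sum (f := fun p : ℂ => |p.im|) (fun _ _ => abs_nonneg _) hp
  have hlim : Tendsto (fun i => (C * Real.exp (-(ε * |y i|)) + ∑ p ∈ F, ‖r p‖ / (|y i| - T₀)) *
      ‖(x' : ℂ) - x‖) l (𝓝 ((C * 0 + ∑ p ∈ F, 0) * ‖(x' : ℂ) - x‖)) := by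
    refine Tendsto.mul_const _ (Tendsto.add (Tendsto.const_mul _ ?_)
      (tendsto_finsetSum _ fun p _ => ?_))
    · exact Real.tendsto_exp_neg_atTop_nhds_zero.comp (hy.const_mul_atTop hε)
    · exact Tendsto.const_div_atTop (tendsto_atTop_add_const_right _ (-T₀) hy) _
  simp only [mul_zero, Finset.sum_const_zero, add_zero, zero_mul] at hlim
  refine squeeze_zero_norm' ?_ hlim
  filter_upwards [hy.eventually_ge_atTop T, hy.eventually_gt_atTop T₀] with i h1 h2
  have hseg : ∀ s ∈ segment ℝ ((x : ℂ) + y i * I) (x' + y i * I),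
      s ∈ {s : ℂ | A < s.re ∧ s.re < B} \ F ∧ |s.im| = |y i| ∧ ∀ p ∈ F, |y i| - T₀ ≤ ‖s - p‖ := by
    intro s hs
    have him : s.im = y i := by simpa using im_eq_of_mem_segment (by simp) hs
    have hre : s.re ∈ Set.uIcc x x' := by simpa using re_mem_uIcc_of_mem_segment hs
    have hre' : s.re ∈ Set.Ioo A B := (Set.OrdConnected.uIcc_subset Set.ordConnected_Ioo hx hx') hre
    refine ⟨⟨hre', fun hF => ?_⟩, by rw [him], fun p hp => ?_⟩
    · have := hT₀' s hF
      rw [him] at this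
      linarith
    · have h3 := abs_im_le_norm (s - p)
      rw [sub_im, him] at h3
      have := abs_sub_abs_le_abs_sub (y i) p.im
      linarith [hT₀' p hp]
  have := norm_sub_le_of_hasDerivAt_segment (fun s hs => hH s (hseg s hs).1)
    (K := C * Real.exp (-(ε * |y i|)) + ∑ p ∈ F, ‖r p‖ / (|y i| - T₀)) fun s hs => by
      obtain ⟨hs1, hs2, hs3⟩ := hseg s hs
      refine (norm_sub_le _ _).trans (add_le_add ?_ ((norm_sum_le _ _).trans
        (Finset.sum_le_sum fun p hp => ?_)))
      · rw [← hs2]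
        refine h s ?_ (by rwa [hs2])
        exact abs_le_max_abs_abs hs1.1.1.le hs1.1.2.le
      · rw [norm_div]
        exact div_le_div_of_nonneg_left (norm_nonneg _) (by linarith) (hs3 p hp)
  simpa using this

/-- The abscissa n - k + 1/2 is midway between the consecutive right poles n - k and n - k + 1;
equality would give 2j + 1 = 2n. -/
lemma re_ne_of_eq_add_half {n : ℕ} {X : ℝ} (j : ℕ) (hXn : X = n - k + 1 / 2) :
    (1 - k + j : ℂ).re ≠ X := fun h => by
  simp only [add_re, sub_re, one_re, intCast_re, natCast_re, hXn] at h
  have : (2 * (j : ℤ) + 1 : ℝ) = 2 * (n : ℤ) := by push_cast; linarith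
  have : 2 * (j : ℤ) + 1 = 2 * (n : ℤ) := by exact_mod_cast this
  omega

lemma verticalLine_notMem_poles {n : ℕ} {X : ℝ} (hX : ∀ p ∈ gammaLeftPoles α, p.re < X)
    (hXn : X = n - k + 1 / 2) (t : ℝ) :
    (X + t * I : ℂ) ∉ gammaLeftPoles α ∧ (X + t * I : ℂ) ∉ gammaRightPoles k := by
  have hre : (X + t * I : ℂ).re = X := by simp
  refine ⟨fun h => (hX _ h).ne hre, ?_⟩
  rintro ⟨j, hj⟩
  exact re_ne_of_eq_add_half j hXn (by rw [← hj, hre])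

/-- The integral along a vertical contour in terms of the residues at the points
`1 - k + j`, `j < n`, and the integral along a vertical line to the right of these points. -/
theorem contourIntegral_vertical {γ : ℝ → ℂ}
    (hγ : IsVerticalContour (gammaLeftPoles α) (gammaRightPoles k) γ)
    (hdisj : ∀ j : ℕ, (1 - k + j : ℂ) ∉ gammaLeftPoles α)
    (hw : |w.im| < ((L : ℝ) - M + 1) * Real.pi / 2) {n : ℕ} {X : ℝ}
    (hX : ∀ p ∈ gammaLeftPoles α, p.re < X) (hXn : X = n - k + 1 / 2) :
    ContourIntegrable (barnes α δ k w) γ ∧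
    ContourIntegrable (barnes α δ k w) (fun t => X + t * I) ∧
    contourIntegral (barnes α δ k w) γ = ∑ j ∈ Finset.range n, barnesTerm α δ k w j +
      contourIntegral (barnes α δ k w) (fun t => X + t * I) := by
  classical
  obtain ⟨hγ1, ⟨x₁, x₂, T, h₁, h₂⟩, hP, hQ⟩ := hγ
  have hγP : ∀ t, γ t ∉ gammaLeftPoles α ∧ γ t ∉ gammaRightPoles k := fun t =>
    ⟨fun h => (hP _ h).1 ⟨t, rfl⟩, fun h => (hQ _ h).1 ⟨t, rfl⟩⟩
  set ℓ : ℝ → ℂ := fun t => X + t * I with hℓ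
  have hℓ1 : IsPiecewiseC1 ℓ := .of_contDiff (contDiff_verticalLine X)
  have hQre : ∀ j : ℕ, (1 - k + j : ℂ).re = 1 - k + j := fun j => by simp
  have hQX : ∀ j : ℕ, (1 - k + j : ℂ).re ≠ X := fun j => re_ne_of_eq_add_half j hXn
  have hℓP := verticalLine_notMem_poles hX hXn
  have hint := integrable_barnes_of_vertical (δ := δ) hγ1 h₁ h₂ hγP hw
  have hint' := integrable_barnes_of_vertical (δ := δ) hℓ1 (T := 0) (fun _ _ => rfl)
    (fun _ _ => rfl) hℓP hw
  refine ⟨hint, hint', ?_⟩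
  obtain ⟨B, hB⟩ := hγ1.bounded_re h₁ h₂
  -- A strip wide enough for the contour, the line, and the right poles with j < n.
  set B' := max B (max |X| |(1 - k : ℝ)|) + 1 with hB'
  have hBγ : ∀ t, -B' < (γ t).re ∧ (γ t).re < B' := fun t =>
    abs_lt.1 ((hB t).trans_lt ((le_max_left _ _).trans_lt (lt_add_one _)))
  have hBX : -B' < X ∧ X < B' :=
    abs_lt.1 (((le_max_left _ _).trans (le_max_right _ _)).trans_lt (lt_add_one _))
  have hBk : -B' < (1 - k : ℝ) :=
    (abs_lt.1 (((le_max_right _ _).trans (le_max_right _ _)).trans_lt (lt_add_one _))).1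
  set U := {s : ℂ | -B' < s.re ∧ s.re < B'} with hU
  set F := (finite_poles α k (-B') B').toFinset with hF
  have hFmem : ∀ p, p ∈ F ↔ p ∈ gammaLeftPoles α ∪ gammaRightPoles k ∧ p ∈ U := fun p => by
    simp [hF, hU]
  have hdiff : DifferentiableOn ℂ (barnes α δ k w) (U \ F) := by
    rintro s ⟨hs, hs'⟩
    have : s ∉ gammaLeftPoles α ∪ gammaRightPoles k := fun h => hs' ((hFmem s).2 ⟨h, hs⟩)
    simp only [Set.mem_union, not_or] at this
    exact (differentiableAt_barnes w this.1 this.2).differentiableWithinAt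
  obtain ⟨r, H, hH, hr⟩ := exists_primitive_sub_residues (isOpen_re_Ioo (-B') B')
    (convex_re_Ioo (-B') B') F hdiff fun p _ => meromorphicAt_barnes w p
  have hrQ : ∀ j : ℕ, (1 - k + j : ℂ) ∈ F → r (1 - k + j) = -barnesTerm α δ k w j := fun j hj =>
    hr _ hj _ (tendsto_sub_mul_barnes w j (hdisj j))
  have hγU : ∀ t, γ t ∈ U \ F := fun t => ⟨hBγ t, fun h => by
    rcases ((hFmem _).1 h).1 with h | h
    · exact (hγP t).1 h
    · exact (hγP t).2 h⟩
  have hℓU : ∀ t, ℓ t ∈ U \ F := fun t => ⟨by simpa [hU, hℓ] using hBX, fun h => by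
    rcases ((hFmem _).1 h).1 with h | h
    · exact (hℓP t).1 h
    · exact (hℓP t).2 h⟩
  -- The indices of the contour and of the line. They agree at the left poles and at the right poles
  -- beyond the line, and differ by -1 at the right poles with j < n.
  set ν : ℂ → ℂ := fun p => if p ∈ gammaLeftPoles α then 1 / 2 else -1 / 2 with hν
  set ν' : ℂ → ℂ := fun p => if p.re < X then 1 / 2 else -1 / 2 with hν'
  have hνlim : ∀ p ∈ F, Tendsto (fun R : ℝ => ∫ t in (-R)..R, deriv γ t / (γ t - p)) atTop
      (𝓝 (2 * Real.pi * I * ν p)) := fun p hp => by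
    by_cases h : p ∈ gammaLeftPoles α
    · simpa only [hν, if_pos h] using (hP p h).tendsto_integral
    · simpa only [hν, if_neg h] using (hQ p (((hFmem p).1 hp).1.resolve_left h)).tendsto_integral
  have hν'lim : ∀ p ∈ F, Tendsto (fun R : ℝ => ∫ t in (-R)..R, deriv ℓ t / (ℓ t - p)) atTop
      (𝓝 (2 * Real.pi * I * ν' p)) := fun p hp => by
    refine tendsto_integral_verticalLine X ?_
    rcases ((hFmem p).1 hp).1 with h | ⟨j, rfl⟩
    · exact (hX p h).ne
    · exact hQX j
  -- the identity for truncated contours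
  have hid : ∀ᶠ R : ℝ in atTop, (∫ t in (-R)..R, barnes α δ k w (γ t) * deriv γ t) -
      (∫ t in (-R)..R, barnes α δ k w (ℓ t) * deriv ℓ t) =
      ∑ p ∈ F, r p * ((∫ t in (-R)..R, deriv γ t / (γ t - p)) -
        ∫ t in (-R)..R, deriv ℓ t / (ℓ t - p)) +
      ((H (x₁ + R * I) - H (X + R * I)) -
        (H (x₂ + (-R : ℝ) * I) - H (X + (-R : ℝ) * I))) := by
    filter_upwards [eventually_ge_atTop 0, eventually_ge_atTop T] with R hR hRT
    rw [integral_eq_sum_residues_add_sub hdiff hH hγ1 (by linarith) fun t _ => hγU t,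
      integral_eq_sum_residues_add_sub hdiff hH hℓ1 (by linarith) fun t _ => hℓU t,
      h₁ R hRT, h₂ (-R) (by linarith)]
    simp only [mul_sub, Finset.sum_sub_distrib, hℓ]
    ring
  have hx₁ : x₁ ∈ Set.Ioo (-B') B' := by simpa [h₁ T le_rfl] using hBγ T
  have hx₂ : x₂ ∈ Set.Ioo (-B') B' := by simpa [h₂ (-T) le_rfl] using hBγ (-T)
  have hR1 := tendsto_primitive_sub hw hH (y := fun R : ℝ => R) tendsto_abs_atTop_atTop hBX hx₁
  have hR2 := tendsto_primitive_sub hw hH (y := fun R : ℝ => -R)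
    (by simpa using tendsto_abs_atTop_atTop) hBX hx₂
  have hrhs := (tendsto_finsetSum F fun p hp =>
    ((hνlim p hp).sub (hν'lim p hp)).const_mul (r p)).add (hR1.sub hR2)
  have hlhs := (intervalIntegral_tendsto_integral hint tendsto_neg_atTop_atBot tendsto_id).sub
    (intervalIntegral_tendsto_integral hint' tendsto_neg_atTop_atBot tendsto_id)
  have heq := tendsto_nhds_unique (hlhs.congr' hid) hrhs
  -- The unknown residues at the left poles drop out because the indices agree there.
  have hsum : ∑ p ∈ F, r p * (2 * Real.pi * I * ν p - 2 * Real.pi * I * ν' p) =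
      2 * Real.pi * I * ∑ j ∈ Finset.range n, barnesTerm α δ k w j := by
    rw [sum_residues_eq (fun p hp => ((hFmem p).1 hp).1) (n := n) (a := -(2 * Real.pi * I))
      (δ := δ) (w := w), neg_neg]
    · intro j hj
      refine (hFmem _).2 ⟨Or.inr ⟨j, rfl⟩, ?_⟩
      have : (j : ℝ) + 1 ≤ n := by exact_mod_cast hj
      have hj0 : (0 : ℝ) ≤ j := Nat.cast_nonneg j
      simp only [hU, Set.mem_ofPred_eq, hQre]
      constructor <;> linarith [hBX.2]
    · intro j hj
      refine hrQ j ((hFmem _).2 ⟨Or.inr ⟨j, rfl⟩, ?_⟩)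
      have : (j : ℝ) + 1 ≤ n := by exact_mod_cast hj
      have hj0 : (0 : ℝ) ≤ j := Nat.cast_nonneg j
      simp only [hU, Set.mem_ofPred_eq, hQre]
      constructor <;> linarith [hBX.2]
    · intro p hp
      simp [hν, hν', hp, hX p hp]
    · intro j hj
      have : (j : ℝ) + 1 ≤ n := by exact_mod_cast hj
      have h : (1 - k + j : ℂ).re < X := by rw [hQre, hXn]; linarith
      simp only [hν, hν', hdisj j, if_false, h, if_true]
      ring
    · intro j hj
      have : (n : ℝ) ≤ j := by exact_mod_cast hj
      have h : ¬ (1 - k + j : ℂ).re < X := by rw [hQre, hXn]; linarith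
      simp only [hν, hν', hdisj j, if_false, h]
      ring
  rw [hsum, sub_zero, add_zero, sub_eq_iff_eq_add] at heq
  rw [contourIntegral, heq, mul_add, ← mul_assoc, inv_mul_cancel₀ Complex.two_pi_I_ne_zero, one_mul]
  rfl

end Vertical

/-! ### Evaluation of the integral by the series of residues -/

/-- A function that decreases by a factor `r < 1` over each unit step decays exponentially. -/
lemma le_exp_of_forall_add_one_le {φ : ℝ → ℝ} {A r K : ℝ} (hr₀ : 0 < r) (hr₁ : r < 1) (hK : 0 ≤ K)
    (hφ : ∀ t, A ≤ t → φ (t + 1) ≤ r * φ t) (hφK : ∀ t ∈ Set.Icc A (A + 1), φ t ≤ K) {t : ℝ}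
    (ht : A ≤ t) :
    φ t ≤ K * Real.exp ((A + 1) * -Real.log r) * Real.exp (-(-Real.log r * t)) := by
  have h1 : ∀ (n : ℕ) (t : ℝ), A ≤ t → φ (t + n) ≤ r ^ n * φ t := by
    intro n
    induction n with
    | zero => simp
    | succ n ih =>
      intro t ht
      have h2 := hφ (t + n) (by have : (0 : ℝ) ≤ n := Nat.cast_nonneg n; linarith)
      have h3 := mul_le_mul_of_nonneg_left (ih t ht) hr₀.le
      push_cast
      rw [← add_assoc, pow_succ]
      linarith
  -- The number of unit steps that bring t back to [A, A + 1). Since n > t - A - 1, the power r^n is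
  -- at most r^(t-A-1), whence the constant (A + 1)(-log r).
  set n := ⌊t - A⌋₊ with hn
  have hn1 : (n : ℝ) ≤ t - A := Nat.floor_le (by linarith)
  have hn2 : t - A < n + 1 := Nat.lt_floor_add_one _
  have h2 := h1 n (t - n) (by linarith)
  rw [sub_add_cancel] at h2
  have h3 := mul_le_mul_of_nonneg_left (hφK (t - n) ⟨by linarith, by linarith⟩) (pow_pos hr₀ n).le
  have hlog : Real.log r < 0 := Real.log_neg hr₀ hr₁
  have h4 : r ^ n ≤ Real.exp ((A + 1) * -Real.log r) * Real.exp (-(-Real.log r * t)) := by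
    rw [← Real.exp_add, ← Real.rpow_natCast, Real.rpow_def_of_pos hr₀]
    refine Real.exp_le_exp.2 ?_
    nlinarith
  calc φ t ≤ r ^ n * K := h2.trans h3
    _ ≤ _ := by
      rw [mul_comm, mul_assoc]
      exact mul_le_mul_of_nonneg_left h4 hK

section Series

variable {L M : ℕ} {α : Fin L → ℂ} {δ : Fin M → ℂ} {k : ℤ} {w : ℂ}

lemma exists_norm_barnes_add_one_le (α : Fin L → ℂ) (δ : Fin M → ℂ) (k : ℤ)
    (h : L ≤ M ∨ (L = M + 1 ∧ w.re < 0)) :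
    ∃ A r : ℝ, 0 < r ∧ r < 1 ∧ ∀ s : ℂ, A ≤ s.re →
      ‖barnes α δ k w (s + 1)‖ ≤ r * ‖barnes α δ k w s‖ := by
  obtain ⟨A, r, hr₀, hr₁, hA⟩ := exists_norm_barnesRatio_le α δ k h
  refine ⟨A, r, hr₀, hr₁, fun s hs => ?_⟩
  obtain ⟨h1, h2, h3, h4⟩ := hA s hs
  rw [barnes_add_one w h1 h2 h3, norm_mul, mul_comm]
  exact mul_le_mul_of_nonneg_right h4 (norm_nonneg _)

lemma summable_barnesTerm (α : Fin L → ℂ) (δ : Fin M → ℂ) (k : ℤ)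
    (h : L ≤ M ∨ (L = M + 1 ∧ w.re < 0)) : Summable (barnesTerm α δ k w) := by
  obtain ⟨A, r, hr₀, hr₁, hA⟩ := exists_norm_barnesRatio_le α δ k h
  refine summable_of_ratio_norm_eventually_le hr₁ ?_
  have hev : ∀ᶠ j : ℕ in atTop, A - 1 + k ≤ j := tendsto_natCast_atTop_atTop.eventually_ge_atTop _
  filter_upwards [hev] with j hj
  obtain ⟨h1, h2, -, h4⟩ := hA (1 - k + j) (by simp; linarith)
  rw [barnesTerm_succ w h1 h2, norm_mul, mul_comm]
  exact mul_le_mul_of_nonneg_right h4 (norm_nonneg _)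

/-- The integrals of the norm along consecutive lines eventually satisfy a_{n+1} ≤ r a_n with r < 1,
hence are summable and tend to 0. -/
lemma tendsto_contourIntegral_verticalLine
    (hw : |w.im| < ((L : ℝ) - M + 1) * Real.pi / 2) (h : L ≤ M ∨ (L = M + 1 ∧ w.re < 0)) :
    Tendsto (fun n : ℕ => contourIntegral (barnes α δ k w)
      (fun t => ((n - k + 1 / 2 : ℝ) : ℂ) + t * I)) atTop (𝓝 0) := by
  obtain ⟨A, r, hr₀, hr₁, hA⟩ := exists_norm_barnes_add_one_le α δ k h
  obtain ⟨A', hA'⟩ := exists_forall_re_lt α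
  set a : ℕ → ℝ := fun n => ∫ t : ℝ, ‖barnes α δ k w (((n - k + 1 / 2 : ℝ) : ℂ) + t * I)‖ with ha
  have hev : ∀ B : ℝ, ∀ᶠ n : ℕ in atTop, B ≤ n - k + 1 / 2 := fun B => by
    have : ∀ᶠ n : ℕ in atTop, B + k - 1 / 2 ≤ n :=
      tendsto_natCast_atTop_atTop.eventually_ge_atTop _
    filter_upwards [this] with n hn
    linarith
  have hint : ∀ n : ℕ, A' ≤ n - k + 1 / 2 →
      Integrable (fun t : ℝ => ‖barnes α δ k w (((n - k + 1 / 2 : ℝ) : ℂ) + t * I)‖) := by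
    intro n hn
    have := integrable_barnes_of_vertical (α := α) (k := k) (δ := δ) (w := w)
      (.of_contDiff (contDiff_verticalLine (n - k + 1 / 2))) (T := 0) (fun _ _ => rfl)
      (fun _ _ => rfl) (verticalLine_notMem_poles (fun p hp => (hA' p hp).trans_le hn) rfl) hw
    refine this.norm.congr (.of_forall fun t => ?_)
    simp only [norm_mul, deriv_verticalLine, norm_I, mul_one]
  have hsum : Summable a := by
    refine summable_of_ratio_norm_eventually_le hr₁ ?_
    filter_upwards [hev A, hev A'] with n hn hn'
    have hpos : ∀ n, 0 ≤ a n := fun n => integral_nonneg fun t => norm_nonneg _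
    rw [Real.norm_of_nonneg (hpos _), Real.norm_of_nonneg (hpos _), ← integral_const_mul]
    refine integral_mono (hint (n + 1) (by push_cast; linarith)) ((hint n hn').const_mul r)
      fun t => ?_
    have := hA (((n - k + 1 / 2 : ℝ) : ℂ) + t * I) (by simpa using hn)
    refine le_of_eq_of_le ?_ this
    congr 2
    push_cast
    ring
  have hlim := hsum.tendsto_atTop_zero.const_mul ‖(2 * (Real.pi : ℂ) * I)⁻¹‖
  rw [mul_zero] at hlim
  refine squeeze_zero_norm (fun n => ?_) hlim
  rw [contourIntegral, norm_mul]
  refine mul_le_mul_of_nonneg_left ((norm_integral_le_integral_norm _).trans (le_of_eq ?_))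
    (norm_nonneg _)
  refine integral_congr_ae (.of_forall fun t => ?_)
  simp only [norm_mul, deriv_verticalLine, norm_I, mul_one]

/-- If loops are allowed as well, then the integral along vertical contours is the sum of the
residues. -/
theorem contourIntegral_vertical_eq_tsum {γ : ℝ → ℂ}
    (hγ : IsVerticalContour (gammaLeftPoles α) (gammaRightPoles k) γ)
    (hdisj : ∀ j : ℕ, (1 - k + j : ℂ) ∉ gammaLeftPoles α)
    (hw : |w.im| < ((L : ℝ) - M + 1) * Real.pi / 2) (h : L ≤ M ∨ (L = M + 1 ∧ w.re < 0)) :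
    contourIntegral (barnes α δ k w) γ = ∑' j, barnesTerm α δ k w j := by
  have h1 := (summable_barnesTerm α δ k h).hasSum.tendsto_sum_nat.add
    (tendsto_contourIntegral_verticalLine (α := α) (δ := δ) (k := k) hw h)
  rw [add_zero] at h1
  refine tendsto_nhds_unique (tendsto_const_nhds.congr' ?_) h1
  obtain ⟨A', hA'⟩ := exists_forall_re_lt α
  have : ∀ᶠ n : ℕ in atTop, A' + k - 1 / 2 ≤ n :=
    tendsto_natCast_atTop_atTop.eventually_ge_atTop _
  filter_upwards [this] with n hn
  exact (contourIntegral_vertical hγ hdisj hw (fun p hp => (hA' p hp).trans_le (by linarith))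
    rfl).2.2

lemma deriv_horizontal_right {γ : ℝ → ℂ} {y t : ℝ} (h : ∀ᶠ t in 𝓝 t, γ t = t + y * I) :
    deriv γ t = 1 := by
  have := ((ofRealCLM.hasDerivAt (x := t)).add_const ((y : ℂ) * I))
  exact (Filter.EventuallyEq.deriv_eq h).trans (by simpa using this.deriv)

lemma deriv_horizontal_left {γ : ℝ → ℂ} {y t : ℝ} (h : ∀ᶠ t in 𝓝 t, γ t = -t + y * I) :
    deriv γ t = -1 := by
  have := ((ofRealCLM.hasDerivAt (x := t)).fun_neg.add_const ((y : ℂ) * I))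
  exact (Filter.EventuallyEq.deriv_eq h).trans (by simpa using this.deriv)

/-- As y ≠ 0, the ray avoids the real right poles, and beyond A₂ it avoids the left ones. A bound on
one unit interval is propagated by the ratio estimate. -/
lemma exists_norm_barnes_horizontal_le (α : Fin L → ℂ) (δ : Fin M → ℂ) (k : ℤ)
    (h : L ≤ M ∨ (L = M + 1 ∧ w.re < 0)) {y : ℝ} (hy : y ≠ 0) :
    ∃ C ε T : ℝ, 0 < ε ∧ ∀ t, T ≤ t → ‖barnes α δ k w (t + y * I)‖ ≤ C * Real.exp (-(ε * t)) := by
  obtain ⟨A₁, r, hr₀, hr₁, hA₁⟩ := exists_norm_barnes_add_one_le α δ k h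
  obtain ⟨A₂, hA₂⟩ := exists_forall_re_lt α
  set A := max A₁ A₂ with hA
  have hcont : ContinuousOn (fun t : ℝ => barnes α δ k w (t + y * I)) (Set.Icc A (A + 1)) := by
    refine (continuousOn_barnes (α := α) (k := k) δ w (S := {s | A ≤ s.re ∧ s.im ≠ 0})
      fun s hs => ⟨fun h => ?_, ?_⟩).comp (by fun_prop) fun t ht => by simpa [hy] using ht.1
    · exact ((hA₂ s h).trans_le ((le_max_right _ _).trans hs.1)).false
    · rintro ⟨j, rfl⟩
      exact hs.2 (by simp)
  obtain ⟨K, hK⟩ := isCompact_Icc.exists_bound_of_continuousOn hcont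
  refine ⟨max K 0 * Real.exp ((A + 1) * -Real.log r), -Real.log r, A,
    neg_pos.2 (Real.log_neg hr₀ hr₁), fun t ht =>
    le_exp_of_forall_add_one_le (φ := fun t : ℝ => ‖barnes α δ k w (t + y * I)‖) hr₀ hr₁
      (le_max_right _ _) (fun t ht => ?_) (fun t ht => (hK t ht).trans (le_max_left _ _)) ht⟩
  have := hA₁ (t + y * I) (by simpa using (le_max_left _ _).trans ht)
  convert this using 3
  push_cast
  ring

lemma integrable_barnes_of_loop {γ : ℝ → ℂ} (hγ : IsPiecewiseC1 γ) {y₁ y₂ T : ℝ}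
    (h₁ : ∀ t, T ≤ t → γ t = t + y₁ * I) (h₂ : ∀ t, t ≤ -T → γ t = -t + y₂ * I)
    (hy₁ : y₁ ≠ 0) (hy₂ : y₂ ≠ 0)
    (hP : ∀ t, γ t ∉ gammaLeftPoles α ∧ γ t ∉ gammaRightPoles k)
    (h : L ≤ M ∨ (L = M + 1 ∧ w.re < 0)) :
    ContourIntegrable (barnes α δ k w) γ := by
  obtain ⟨C₁, ε₁, T₁, hε₁, hC₁⟩ := exists_norm_barnes_horizontal_le α δ k h hy₁
  obtain ⟨C₂, ε₂, T₂, hε₂, hC₂⟩ := exists_norm_barnes_horizontal_le α δ k h hy₂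
  refine LocallyIntegrable.integrable_of_norm_le_exp (C := max C₁ C₂) (ε := min ε₁ ε₂)
    (T := max (max T₁ T₂) (|T| + 1))
    (hγ.locallyIntegrable (continuousOn_barnes δ w (by rintro _ ⟨t, rfl⟩; exact hP t)))
    (lt_min hε₁ hε₂) ?_
  intro t ht
  simp only [max_le_iff] at ht
  have htT : |T| < |t| := by linarith [ht.2]
  have key : ∀ (C ε y : ℝ), C ≤ max C₁ C₂ → min ε₁ ε₂ ≤ ε → ‖deriv γ t‖ = 1 →
      γ t = |t| + y * I → ‖barnes α δ k w (|t| + y * I)‖ ≤ C * Real.exp (-(ε * |t|)) →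
      ‖barnes α δ k w (γ t) * deriv γ t‖ ≤ max C₁ C₂ * Real.exp (-(min ε₁ ε₂ * |t|)) := by
    intro C ε y hC hε hd hγt hb
    rw [norm_mul, hd, mul_one, hγt]
    have hC0 : 0 ≤ C := nonneg_of_mul_nonneg_left ((norm_nonneg _).trans hb) (Real.exp_pos _)
    refine hb.trans ?_
    have := abs_nonneg t
    gcongr
    exact hC0.trans hC
  rcases lt_abs.1 ((le_abs_self T).trans_lt htT) with h | h
  · have ht0 : 0 ≤ t := by
      by_contra! h0
      rw [abs_of_neg h0] at htT
      linarith [neg_abs_le T]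
    refine key C₁ ε₁ y₁ (le_max_left _ _) (min_le_left _ _) ?_ ?_ (hC₁ _ ht.1.1)
    · rw [deriv_horizontal_right (y := y₁) (by
        filter_upwards [Ioi_mem_nhds h] with s hs using h₁ s (le_of_lt hs)), norm_one]
    · rw [h₁ t h.le, abs_of_nonneg ht0]
  · have h' : t < -T := by linarith
    have ht0 : t ≤ 0 := by
      by_contra! h0
      rw [abs_of_pos h0] at htT
      linarith [neg_abs_le T, le_abs_self T]
    refine key C₂ ε₂ y₂ (le_max_right _ _) (min_le_right _ _) ?_ ?_ (hC₂ _ ht.1.2)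
    · rw [deriv_horizontal_left (y := y₂) (by
        filter_upwards [Iio_mem_nhds h'] with s hs using h₂ s (le_of_lt hs)), norm_neg, norm_one]
    · rw [h₂ t h'.le, abs_of_nonpos ht0]
      push_cast
      rfl

end Series

/-! ### Evaluation of the integral along loops -/

lemma hasDerivAt_log_sub {p s : ℂ} (hs : p.re < s.re) :
    HasDerivAt (fun s => log (s - p)) (1 / (s - p)) s := by
  simpa using ((hasDerivAt_id s).sub_const p).clog (Or.inl (by simp [hs]))

/-- The two points are joined by a vertical segment of fixed length, on which 1/(s-p) is at most
1/(R - Re p). -/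
lemma tendsto_log_sub_log (p : ℂ) (y₁ y₂ : ℝ) :
    Tendsto (fun R : ℝ => log (R + y₁ * I - p) - log (R + y₂ * I - p)) atTop (𝓝 0) := by
  have h0 : Tendsto (fun R' : ℝ => 1 / (R' - p.re) * ‖(y₁ * I - y₂ * I : ℂ)‖) atTop
      (𝓝 (0 * ‖(y₁ * I - y₂ * I : ℂ)‖)) :=
    ((tendsto_const_nhds.div_atTop
      (tendsto_atTop_add_const_right _ (-p.re) tendsto_id))).mul_const _
  rw [zero_mul] at h0
  refine squeeze_zero_norm' ?_ h0
  filter_upwards [eventually_gt_atTop p.re] with R' hR'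
  have hseg : ∀ s ∈ segment ℝ ((R' : ℂ) + y₂ * I) (R' + y₁ * I), s.re = R' := fun s hs => by
    simpa using re_eq_of_mem_segment (by simp) hs
  have := norm_sub_le_of_hasDerivAt_segment (K := 1 / (R' - p.re))
    (fun s hs => hasDerivAt_log_sub (p := p) (by rwa [hseg s hs])) fun s hs => by
      have h1 := abs_re_le_norm (s - p)
      rw [sub_re, hseg s hs] at h1
      rw [norm_div, norm_one]
      exact one_div_le_one_div_of_le (by linarith) ((le_abs_self _).trans h1)
  simpa using this

/-- The index of a loop from `+∞` to `+∞`, computed from the truncated loop. -/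
lemma HasContourIndex.integral_eq_of_loop {γ : ℝ → ℂ} {p ν : ℂ} (h : HasContourIndex γ p ν)
    (hγ : IsPiecewiseC1 γ) {y₁ y₂ T : ℝ}
    (h₁ : ∀ t, T ≤ t → γ t = t + y₁ * I) (h₂ : ∀ t, t ≤ -T → γ t = -t + y₂ * I) {R : ℝ}
    (hT : T ≤ R) (hp : p.re < R) :
    ∫ t in (-R)..R, deriv γ t / (γ t - p) =
      2 * Real.pi * I * ν + log (R + y₁ * I - p) - log (R + y₂ * I - p) := by
  have hcont : ∀ a b : ℝ, ContinuousOn (fun s => 1 / (s - p)) (γ '' Set.uIcc a b) := fun a b => by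
    refine continuousOn_const.div (by fun_prop) ?_
    rintro _ ⟨t, -, rfl⟩ h0
    exact h.1 ⟨t, sub_eq_zero.1 h0⟩
  have hdiv : ∀ a b : ℝ, ∫ t in a..b, deriv γ t / (γ t - p) =
      ∫ t in a..b, 1 / (γ t - p) * deriv γ t := fun a b =>
    intervalIntegral.integral_congr fun t _ => by ring
  have hlog := fun s => hasDerivAt_log_sub (p := p) (s := s)
  -- On the horizontal ends log(s-p) is a primitive, so the truncated integral minus the difference
  -- of logarithms at its end points does not depend on the truncation. Letting R' tend to infinity
  -- identifies it with 2πi times the index.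
  have hconst : ∀ R', R ≤ R' → ∫ t in (-R)..R, deriv γ t / (γ t - p) =
      (∫ t in (-R')..R', deriv γ t / (γ t - p)) -
        (log (R' + y₁ * I - p) - log (R' + y₂ * I - p)) +
        (log (R + y₁ * I - p) - log (R + y₂ * I - p)) := by
    intro R' hR
    have hi : ∀ a b, IntervalIntegrable (fun t => 1 / (γ t - p) * deriv γ t) volume a b :=
      fun a b => hγ.intervalIntegrable (hcont a b)
    have e1 : ∫ t in R..R', 1 / (γ t - p) * deriv γ t =
        log (R' + y₁ * I - p) - log (R + y₁ * I - p) := by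
      rw [hγ.integral_eq_sub (F := fun s => log (s - p)) hR (hcont _ _), h₁ R hT,
        h₁ R' (hT.trans hR)]
      intro t ht
      refine hlog _ ?_
      rw [h₁ t (hT.trans ht.1)]
      simpa using hp.trans_le ht.1
    have e2 : ∫ t in (-R')..(-R), 1 / (γ t - p) * deriv γ t =
        log (R + y₂ * I - p) - log (R' + y₂ * I - p) := by
      rw [hγ.integral_eq_sub (F := fun s => log (s - p)) (by linarith) (hcont _ _),
        h₂ (-R) (by linarith), h₂ (-R') (by linarith)]
      · push_cast
        simp only [neg_neg]
      · intro t ht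
        refine hlog _ ?_
        rw [h₂ t (by linarith [ht.2])]
        simp
        linarith [ht.2]
    have e3 := intervalIntegral.integral_add_adjacent_intervals
      ((hi (-R') (-R)).trans (hi (-R) R)) (hi R R')
    rw [← intervalIntegral.integral_add_adjacent_intervals (hi (-R') (-R)) (hi (-R) R), e1, e2]
      at e3
    rw [hdiv, hdiv]
    linear_combination e3
  have hlim := tendsto_log_sub_log p y₁ y₂
  refine tendsto_nhds_unique tendsto_const_nhds
    (Tendsto.congr' (f₁ := fun R' : ℝ => (∫ t in (-R')..R', deriv γ t / (γ t - p)) -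
        (log (R' + y₁ * I - p) - log (R' + y₂ * I - p)) +
        (log (R + y₁ * I - p) - log (R + y₂ * I - p))) ?_ ?_) (l := (atTop : Filter ℝ))
  · filter_upwards [eventually_ge_atTop R] with R' hR'
    exact (hconst R' hR').symm
  · have := (h.tendsto_integral.sub hlim).add_const
      (log (R + y₁ * I - p) - log (R + y₂ * I - p))
    convert this using 2
    ring

section Loop

variable {L M : ℕ} {α : Fin L → ℂ} {δ : Fin M → ℂ} {k : ℤ} {w : ℂ}

/-- Controls the segments that close truncated loops: their abscissas increase by 1, so a bound on
the first one decreases by the factor r at each step. -/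
lemma exists_norm_barnes_segment_le (α : Fin L → ℂ) (δ : Fin M → ℂ) (k : ℤ)
    (h : L ≤ M ∨ (L = M + 1 ∧ w.re < 0)) (y₁ y₂ : ℝ) :
    ∃ (K r : ℝ) (n₀ : ℕ), 0 < r ∧ r < 1 ∧ ∀ (m : ℕ), ∀ y ∈ Set.uIcc y₁ y₂,
      ‖barnes α δ k w ((((n₀ + m : ℕ) - k + 1 / 2 : ℝ) : ℂ) + y * I)‖ ≤ K * r ^ m := by
  obtain ⟨A₁, r, hr₀, hr₁, hA₁⟩ := exists_norm_barnes_add_one_le α δ k h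
  obtain ⟨A₂, hA₂⟩ := exists_forall_re_lt α
  obtain ⟨n₀, hn₀⟩ := exists_nat_ge (max A₁ A₂ + k - 1 / 2)
  have hcont : ContinuousOn (fun y : ℝ => barnes α δ k w (((n₀ - k + 1 / 2 : ℝ) : ℂ) + y * I))
      (Set.uIcc y₁ y₂) := by
    refine (continuousOn_barnes (α := α) (k := k) δ w
      (S := Set.range fun y : ℝ => (((n₀ - k + 1 / 2 : ℝ) : ℂ) + y * I)) ?_).comp (by fun_prop)
      fun y _ => ⟨y, rfl⟩
    rintro _ ⟨y, rfl⟩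
    exact verticalLine_notMem_poles
      (fun p hp => (hA₂ p hp).trans_le (by linarith [le_max_right A₁ A₂])) rfl y
  obtain ⟨K, hK⟩ := isCompact_uIcc.exists_bound_of_continuousOn hcont
  refine ⟨K, r, n₀, hr₀, hr₁, fun m => ?_⟩
  induction m with
  | zero => simpa using hK
  | succ m ih =>
    intro y hy
    have h1 := hA₁ ((((n₀ + m : ℕ) - k + 1 / 2 : ℝ) : ℂ) + y * I) (by
      have : (0 : ℝ) ≤ m := Nat.cast_nonneg m
      simp
      linarith [le_max_left A₁ A₂])
    have h2 := mul_le_mul_of_nonneg_left (ih y hy) hr₀.le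
    have e : ((((n₀ + m : ℕ) - k + 1 / 2 : ℝ) : ℂ) + y * I) + 1 =
        (((n₀ + (m + 1) : ℕ) - k + 1 / 2 : ℝ) : ℂ) + y * I := by
      push_cast
      ring
    rw [e] at h1
    calc _ ≤ _ := h1
      _ ≤ _ := h2
      _ = _ := by ring

/-- The integral along a loop is the sum of the residues. -/
theorem contourIntegral_loop {γ : ℝ → ℂ}
    (hγ : IsLoopContour (gammaLeftPoles α) (gammaRightPoles k) γ)
    (hdisj : ∀ j : ℕ, (1 - k + j : ℂ) ∉ gammaLeftPoles α)
    (h : L ≤ M ∨ (L = M + 1 ∧ w.re < 0)) :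
    ContourIntegrable (barnes α δ k w) γ ∧
    contourIntegral (barnes α δ k w) γ = ∑' j, barnesTerm α δ k w j := by
  classical
  obtain ⟨hγ1, ⟨y₁, y₂, T, h₁, h₂⟩, hP, hQ⟩ := hγ
  have hγP : ∀ t, γ t ∉ gammaLeftPoles α ∧ γ t ∉ gammaRightPoles k := fun t =>
    ⟨fun h => (hP _ h).1 ⟨t, rfl⟩, fun h => (hQ _ h).1 ⟨t, rfl⟩⟩
  obtain ⟨j₀, hj₀⟩ := exists_nat_ge (T + k - 1)
  -- A loop with an end on the real axis would run through right poles.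
  have hy₁ : y₁ ≠ 0 := by
    rintro rfl
    refine (hγP (1 - k + j₀)).2 ⟨j₀, ?_⟩
    rw [h₁ _ (by linarith)]
    push_cast
    ring
  have hy₂ : y₂ ≠ 0 := by
    rintro rfl
    refine (hγP (-(1 - k + j₀))).2 ⟨j₀, ?_⟩
    rw [h₂ _ (by linarith)]
    push_cast
    ring
  have hint := integrable_barnes_of_loop (δ := δ) hγ1 h₁ h₂ hy₁ hy₂ hγP h
  refine ⟨hint, ?_⟩
  obtain ⟨B, hB⟩ := isCompact_Icc.exists_bound_of_continuousOn
    (hγ1.1.continuousOn (s := Set.Icc (-T) T))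
  have hB' : ∀ t ∈ Set.Icc (-T) T, |(γ t).re| ≤ B := fun t ht =>
    (abs_re_le_norm _).trans (hB t ht)
  set A₀ := -(max B (max |T| |(1 - k : ℝ)|)) - 1 with hA₀
  have hA₀T : A₀ < T := by
    have := le_max_left |T| |(1 - k : ℝ)|
    have := le_max_right B (max |T| |(1 - k : ℝ)|)
    have := neg_abs_le T
    linarith
  have hA₀B : A₀ < -B := by linarith [le_max_left B (max |T| |(1 - k : ℝ)|)]
  have hA₀k : A₀ < 1 - k := by
    have := le_max_right |T| |(1 - k : ℝ)|
    have := le_max_right B (max |T| |(1 - k : ℝ)|)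
    have := neg_abs_le (1 - k : ℝ)
    linarith
  have hγre : ∀ t, A₀ < (γ t).re ∧ (γ t).re ≤ max B |t| := by
    intro t
    rcases le_total T t with ht | ht
    · rw [h₁ t ht]
      simpa using ⟨hA₀T.trans_le ht, Or.inr (le_abs_self t)⟩
    rcases le_total t (-T) with ht' | ht'
    · rw [h₂ t ht']
      simp only [add_re, neg_re, ofReal_re, mul_re, I_re, mul_zero, ofReal_im, I_im, mul_one,
        sub_self, add_zero, le_max_iff]
      exact ⟨by linarith, Or.inr (neg_le_abs t)⟩
    · have := abs_le.1 (hB' t ⟨ht', ht⟩)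
      exact ⟨by linarith, this.2.trans (le_max_left _ _)⟩
  obtain ⟨A', hA'⟩ := exists_forall_re_lt α
  have hQre : ∀ j : ℕ, (1 - k + j : ℂ).re = 1 - k + j := fun j => by simp
  -- the truncated loop
  have key : ∀ (n : ℕ) (X K : ℝ), X = n - k + 1 / 2 → T ≤ X → B ≤ X → A' ≤ X → A₀ < X → 0 ≤ X →
      (∀ y ∈ Set.uIcc y₂ y₁, ‖barnes α δ k w (X + y * I)‖ ≤ K) →
      ‖(∫ t in (-X)..X, barnes α δ k w (γ t) * deriv γ t) -
        2 * Real.pi * I * ∑ j ∈ Finset.range n, barnesTerm α δ k w j‖ ≤ K * |y₁ - y₂| := by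
    intro n X K hX hXT hXB hXA hXA₀ hX0 hK
    -- The next right pole is at X + 1/2, so all poles of this strip lie to the left of the closing
    -- segment Re s = X.
    set U := {s : ℂ | A₀ < s.re ∧ s.re < X + 1 / 4} with hU
    set F := (finite_poles α k A₀ (X + 1 / 4)).toFinset with hF
    have hFmem : ∀ p, p ∈ F ↔ p ∈ gammaLeftPoles α ∪ gammaRightPoles k ∧ p ∈ U := fun p => by
      simp [hF, hU]
    have hFre : ∀ p ∈ F, p.re < X := by
      intro p hp
      rcases (hFmem p).1 hp with ⟨h | ⟨j, rfl⟩, hpU⟩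
      · exact (hA' p h).trans_le hXA
      · have hjX := hpU.2
        rw [hQre, hX] at hjX ⊢
        have : (j : ℝ) < n := by
          have h3 : (4 * (j : ℤ) : ℝ) < 4 * (n : ℤ) - 1 := by push_cast; linarith
          have h3 : 4 * (j : ℤ) < 4 * (n : ℤ) - 1 := by exact_mod_cast h3
          exact_mod_cast (by omega : (j : ℤ) < n)
        have : (j : ℝ) + 1 ≤ n := by exact_mod_cast this
        linarith
    have hdiff : DifferentiableOn ℂ (barnes α δ k w) (U \ F) := by
      rintro s ⟨hs, hs'⟩
      have : s ∉ gammaLeftPoles α ∪ gammaRightPoles k := fun h => hs' ((hFmem s).2 ⟨h, hs⟩)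
      simp only [Set.mem_union, not_or] at this
      exact (differentiableAt_barnes w this.1 this.2).differentiableWithinAt
    obtain ⟨r, H, hH, hr⟩ := exists_primitive_sub_residues (isOpen_re_Ioo A₀ (X + 1 / 4))
      (convex_re_Ioo A₀ (X + 1 / 4)) F hdiff fun p _ => meromorphicAt_barnes w p
    have hγU : ∀ t ∈ Set.Icc (-X) X, γ t ∈ U \ F := fun t ht => by
      have ht' := abs_le.2 ht
      refine ⟨⟨(hγre t).1, ((hγre t).2.trans (max_le hXB ht')).trans_lt (by linarith)⟩,
        fun h => ?_⟩
      rcases ((hFmem _).1 h).1 with h | h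
      · exact (hγP t).1 h
      · exact (hγP t).2 h
    -- The integral of 1/(s-p) along the truncated loop, without the difference of logarithms at the
    -- end points.
    set c : ℂ → ℂ := fun p => if p ∈ gammaLeftPoles α then 0 else
      if p.re < X then -(2 * Real.pi * I) else 0 with hc
    have hIγ : ∀ p ∈ F, ∫ t in (-X)..X, deriv γ t / (γ t - p) =
        c p + log (X + y₁ * I - p) - log (X + y₂ * I - p) := by
      intro p hp
      by_cases hpP : p ∈ gammaLeftPoles α
      · rw [(hP p hpP).integral_eq_of_loop hγ1 h₁ h₂ hXT (hFre p hp)]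
        simp only [hc, if_pos hpP, mul_zero]
      · rw [(hQ p (((hFmem p).1 hp).1.resolve_left hpP)).integral_eq_of_loop hγ1 h₁ h₂ hXT
          (hFre p hp)]
        simp only [hc, if_neg hpP, if_pos (hFre p hp)]
        ring
    have hsum : ∑ p ∈ F, r p * c p =
        2 * Real.pi * I * ∑ j ∈ Finset.range n, barnesTerm α δ k w j := by
      have hmem : ∀ j < n, (1 - k + j : ℂ) ∈ F ∧ (1 - k + j : ℂ).re < X := by
        intro j hj
        have : (j : ℝ) + 1 ≤ n := by exact_mod_cast hj
        have hj0 : (0 : ℝ) ≤ j := Nat.cast_nonneg j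
        refine ⟨(hFmem _).2 ⟨Or.inr ⟨j, rfl⟩, ?_⟩, by rw [hQre, hX]; linarith⟩
        simp only [hU, Set.mem_ofPred_eq, hQre]
        constructor <;> linarith
      rw [sum_residues_eq (fun p hp => ((hFmem p).1 hp).1) (n := n) (a := -(2 * Real.pi * I))
        (δ := δ) (w := w) (fun j hj => (hmem j hj).1), neg_neg]
      · exact fun j hj => hr _ (hmem j hj).1 _ (tendsto_sub_mul_barnes w j (hdisj j))
      · intro p hp
        simp only [hc, if_pos hp]
      · intro j hj
        simp only [hc, hdisj j, if_false, if_pos (hmem j hj).2]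
      · intro j hj
        have : (n : ℝ) ≤ j := by exact_mod_cast hj
        have h : ¬ (1 - k + j : ℂ).re < X := by rw [hQre, hX]; linarith
        simp only [hc, hdisj j, if_false, h]
    have hmain := integral_eq_sum_residues_add_sub hdiff hH hγ1 (by linarith : -X ≤ X) hγU
    rw [Finset.sum_congr rfl fun p hp => by rw [hIγ p hp], h₁ X hXT, h₂ (-X) (by linarith)]
      at hmain
    have hseg : ∀ s ∈ segment ℝ ((X : ℂ) + y₂ * I) (X + y₁ * I), s.re = X := fun s hs => by
      simpa using re_eq_of_mem_segment (by simp) hs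
    -- H + ∑ r_p log(s-p) is a primitive of the integrand itself along the closing segment. Its
    -- increment there is the truncated loop integral minus 2πi times the partial sum.
    have hest := norm_sub_le_of_hasDerivAt_segment (z := (X : ℂ) + y₂ * I) (z' := X + y₁ * I)
      (H := fun s => H s + ∑ p ∈ F, r p * log (s - p)) (g := barnes α δ k w) (K := K)
      (fun s hs => by
        have hsX := hseg s hs
        have h1 := hH s ⟨⟨by rw [hsX]; exact hXA₀, by rw [hsX]; linarith⟩, fun hsF =>
          (hFre s hsF).ne hsX⟩
        have h2 : HasDerivAt (fun s => ∑ p ∈ F, r p * log (s - p)) (∑ p ∈ F, r p / (s - p)) s := by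
          refine HasDerivAt.fun_sum fun p hp => ?_
          have := (((hasDerivAt_id s).sub_const p).clog (Or.inl (by
            simp only [id, sub_re, hsX]
            linarith [hFre p hp]))).const_mul (r p)
          refine this.congr_deriv ?_
          simp [div_eq_mul_inv]
        refine (h1.fun_add h2).congr_deriv ?_
        ring) (fun s hs => by
        have hsX := hseg s hs
        have him := im_mem_uIcc_of_mem_segment hs
        have := hK s.im (by simpa using him)
        rwa [← hsX, re_add_im] at this)
    have e : (∫ t in (-X)..X, barnes α δ k w (γ t) * deriv γ t) -
        2 * Real.pi * I * ∑ j ∈ Finset.range n, barnesTerm α δ k w j =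
        (H (X + y₁ * I) + ∑ p ∈ F, r p * log (X + y₁ * I - p)) -
        (H (X + y₂ * I) + ∑ p ∈ F, r p * log (X + y₂ * I - p)) := by
      rw [hmain, ← hsum]
      simp only [mul_add, mul_sub, Finset.sum_add_distrib, Finset.sum_sub_distrib]
      push_cast
      rw [neg_neg]
      ring
    rw [e]
    refine hest.trans (le_of_eq ?_)
    congr 1
    have : (X + y₁ * I - (X + y₂ * I) : ℂ) = ((y₁ - y₂ : ℝ) : ℂ) * I := by push_cast; ring
    rw [this, norm_mul, norm_I, mul_one, norm_real, Real.norm_eq_abs]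
  obtain ⟨K, r, n₀, hr₀, hr₁, hK⟩ := exists_norm_barnes_segment_le α δ k h y₂ y₁
  set X : ℕ → ℝ := fun m => (n₀ + m : ℕ) - k + 1 / 2 with hX
  have hXlim : Tendsto X atTop atTop := by
    have h1 : Tendsto (fun m : ℕ => ((n₀ + m : ℕ) : ℝ)) atTop atTop :=
      tendsto_natCast_atTop_atTop.comp (tendsto_add_atTop_nat n₀ |>.congr fun m => by ring)
    refine (tendsto_atTop_add_const_right _ (-(k : ℝ) + 1 / 2) h1).congr fun m => ?_
    simp only [hX]
    ring
  have hlim1 : Tendsto (fun m => ∫ t in (-(X m))..(X m), barnes α δ k w (γ t) * deriv γ t) atTop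
      (𝓝 (∫ t, barnes α δ k w (γ t) * deriv γ t)) :=
    intervalIntegral_tendsto_integral hint (tendsto_neg_atTop_atBot.comp hXlim) hXlim
  have hlim2 : Tendsto (fun m => 2 * Real.pi * I * ∑ j ∈ Finset.range (n₀ + m),
      barnesTerm α δ k w j) atTop (𝓝 (2 * Real.pi * I * ∑' j, barnesTerm α δ k w j)) :=
    ((summable_barnesTerm α δ k h).hasSum.tendsto_sum_nat.comp
      (tendsto_add_atTop_nat n₀ |>.congr fun m => by ring)).const_mul _
  have hlim3 : Tendsto (fun m => (∫ t in (-(X m))..(X m), barnes α δ k w (γ t) * deriv γ t) -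
      2 * Real.pi * I * ∑ j ∈ Finset.range (n₀ + m), barnesTerm α δ k w j) atTop (𝓝 0) := by
    have h0 : Tendsto (fun m : ℕ => K * r ^ m * |y₁ - y₂|) atTop (𝓝 (K * 0 * |y₁ - y₂|)) :=
      ((tendsto_pow_atTop_nhds_zero_of_lt_one hr₀.le hr₁).const_mul K).mul_const _
    rw [mul_zero, zero_mul] at h0
    refine squeeze_zero_norm' ?_ h0
    filter_upwards [hXlim.eventually_ge_atTop T, hXlim.eventually_ge_atTop B,
      hXlim.eventually_ge_atTop A', hXlim.eventually_gt_atTop A₀, hXlim.eventually_ge_atTop 0]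
      with m g1 g2 g3 g4 g5
    exact key (n₀ + m) (X m) _ rfl g1 g2 g3 g4 g5 fun y hy => hK m y hy
  have heq := tendsto_nhds_unique hlim3 (hlim1.sub hlim2)
  rw [contourIntegral, sub_eq_zero.1 heq.symm, ← mul_assoc,
    inv_mul_cancel₀ Complex.two_pi_I_ne_zero, one_mul]

end Loop

/-! ### Construction of separating contours -/

lemma IsPiecewiseC1.comp_sub {γ : ℝ → ℂ} (h : IsPiecewiseC1 γ) (a : ℝ) :
    IsPiecewiseC1 (fun t => γ (t - a)) := by
  classical
  obtain ⟨hc, S, hS⟩ := h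
  refine ⟨hc.comp (continuous_id.sub continuous_const), S.image (· + a), fun x y hxy hs => ?_⟩
  refine (hS (x - a) (y - a) (by linarith) fun t ht h => hs (t + a)
    (Finset.mem_image_of_mem _ ht) ⟨by linarith [h.1], by linarith [h.2]⟩).comp
    (contDiff_id.sub contDiff_const).contDiffOn fun t ht => ⟨?_, ?_⟩
  · simpa using ht.1
  · simpa using ht.2

lemma isPiecewiseC1_affine (u v : ℂ) : IsPiecewiseC1 (fun t : ℝ => u + t * v) := by
  refine .of_contDiff ?_
  have : ContDiff ℝ 1 (fun t : ℝ => (t : ℂ)) := ofRealCLM.contDiff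
  fun_prop

lemma deriv_affine (u v : ℂ) (t : ℝ) : deriv (fun t : ℝ => u + t * v) t = v := by
  have := ((ofRealCLM.hasDerivAt (x := t)).mul_const v).const_add u
  simpa using this.deriv

/-- The integral of `γ' / (γ - p)` is additive in the interval. -/
lemma IsPiecewiseC1.integral_div_add {γ : ℝ → ℂ} (h : IsPiecewiseC1 γ) {p : ℂ} {x y z : ℝ}
    (hxy : x ≤ y) (hyz : y ≤ z) (hp : ∀ t ∈ Set.Icc x z, γ t ≠ p) :
    ∫ t in x..z, deriv γ t / (γ t - p) =
      (∫ t in x..y, deriv γ t / (γ t - p)) + ∫ t in y..z, deriv γ t / (γ t - p) := by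
  have hi : ∀ a b, x ≤ a → a ≤ b → b ≤ z →
      IntervalIntegrable (fun t => deriv γ t / (γ t - p)) volume a b := fun a b h1 h2 h3 => by
    have := h.intervalIntegrable (f := fun s => 1 / (s - p)) (a := a) (b := b) (by
      refine continuousOn_const.div (by fun_prop) ?_
      rintro _ ⟨t, ht, rfl⟩ h0
      rw [Set.uIcc_of_le h2] at ht
      exact hp t ⟨h1.trans ht.1, ht.2.trans h3⟩ (sub_eq_zero.1 h0))
    refine this.congr (fun t _ => ?_)
    ring
  exact (intervalIntegral.integral_add_adjacent_intervals (hi x y le_rfl hxy hyz)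
    (hi y z hxy hyz le_rfl)).symm

lemma IsPiecewiseC1.integral_div_eq_sub {γ : ℝ → ℂ} (h : IsPiecewiseC1 γ) {p : ℂ} {x y : ℝ}
    (hxy : x ≤ y) {F : ℂ → ℂ} (hp : ∀ t ∈ Set.Icc x y, γ t ≠ p)
    (hF : ∀ t ∈ Set.Icc x y, HasDerivAt F (1 / (γ t - p)) (γ t)) :
    ∫ t in x..y, deriv γ t / (γ t - p) = F (γ y) - F (γ x) := by
  rw [← h.integral_eq_sub (f := fun s => 1 / (s - p)) hxy ?_ hF]
  · exact intervalIntegral.integral_congr fun t _ => by ring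
  · refine continuousOn_const.div (by fun_prop) ?_
    rintro _ ⟨t, ht, rfl⟩ h0
    rw [Set.uIcc_of_le hxy] at ht
    exact hp t ht (sub_eq_zero.1 h0)

lemma integral_div_glue_left {γ γ' : ℝ → ℂ} {a x y : ℝ} (p : ℂ) (hx : x ≤ a) (hy : y ≤ a) :
    ∫ t in x..y, deriv (fun t => if t ≤ a then γ t else γ' t) t /
        ((if t ≤ a then γ t else γ' t) - p) = ∫ t in x..y, deriv γ t / (γ t - p) := by
  have := integral_glue_left (γ := γ) (γ' := γ') (fun s => 1 / (s - p)) hx hy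
  simpa only [one_div_mul_eq_div] using this

lemma integral_div_glue_right {γ γ' : ℝ → ℂ} {a x y : ℝ} (p : ℂ) (hx : a ≤ x) (hy : a ≤ y) :
    ∫ t in x..y, deriv (fun t => if t ≤ a then γ t else γ' t) t /
        ((if t ≤ a then γ t else γ' t) - p) = ∫ t in x..y, deriv γ' t / (γ' t - p) := by
  have := integral_glue_right (γ := γ) (γ' := γ') (fun s => 1 / (s - p)) hx hy
  simpa only [one_div_mul_eq_div] using this

lemma integral_div_comp_sub (γ : ℝ → ℂ) (p : ℂ) (a x y : ℝ) :
    ∫ t in x..y, deriv (fun t => γ (t - a)) t / (γ (t - a) - p) =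
      ∫ t in (x - a)..(y - a), deriv γ t / (γ t - p) := by
  simp_rw [deriv_comp_sub_const]
  exact intervalIntegral.integral_comp_sub_right (fun t => deriv γ t / (γ t - p)) a

lemma glue_apply_right {γ γ' : ℝ → ℂ} {a t : ℝ} (h : a ≤ t) (ha : γ a = γ' a) :
    (if t ≤ a then γ t else γ' t) = γ' t := by
  rcases h.eq_or_lt with rfl | h
  · rw [if_pos le_rfl, ha]
  · rw [if_neg h.not_ge]

/-- The point of the circle of radius `h` about `q`, starting above `q`, run through once in the
negative sense on `[1, 2]`. -/
def circlePath (q : ℂ) (h t : ℝ) : ℂ := q + h * I * exp (-(2 * Real.pi * I) * (t - 1))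

lemma hasDerivAt_circlePath (q : ℂ) (h t : ℝ) :
    HasDerivAt (circlePath q h) (-(2 * Real.pi * I) * (circlePath q h t - q)) t := by
  have h1 : HasDerivAt (fun t : ℝ => -(2 * Real.pi * I) * ((t : ℂ) - 1)) (-(2 * Real.pi * I)) t := by
    simpa using ((ofRealCLM.hasDerivAt (x := t)).sub_const 1).const_mul (-(2 * Real.pi * I : ℂ))
  refine ((h1.cexp.const_mul (h * I : ℂ)).const_add q).congr_deriv ?_
  simp only [circlePath]
  ring

lemma isPiecewiseC1_circlePath (q : ℂ) (h : ℝ) : IsPiecewiseC1 (circlePath q h) := by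
  refine .of_contDiff ?_
  have : ContDiff ℝ 1 (fun t : ℝ => (t : ℂ)) := ofRealCLM.contDiff
  unfold circlePath
  fun_prop

lemma norm_circlePath_sub (q : ℂ) {h : ℝ} (hh : 0 ≤ h) (t : ℝ) : ‖circlePath q h t - q‖ = h := by
  have : (-(2 * Real.pi * I) * ((t : ℂ) - 1)) = ((-(2 * Real.pi * (t - 1)) : ℝ) : ℂ) * I := by
    push_cast
    ring
  rw [circlePath, add_sub_cancel_left, this, norm_mul, norm_exp_ofReal_mul_I, norm_mul, norm_I,
    norm_real, Real.norm_of_nonneg hh, mul_one, mul_one]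

lemma circlePath_one (q : ℂ) (h : ℝ) : circlePath q h 1 = q + h * I := by simp [circlePath]

lemma circlePath_two (q : ℂ) (h : ℝ) : circlePath q h 2 = q + h * I := by
  have : (-(2 * Real.pi * I) * (((2 : ℝ) : ℂ) - 1)) = -(2 * Real.pi * I) := by
    push_cast
    ring
  rw [circlePath, this, exp_neg, exp_two_pi_mul_I, inv_one, mul_one]

lemma integral_circlePath_self (q : ℂ) {h : ℝ} (hh : 0 < h) :
    ∫ t in (1 : ℝ)..2, deriv (circlePath q h) t / (circlePath q h t - q) = -(2 * Real.pi * I) := by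
  have : ∀ t, deriv (circlePath q h) t / (circlePath q h t - q) = -(2 * Real.pi * I) := fun t => by
    have h0 : circlePath q h t - q ≠ 0 := norm_pos_iff.1 (by rwa [norm_circlePath_sub q hh.le])
    rw [(hasDerivAt_circlePath q h t).deriv, mul_div_assoc, div_self h0, mul_one]
  simp_rw [this]
  norm_num

/-- On the circle (s-p)/(q-p) stays in a disc about 1 of radius less than 1, where the logarithm is
holomorphic, and the circle is closed. -/
lemma integral_circlePath_of_lt {p q : ℂ} {h : ℝ} (hh : 0 < h) (hp : h < ‖p - q‖) :
    ∫ t in (1 : ℝ)..2, deriv (circlePath q h) t / (circlePath q h t - p) = 0 := by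
  have hpq : q - p ≠ 0 := norm_pos_iff.1 (by rw [norm_sub_rev]; exact hh.trans hp)
  have hne : ∀ t, circlePath q h t ≠ p := fun t h0 => by
    have := norm_circlePath_sub q hh.le t
    rw [h0] at this
    exact hp.ne' this
  rw [(isPiecewiseC1_circlePath q h).integral_div_eq_sub (by norm_num)
    (F := fun s => log ((s - p) / (q - p))) (fun t _ => hne t), circlePath_one, circlePath_two,
    sub_self]
  intro t _
  have hmem : (circlePath q h t - p) / (q - p) ∈ slitPlane := by
    have e : (circlePath q h t - p) / (q - p) = 1 + (circlePath q h t - q) / (q - p) := by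
      field_simp
      ring
    rw [e]
    refine mem_slitPlane_of_norm_lt_one ?_
    rw [norm_div, norm_circlePath_sub q hh.le, norm_sub_rev q p, div_lt_one (hh.trans hp)]
    exact hp
  refine ((((hasDerivAt_id _).sub_const p).div_const (q - p)).clog hmem).congr_deriv ?_
  exact div_div_div_cancel_right₀ hpq _ _

/-- A lasso that starts at `b`, goes straight to the point `q + h i`, runs through the circle of
radius `h` about `q` in the negative sense, and goes straight back. -/
def lasso (b q : ℂ) (h t : ℝ) : ℂ :=
  if t ≤ 1 then b + t * (q + h * I - b)
  else if t ≤ 2 then circlePath q h t else b + 3 * (q + h * I - b) + t * -(q + h * I - b)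

section Lasso

variable {b q : ℂ} {h : ℝ}

lemma lasso_eq (b q : ℂ) (h : ℝ) : lasso b q h = fun t => if t ≤ 1 then
    (fun t : ℝ => b + t * (q + h * I - b)) t else (fun t : ℝ => if t ≤ 2 then circlePath q h t else
      (fun t : ℝ => b + 3 * (q + h * I - b) + t * -(q + h * I - b)) t) t := rfl

lemma circlePath_two_eq (b q : ℂ) (h : ℝ) : circlePath q h 2 =
    b + 3 * (q + h * I - b) + (2 : ℝ) * -(q + h * I - b) := by
  rw [circlePath_two]
  push_cast
  ring

lemma isPiecewiseC1_lasso (b q : ℂ) (h : ℝ) : IsPiecewiseC1 (lasso b q h) := by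
  rw [lasso_eq]
  refine (isPiecewiseC1_affine _ _).glue ((isPiecewiseC1_circlePath q h).glue
    (isPiecewiseC1_affine _ _) (circlePath_two_eq b q h)) ?_
  simp [circlePath_one]

lemma lasso_zero (b q : ℂ) (h : ℝ) : lasso b q h 0 = b := by simp [lasso]

lemma lasso_three (b q : ℂ) (h : ℝ) : lasso b q h 3 = b := by
  rw [lasso, if_neg (by norm_num), if_neg (by norm_num)]
  push_cast
  ring

/-- The straight parts lie on the line Im s = h, and the circle has radius h. -/
lemma lasso_ne (hh : 0 < h) (hb : b.im = h) (hq : q.im = 0) {p : ℂ} (hp : p.im ≠ h)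
    (hpq : p = q ∨ h < ‖p - q‖) (t : ℝ) : lasso b q h t ≠ p := by
  intro h0
  rw [lasso] at h0
  split_ifs at h0
  · refine hp ?_
    rw [← h0]
    simp [hb, hq]
  · have h1 := norm_circlePath_sub q hh.le t
    rw [h0] at h1
    rcases hpq with rfl | h2
    · simp only [sub_self, norm_zero] at h1
      exact hh.ne h1
    · exact h2.ne' h1
  · refine hp ?_
    rw [← h0]
    simp [hb, hq]

/-- The two straight parts cancel, and only the circle contributes. -/
lemma integral_lasso (hh : 0 < h) (hb : b.im = h) (hq : q.im = 0) {p : ℂ} (hp : p.im ≠ h)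
    (hpq : p = q ∨ h < ‖p - q‖) :
    ∫ t in (0 : ℝ)..3, deriv (lasso b q h) t / (lasso b q h t - p) =
      if p = q then -(2 * Real.pi * I) else 0 := by
  have hne := lasso_ne hh hb hq hp hpq
  have hc1 := isPiecewiseC1_lasso b q h
  rw [hc1.integral_div_add (y := 1) (by norm_num) (by norm_num) fun t _ => hne t,
    hc1.integral_div_add (x := 1) (y := 2) (by norm_num) (by norm_num) fun t _ => hne t]
  have e1 : ∫ t in (0 : ℝ)..1, deriv (lasso b q h) t / (lasso b q h t - p) =
      ∫ t in (0 : ℝ)..1, (q + h * I - b) / (b + t * (q + h * I - b) - p) := by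
    rw [lasso_eq, integral_div_glue_left p (by norm_num) le_rfl]
    simp_rw [deriv_affine]
  have e2 : ∫ t in (1 : ℝ)..2, deriv (lasso b q h) t / (lasso b q h t - p) =
      ∫ t in (1 : ℝ)..2, deriv (circlePath q h) t / (circlePath q h t - p) := by
    rw [lasso_eq, integral_div_glue_right p le_rfl (by norm_num),
      integral_div_glue_left p (by norm_num) le_rfl]
  have e3 : ∫ t in (2 : ℝ)..3, deriv (lasso b q h) t / (lasso b q h t - p) =
      -∫ t in (0 : ℝ)..1, (q + h * I - b) / (b + t * (q + h * I - b) - p) := by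
    rw [lasso_eq, integral_div_glue_right p (by norm_num) (by norm_num),
      integral_div_glue_right p le_rfl (by norm_num)]
    simp_rw [deriv_affine]
    have := intervalIntegral.integral_comp_sub_left
      (fun t : ℝ => (q + h * I - b) / (b + t * (q + h * I - b) - p)) (a := 2) (b := 3) 3
    rw [sub_self, show (3 - 2 : ℝ) = 1 by norm_num] at this
    rw [← this, ← intervalIntegral.integral_neg]
    refine intervalIntegral.integral_congr fun t _ => ?_
    rw [neg_div]
    congr 2
    push_cast
    ring
  rw [e1, e2, e3]
  rcases eq_or_ne p q with rfl | hne'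
  · rw [integral_circlePath_self p hh, if_pos rfl]
    ring
  · rw [integral_circlePath_of_lt hh (hpq.resolve_left hne'), if_neg hne']
    ring

end Lasso

/-- A closed curve that encircles the points `q 0, …, q (N - 1)` once in the negative sense and no
other point of `Z`. -/
lemma exists_closed_curve {Z : Set ℂ} {q : ℕ → ℂ} {b : ℂ} {h : ℝ} (hh : 0 < h) (hb : b.im = h)
    (hq : ∀ j, (q j).im = 0) (hqi : Function.Injective q) (hZ : ∀ p ∈ Z, p.im ≠ h) (N : ℕ)
    (hZq : ∀ p ∈ Z, ∀ j < N, p = q j ∨ h < ‖p - q j‖) :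
    ∃ (η : ℝ → ℂ) (τ : ℝ), 0 ≤ τ ∧ IsPiecewiseC1 η ∧ η 0 = b ∧ η τ = b ∧
      ∀ p ∈ Z, (∀ t ∈ Set.Icc 0 τ, η t ≠ p) ∧
        ((∃ j < N, p = q j) → ∫ t in (0 : ℝ)..τ, deriv η t / (η t - p) = -(2 * Real.pi * I)) ∧
        ((¬ ∃ j < N, p = q j) → ∫ t in (0 : ℝ)..τ, deriv η t / (η t - p) = 0) := by
  induction N with
  | zero =>
    refine ⟨fun _ => b, 0, le_rfl, .of_contDiff contDiff_const, rfl, rfl, fun p hp =>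
      ⟨fun t _ h0 => hZ p hp (h0 ▸ hb), by simp, by simp⟩⟩
  | succ N ih =>
    obtain ⟨η, τ, hτ, hη, h0, h1, hZη⟩ := ih fun p hp j hj => hZq p hp j (by omega)
    have hglue : η τ = lasso b (q N) h (τ - τ) := by rw [sub_self, lasso_zero, h1]
    have hc1 := hη.glue ((isPiecewiseC1_lasso b (q N) h).comp_sub τ) hglue
    have hl3 : lasso b (q N) h (τ + 3 - τ) = b := by rw [add_sub_cancel_left, lasso_three]
    -- One more lasso is appended at the common base point b; its circle has index about q N only.
    refine ⟨fun t => if t ≤ τ then η t else lasso b (q N) h (t - τ), τ + 3, by linarith, hc1, ?_, ?_,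
      fun p hp => ?_⟩
    · exact (if_pos hτ).trans h0
    · exact (if_neg (by linarith)).trans hl3
    · obtain ⟨hp1, hp2, hp3⟩ := hZη p hp
      have hne : ∀ t ∈ Set.Icc 0 (τ + 3),
          (if t ≤ τ then η t else lasso b (q N) h (t - τ)) ≠ p := by
        intro t ht
        split_ifs with hle
        · exact hp1 t ⟨ht.1, hle⟩
        · exact lasso_ne hh hb (hq N) (hZ p hp) (hZq p hp N (by omega)) _
      have hint : ∫ t in (0 : ℝ)..(τ + 3),
          deriv (fun t => if t ≤ τ then η t else lasso b (q N) h (t - τ)) t /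
            ((if t ≤ τ then η t else lasso b (q N) h (t - τ)) - p) =
          (∫ t in (0 : ℝ)..τ, deriv η t / (η t - p)) +
            if p = q N then -(2 * Real.pi * I) else 0 := by
        rw [hc1.integral_div_add hτ (by linarith) hne, integral_div_glue_left p hτ le_rfl,
          integral_div_glue_right (γ' := fun t => lasso b (q N) h (t - τ)) p le_rfl (by linarith),
          integral_div_comp_sub, sub_self, add_sub_cancel_left,
          integral_lasso hh hb (hq N) (hZ p hp) (hZq p hp N (by omega))]
      refine ⟨hne, ?_, ?_⟩
      · rintro ⟨j, hj, rfl⟩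
        rcases (Nat.lt_succ_iff.1 hj).eq_or_lt with rfl | hj'
        · rw [hint, if_pos rfl, hp3, zero_add]
          rintro ⟨i, hi, hij⟩
          exact hi.ne' (hqi hij)
        · rw [hint, if_neg fun h => hj'.ne (hqi h), hp2 ⟨j, hj', rfl⟩, add_zero]
      · intro hn
        rw [hint, if_neg fun h => hn ⟨N, by omega, h⟩, hp3, add_zero]
        rintro ⟨j, hj, hj'⟩
        exact hn ⟨j, by omega, hj'⟩

/-- Insertion of a closed curve between two curves. -/
lemma exists_insert {A B η : ℝ → ℂ} {a τ : ℝ} {b : ℂ} (hτ : 0 ≤ τ) (hA : IsPiecewiseC1 A)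
    (hB : IsPiecewiseC1 B) (hη : IsPiecewiseC1 η) (hAa : A a = b) (hη0 : η 0 = b) (hητ : η τ = b)
    (hBa : B (a + τ) = b) :
    ∃ γ : ℝ → ℂ, IsPiecewiseC1 γ ∧ (∀ t ≤ a, γ t = A t) ∧ (∀ t, a + τ ≤ t → γ t = B t) ∧
      ∀ p, (∀ t ≤ a, A t ≠ p) → (∀ t ∈ Set.Icc 0 τ, η t ≠ p) → (∀ t, a + τ ≤ t → B t ≠ p) →
        p ∉ Set.range γ ∧ ∀ F : ℂ → ℂ, (∀ t ≤ a, HasDerivAt F (1 / (A t - p)) (A t)) →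
          (∀ t, a + τ ≤ t → HasDerivAt F (1 / (B t - p)) (B t)) → ∀ R, -R ≤ a → a + τ ≤ R →
          ∫ t in (-R)..R, deriv γ t / (γ t - p) =
            F (B R) - F (A (-R)) + ∫ t in (0 : ℝ)..τ, deriv η t / (η t - p) := by
  have hg2 : η (a + τ - a) = B (a + τ) := by rw [add_sub_cancel_left, hητ, hBa]
  have hc2 := (hη.comp_sub a).glue hB hg2
  have hg1 : A a = if a ≤ a + τ then η (a - a) else B a := by
    rw [if_pos (by linarith), sub_self, hη0, hAa]
  have hc1 := hA.glue hc2 hg1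
  refine ⟨_, hc1, fun t ht => if_pos ht, fun t ht => ?_, fun p hpA hpη hpB => ?_⟩
  · rw [glue_apply_right (γ' := fun t => if t ≤ a + τ then η (t - a) else B t) (by linarith) hg1]
    exact glue_apply_right (γ := fun t => η (t - a)) ht hg2
  · have hne : ∀ t, (if t ≤ a then A t else if t ≤ a + τ then η (t - a) else B t) ≠ p := by
      intro t
      split_ifs with h1 h2
      · exact hpA t h1
      · exact hpη _ ⟨by linarith, by linarith⟩
      · exact hpB t (by linarith)
    refine ⟨by rintro ⟨t, ht⟩; exact hne t ht, fun F hFA hFB R hR hR' => ?_⟩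
    rw [hc1.integral_div_add hR (by linarith) fun t _ => hne t,
      hc1.integral_div_add (x := a) (y := a + τ) (by linarith) hR' fun t _ => hne t,
      integral_div_glue_left p hR le_rfl,
      integral_div_glue_right (γ' := fun t => if t ≤ a + τ then η (t - a) else B t) p le_rfl
        (by linarith),
      integral_div_glue_right (γ' := fun t => if t ≤ a + τ then η (t - a) else B t) p (by linarith)
        (by linarith),
      integral_div_glue_left (γ := fun t => η (t - a)) p (by linarith) le_rfl,
      integral_div_glue_right (γ := fun t => η (t - a)) p le_rfl hR', integral_div_comp_sub,
      sub_self, add_sub_cancel_left,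
      hA.integral_div_eq_sub hR (fun t ht => hpA t ht.2) fun t ht => hFA t ht.2,
      hB.integral_div_eq_sub hR' (fun t ht => hpB t ht.1) fun t ht => hFB t ht.1, hAa, hBa]
    ring

/-- Each condition holds for all sufficiently small h > 0: the poles have finitely many imaginary
parts, and only finitely many poles are close to a given right pole. -/
lemma exists_pos_avoiding {L : ℕ} (α : Fin L → ℂ) (k : ℤ) (N : ℕ) :
    ∃ h : ℝ, 0 < h ∧ (∀ p ∈ gammaLeftPoles α ∪ gammaRightPoles k, p.im ≠ h) ∧
      ∀ p ∈ gammaLeftPoles α ∪ gammaRightPoles k, ∀ j < N,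
        p = 1 - k + j ∨ h < ‖p - (1 - k + j)‖ := by
  have h1 : ∀ y : ℝ, ∀ᶠ h in 𝓝[>] (0 : ℝ), y ≠ h := fun y => by
    rcases le_or_gt y 0 with hy | hy
    · filter_upwards [self_mem_nhdsWithin] with h hh
      exact (hy.trans_lt hh).ne
    · filter_upwards [mem_nhdsWithin_of_mem_nhds (Iio_mem_nhds hy)] with h hh
      exact (ne_of_lt hh).symm
  have h2 : ∀ᶠ h in 𝓝[>] (0 : ℝ), ∀ p ∈ gammaLeftPoles α ∪ gammaRightPoles k, p.im ≠ h := by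
    filter_upwards [eventually_all.2 fun l => h1 (-(α l).im), h1 0] with h hα h0
    rintro _ (⟨l, i, rfl⟩ | ⟨i, rfl⟩)
    · simpa using hα l
    · simpa using h0
  have h3 : ∀ j : ℕ, ∀ᶠ h in 𝓝[>] (0 : ℝ), ∀ p ∈ gammaLeftPoles α ∪ gammaRightPoles k,
      p = 1 - k + j ∨ h < ‖p - (1 - k + j)‖ := fun j => by
    have h4 : ∀ᶠ h in 𝓝[>] (0 : ℝ), ∀ p ∈ (gammaLeftPoles α ∪ gammaRightPoles k) ∩
        {s | (1 - k + j : ℂ).re - 1 < s.re ∧ s.re < (1 - k + j : ℂ).re + 1},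
        p = 1 - k + j ∨ h < ‖p - (1 - k + j)‖ :=
      (eventually_all_finite (finite_poles α k _ _)).2 fun p _ => by
        rcases eq_or_ne p (1 - k + j) with hp | hp
        · exact .of_forall fun _ => Or.inl hp
        · filter_upwards [mem_nhdsWithin_of_mem_nhds
            (Iio_mem_nhds (norm_pos_iff.2 (sub_ne_zero.2 hp)))] with h hh
          exact Or.inr hh
    -- Poles at horizontal distance at least 1 satisfy the condition as soon as h < 1.
    filter_upwards [h4, mem_nhdsWithin_of_mem_nhds (Iio_mem_nhds one_pos)] with h hh h5 p hp
    by_cases hs : (1 - k + j : ℂ).re - 1 < p.re ∧ p.re < (1 - k + j : ℂ).re + 1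
    · exact hh p ⟨hp, hs⟩
    · right
      refine (lt_of_lt_of_le h5 ?_).trans_le (abs_re_le_norm _)
      rw [sub_re]
      by_contra! h6
      exact hs ⟨by linarith [(abs_lt.1 h6).1], by linarith [(abs_lt.1 h6).2]⟩
  have h6 : ∀ᶠ h in 𝓝[>] (0 : ℝ), h ∈ Set.Ioi 0 := self_mem_nhdsWithin
  obtain ⟨h, hh, h4, h5⟩ := (h6.and (h2.and
    ((eventually_all_finite (Set.finite_Iio N)).2 fun j _ => h3 j))).exists
  exact ⟨h, hh, h4, fun p hp j hj => h5 j hj p hp⟩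

/-- A vertical line to the right of the left poles, and a closed curve that starts on it and
encircles the right poles that are to the left of the line. -/
lemma exists_line_and_closed_curve {L : ℕ} (α : Fin L → ℂ) (k : ℤ)
    (hdisj : ∀ j : ℕ, (1 - k + j : ℂ) ∉ gammaLeftPoles α) :
    ∃ (x h τ : ℝ) (η : ℝ → ℂ), 0 < h ∧ 0 ≤ τ ∧ IsPiecewiseC1 η ∧ η 0 = x + h * I ∧
      η τ = x + h * I ∧
      (∀ p ∈ gammaLeftPoles α, p.re < x ∧ (∀ t ∈ Set.Icc 0 τ, η t ≠ p) ∧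
        ∫ t in (0 : ℝ)..τ, deriv η t / (η t - p) = 0) ∧
      ∀ q ∈ gammaRightPoles k, q.im = 0 ∧ (∀ t ∈ Set.Icc 0 τ, η t ≠ q) ∧
        ((q.re < x ∧ ∫ t in (0 : ℝ)..τ, deriv η t / (η t - q) = -(2 * Real.pi * I)) ∨
          (x < q.re ∧ ∫ t in (0 : ℝ)..τ, deriv η t / (η t - q) = 0)) := by
  obtain ⟨A, hA⟩ := exists_forall_re_lt α
  -- The line Re s = N - k + 1/2 passes to the right of all left poles; exactly the first N right
  -- poles are on its wrong side.
  obtain ⟨N, hN⟩ := exists_nat_gt (A + k)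
  obtain ⟨h, hh, h1, h2⟩ := exists_pos_avoiding α k N
  have hinj : Function.Injective (fun j : ℕ => (1 - k + j : ℂ)) := fun i j h => by simpa using h
  obtain ⟨η, τ, hτ, hη, h3, h4, h5⟩ := exists_closed_curve (b := ((N - k + 1 / 2 : ℝ) : ℂ) + h * I)
    (q := fun j : ℕ => (1 - k + j : ℂ)) hh (by simp) (fun j => by simp) hinj h1 N h2
  refine ⟨N - k + 1 / 2, h, τ, η, hh, hτ, hη, h3, h4, fun p hp => ?_, ?_⟩
  · obtain ⟨h6, -, h7⟩ := h5 p (Or.inl hp)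
    refine ⟨by linarith [hA p hp], h6, h7 ?_⟩
    rintro ⟨j, -, rfl⟩
    exact hdisj j hp
  · rintro _ ⟨j, rfl⟩
    obtain ⟨h6, h7, h8⟩ := h5 (1 - k + j) (Or.inr ⟨j, rfl⟩)
    refine ⟨by simp, h6, ?_⟩
    simp only [add_re, sub_re, one_re, intCast_re, natCast_re]
    rcases lt_or_ge j N with hj | hj
    · have : (j : ℝ) + 1 ≤ N := by exact_mod_cast hj
      exact Or.inl ⟨by linarith, h7 ⟨j, hj, rfl⟩⟩
    · have : (N : ℝ) ≤ j := by exact_mod_cast hj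
      refine Or.inr ⟨by linarith, h8 ?_⟩
      rintro ⟨i, hi, hij⟩
      have := hinj hij
      omega

lemma hasDerivAt_log_const_sub {p s : ℂ} (hs : p - s ∈ slitPlane) :
    HasDerivAt (fun s => log (p - s)) (1 / (s - p)) s := by
  refine (((hasDerivAt_id s).const_sub p).clog hs).congr_deriv ?_
  simp only [id]
  rw [← neg_sub s p, neg_div, div_neg, neg_neg]

lemma hasContourIndex_of_tendsto {γ : ℝ → ℂ} {p ν : ℂ} (hp : p ∉ Set.range γ)
    (h : Tendsto (fun R : ℝ => ∫ t in (-R)..R, deriv γ t / (γ t - p)) atTop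
      (𝓝 (2 * Real.pi * I * ν))) : HasContourIndex γ p ν := by
  refine ⟨hp, ?_⟩
  have := h.const_mul (2 * (Real.pi : ℂ) * I)⁻¹
  rwa [← mul_assoc, inv_mul_cancel₀ Complex.two_pi_I_ne_zero, one_mul] at this

/-- The line has index 1/2 about the points on its left. The closed curve inserted at x + ih adds -1
at the right poles on the left of the line, which makes their index -1/2 too. -/
theorem exists_isVerticalContour {L : ℕ} (α : Fin L → ℂ) (k : ℤ)
    (hdisj : ∀ j : ℕ, (1 - k + j : ℂ) ∉ gammaLeftPoles α) :
    ∃ γ, IsVerticalContour (gammaLeftPoles α) (gammaRightPoles k) γ := by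
  obtain ⟨x, h, τ, η, hh, hτ, hη, hη0, hητ, hP, hQ⟩ := exists_line_and_closed_curve α k hdisj
  -- The detour takes the parameter time τ. The line is then followed at double speed for time τ, so
  -- that from h + 2τ on the point at parameter t is again x + ti.
  set B : ℝ → ℂ := fun t => if t ≤ h + 2 * τ then
    (fun t : ℝ => (x - (h + 2 * τ : ℝ) * I : ℂ) + t * (2 * I)) t else
      (fun t : ℝ => (x + t * I : ℂ)) t with hBdef
  have hBg : (x - (h + 2 * τ : ℝ) * I : ℂ) + (h + 2 * τ : ℝ) * (2 * I) =
      x + (h + 2 * τ : ℝ) * I := by ring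
  have hB : IsPiecewiseC1 B := (isPiecewiseC1_affine _ _).glue (isPiecewiseC1_affine _ _) hBg
  have hBre : ∀ t, (B t).re = x := fun t => by
    simp only [hBdef]
    split_ifs <;> simp
  have hB' : ∀ t, h + 2 * τ ≤ t → B t = x + t * I := fun t ht =>
    glue_apply_right (γ := fun t : ℝ => (x - (h + 2 * τ : ℝ) * I : ℂ) + t * (2 * I))
      (γ' := fun t : ℝ => (x + t * I : ℂ)) ht hBg
  have hBb : B (h + τ) = x + h * I := by
    simp only [hBdef]
    rw [if_pos (by linarith)]
    push_cast
    ring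
  obtain ⟨γ, hγ, hγA, hγB, hγp⟩ := exists_insert (A := fun t : ℝ => (x + t * I : ℂ)) (a := h) hτ
    (isPiecewiseC1_affine _ _) hB hη rfl hη0 hητ hBb
  have hleft : ∀ p : ℂ, p.re < x → (∀ t ∈ Set.Icc 0 τ, η t ≠ p) → p ∉ Set.range γ ∧
      Tendsto (fun R : ℝ => ∫ t in (-R)..R, deriv γ t / (γ t - p)) atTop
        (𝓝 (Real.pi * I + ∫ t in (0 : ℝ)..τ, deriv η t / (η t - p))) := by
    intro p hp hpη
    obtain ⟨h1, h2⟩ := hγp p (fun t _ h0 => by simp [← h0] at hp) hpη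
      (fun t _ h0 => hp.ne (h0 ▸ hBre t))
    refine ⟨h1, ((tendsto_log_add_sub_log (x - p) (x - p)).add_const _).congr' ?_⟩
    filter_upwards [eventually_ge_atTop (h + 2 * τ), eventually_ge_atTop (-h)] with R hR hR'
    rw [h2 (fun s => log (s - p)) (fun t _ => hasDerivAt_log_sub (by simpa using hp))
      (fun t _ => hasDerivAt_log_sub (by simpa [hBre] using hp)) R (by linarith) (by linarith),
      hB' R hR]
    push_cast
    ring_nf
  have hright : ∀ p : ℂ, x < p.re → (∀ t ∈ Set.Icc 0 τ, η t ≠ p) → p ∉ Set.range γ ∧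
      Tendsto (fun R : ℝ => ∫ t in (-R)..R, deriv γ t / (γ t - p)) atTop
        (𝓝 (-(Real.pi * I) + ∫ t in (0 : ℝ)..τ, deriv η t / (η t - p))) := by
    intro p hp hpη
    obtain ⟨h1, h2⟩ := hγp p (fun t _ h0 => by simp [← h0] at hp) hpη
      (fun t _ h0 => hp.ne' (h0 ▸ hBre t))
    refine ⟨h1, ((tendsto_log_add_sub_log (p - x) (p - x)).neg.add_const _).congr' ?_⟩
    filter_upwards [eventually_ge_atTop (h + 2 * τ), eventually_ge_atTop (-h)] with R hR hR'
    rw [h2 (fun s => log (p - s)) (fun t _ => hasDerivAt_log_const_sub (Or.inl (by simpa using hp)))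
      (fun t _ => hasDerivAt_log_const_sub (Or.inl (by simpa [hBre] using hp))) R (by linarith)
      (by linarith), hB' R hR]
    push_cast
    ring_nf
  refine ⟨γ, hγ, ⟨x, x, |h| + 2 * τ, fun t ht => ?_, fun t ht => hγA t ?_⟩, fun p hp => ?_,
    fun q hq => ?_⟩
  · rw [hγB t (by linarith [le_abs_self h]), hB' t (by linarith [le_abs_self h])]
  · linarith [abs_nonneg h]
  · obtain ⟨h1, h2, h3⟩ := hP p hp
    obtain ⟨h4, h5⟩ := hleft p h1 h2
    refine hasContourIndex_of_tendsto h4 ?_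
    convert h5 using 2
    rw [h3]
    ring
  · obtain ⟨-, h2, ⟨h1, h3⟩ | ⟨h1, h3⟩⟩ := hQ q hq
    · obtain ⟨h4, h5⟩ := hleft q h1 h2
      refine hasContourIndex_of_tendsto h4 ?_
      convert h5 using 2
      rw [h3]
      ring
    · obtain ⟨h4, h5⟩ := hright q h1 h2
      refine hasContourIndex_of_tendsto h4 ?_
      convert h5 using 2
      rw [h3]
      ring

lemma log_neg_of_im_pos {s : ℂ} (hs : 0 < s.im) : log (-s) = log s - Real.pi * I := by
  simp only [log, norm_neg, arg_neg_eq_arg_sub_pi_of_im_pos hs]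
  push_cast
  ring

lemma log_neg_of_im_neg {s : ℂ} (hs : s.im < 0) : log (-s) = log s + Real.pi * I := by
  simp only [log, norm_neg, arg_neg_eq_arg_add_pi_of_im_neg hs]
  push_cast
  ring

/-- The loop comes in along Im s = -h, goes up the line Re s = x, follows the closed curve at x +
ih, and leaves along Im s = h. It has index 0 about points left of x and -1 about real points right
of x; the closed curve adds -1 at the right poles left of x. -/
theorem exists_isLoopContour {L : ℕ} (α : Fin L → ℂ) (k : ℤ)
    (hdisj : ∀ j : ℕ, (1 - k + j : ℂ) ∉ gammaLeftPoles α) :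
    ∃ γ, IsLoopContour (gammaLeftPoles α) (gammaRightPoles k) γ := by
  obtain ⟨x, h, τ, η, hh, hτ, hη, hη0, hητ, hP, hQ⟩ := exists_line_and_closed_curve α k hdisj
  set A : ℝ → ℂ := fun t => if t ≤ -x then
    (fun t : ℝ => ((-h : ℝ) * I : ℂ) + t * (-1)) t else
      (fun t : ℝ => (x + (x - h : ℝ) * I : ℂ) + t * I) t with hAdef
  have hAg : ((-h : ℝ) * I : ℂ) + (-x : ℝ) * (-1) = (x + (x - h : ℝ) * I : ℂ) + (-x : ℝ) * I := by
    push_cast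
    ring
  have hA : IsPiecewiseC1 A := (isPiecewiseC1_affine _ _).glue (isPiecewiseC1_affine _ _) hAg
  -- The parameter of x + ih: the corner x - ih is passed at -x, and the line is followed at unit
  -- speed.
  set a : ℝ := -x + 2 * h with ha
  have hA' : ∀ t, t ≤ -x → A t = -t + (-h : ℝ) * I := fun t ht => by
    simp only [hAdef]
    rw [if_pos ht]
    ring
  have hAa : A a = x + h * I := by
    simp only [hAdef]
    rw [if_neg (by linarith), ha]
    push_cast
    ring
  have hAre : ∀ t, x ≤ (A t).re := fun t => by
    simp only [hAdef]
    split_ifs with ht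
    · simp
      linarith
    · simp
  have hAim : ∀ t, x < (A t).re → (A t).im ≠ 0 := fun t => by
    simp only [hAdef]
    split_ifs with ht
    · simp [hh.ne']
    · simp
  set T : ℝ := max (a + τ) x + 1 with hT
  have hT1 : a + τ < T := by linarith [le_max_left (a + τ) x]
  have hT2 : x < T := by linarith [le_max_right (a + τ) x]
  -- The speed on [a + τ, T] with which the curve reaches T + ih at the parameter T, as required for
  -- the end t + ih of the loop.
  set σ : ℝ := (T - x) / (T - (a + τ)) with hσ
  have hσ0 : 0 ≤ σ := div_nonneg (by linarith) (by linarith)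
  have hσT : σ * (T - (a + τ)) = T - x := div_mul_cancel₀ _ (by linarith)
  set B : ℝ → ℂ := fun t => if t ≤ T then
    (fun t : ℝ => (x - σ * (a + τ : ℝ) + h * I : ℂ) + t * σ) t else
      (fun t : ℝ => (h * I : ℂ) + t * 1) t with hBdef
  have hBg : (x - σ * (a + τ : ℝ) + h * I : ℂ) + T * σ = (h * I : ℂ) + T * 1 := by
    have : (σ * (T - (a + τ : ℝ)) : ℂ) = T - x := by exact_mod_cast hσT
    linear_combination this
  have hB : IsPiecewiseC1 B := (isPiecewiseC1_affine _ _).glue (isPiecewiseC1_affine _ _) hBg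
  have hB' : ∀ t, T ≤ t → B t = t + h * I := fun t ht => by
    rw [hBdef]
    refine (glue_apply_right (γ := fun t : ℝ => (x - σ * (a + τ : ℝ) + h * I : ℂ) + t * σ)
      (γ' := fun t : ℝ => (h * I : ℂ) + t * 1) ht hBg).trans ?_
    ring
  have hBb : B (a + τ) = x + h * I := by
    simp only [hBdef]
    rw [if_pos hT1.le]
    push_cast
    ring
  have hBre : ∀ t, a + τ ≤ t → x ≤ (B t).re := fun t ht => by
    simp only [hBdef]
    split_ifs with htT
    · have := mul_le_mul_of_nonneg_left ht hσ0
      simp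
      linarith
    · simp
      linarith
  have hBim : ∀ t, (B t).im = h := fun t => by
    simp only [hBdef]
    split_ifs with htT <;> simp
  obtain ⟨γ, hγ, hγA, hγB, hγp⟩ := exists_insert (a := a) hτ hA hB hη hAa hη0 hητ hBb
  have hleft : ∀ p : ℂ, p.re < x → (∀ t ∈ Set.Icc 0 τ, η t ≠ p) → p ∉ Set.range γ ∧
      Tendsto (fun R : ℝ => ∫ t in (-R)..R, deriv γ t / (γ t - p)) atTop
        (𝓝 (0 + ∫ t in (0 : ℝ)..τ, deriv η t / (η t - p))) := by
    intro p hp hpη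
    obtain ⟨h1, h2⟩ := hγp p (fun t _ h0 => (hp.trans_le (hAre t)).ne' (by rw [h0])) hpη
      (fun t ht h0 => (hp.trans_le (hBre t ht)).ne' (by rw [h0]))
    refine ⟨h1, ((tendsto_log_sub_log p h (-h)).add_const _).congr' ?_⟩
    filter_upwards [eventually_ge_atTop T, eventually_ge_atTop x, eventually_ge_atTop (-a)]
      with R hR hR' hR''
    rw [h2 (fun s => log (s - p)) (fun t _ => hasDerivAt_log_sub (hp.trans_le (hAre t)))
      (fun t ht => hasDerivAt_log_sub (hp.trans_le (hBre t ht))) R (by linarith) (by linarith),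
      hB' R hR, hA' (-R) (by linarith)]
    push_cast
    ring_nf
  have hright : ∀ p : ℂ, x < p.re → p.im = 0 → (∀ t ∈ Set.Icc 0 τ, η t ≠ p) →
      p ∉ Set.range γ ∧ Tendsto (fun R : ℝ => ∫ t in (-R)..R, deriv γ t / (γ t - p)) atTop
        (𝓝 (0 - 2 * Real.pi * I + ∫ t in (0 : ℝ)..τ, deriv η t / (η t - p))) := by
    intro p hp hpi hpη
    -- The curve A meets the real axis only on Re s = x < Re p, so log(p-s) is a primitive along all
    -- of it.
    have hAs : ∀ t, p - A t ∈ slitPlane := fun t => by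
      rcases (hAre t).eq_or_lt with h0 | h0
      · exact Or.inl (by rw [sub_re, ← h0]; linarith)
      · exact Or.inr (by rw [sub_im, hpi, zero_sub, neg_ne_zero]; exact hAim t h0)
    have hBs : ∀ t, p - B t ∈ slitPlane := fun t =>
      Or.inr (by rw [sub_im, hpi, hBim, zero_sub, neg_ne_zero]; exact hh.ne')
    obtain ⟨h1, h2⟩ := hγp p (fun t _ h0 => slitPlane_ne_zero (hAs t) (by rw [h0, sub_self])) hpη
      (fun t _ h0 => slitPlane_ne_zero (hBs t) (by rw [h0, sub_self]))
    refine ⟨h1, (((tendsto_log_sub_log p h (-h)).sub_const _).add_const _).congr' ?_⟩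
    filter_upwards [eventually_ge_atTop T, eventually_ge_atTop x, eventually_ge_atTop (-a)]
      with R hR hR' hR''
    rw [h2 (fun s => log (p - s)) (fun t _ => hasDerivAt_log_const_sub (hAs t))
      (fun t _ => hasDerivAt_log_const_sub (hBs t)) R (by linarith) (by linarith),
      hB' R hR, hA' (-R) (by linarith)]
    -- Passing from log(p-s) to log(s-p) costs -πi above the real axis and πi below it; the
    -- difference is the -2πi of the index -1.
    have e1 : log (p - (R + h * I)) = log (R + h * I - p) - Real.pi * I := by
      rw [← neg_sub, log_neg_of_im_pos (by simp [hpi, hh])]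
    have e2 : log (p - (-((-R : ℝ) : ℂ) + (-h : ℝ) * I)) =
        log (R + (-h : ℝ) * I - p) + Real.pi * I := by
      rw [← neg_sub, log_neg_of_im_neg (by simp [hpi, hh])]
      push_cast
      rw [neg_neg]
    rw [e1, e2]
    ring
  refine ⟨γ, hγ, ⟨h, -h, max T (max x (-a)), fun t ht => ?_, fun t ht => ?_⟩, fun p hp => ?_,
    fun q hq => ?_⟩
  · have := (le_max_left _ _).trans ht
    rw [hγB t (by linarith), hB' t this]
  · have h1 := (le_max_right T (max x (-a)))
    have h2 := le_max_left x (-a)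
    have h3 := le_max_right x (-a)
    rw [hγA t (by linarith), hA' t (by linarith)]
  · obtain ⟨h1, h2, h3⟩ := hP p hp
    obtain ⟨h4, h5⟩ := hleft p h1 h2
    refine hasContourIndex_of_tendsto h4 ?_
    convert h5 using 2
    rw [h3]
    ring
  · obtain ⟨hq0, h2, ⟨h1, h3⟩ | ⟨h1, h3⟩⟩ := hQ q hq
    · obtain ⟨h4, h5⟩ := hleft q h1 h2
      refine hasContourIndex_of_tendsto h4 ?_
      convert h5 using 2
      rw [h3]
      ring
    · obtain ⟨h4, h5⟩ := hright q h1 hq0 h2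
      refine hasContourIndex_of_tendsto h4 ?_
      convert h5 using 2
      rw [h3]
      ring

/-! ### The integral along a vertical line as a function of the argument -/

section VerticalLine

variable {L M : ℕ} {α : Fin L → ℂ} {k : ℤ} {X : ℝ}

lemma barnes_eq_mul_exp (α : Fin L → ℂ) (δ : Fin M → ℂ) (k : ℤ) (w s : ℂ) :
    barnes α δ k w s = barnes α δ k 0 s * exp (s * w) := by
  simp only [barnes, mul_zero, exp_zero, mul_one]
  ring

lemma contourIntegral_barnes_verticalLine (α : Fin L → ℂ) (δ : Fin M → ℂ) (k : ℤ) (w : ℂ) (X : ℝ) :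
    contourIntegral (barnes α δ k w) (fun t : ℝ => X + t * I) =
      (2 * (Real.pi : ℂ) * I)⁻¹ *
        ((∫ t : ℝ, barnes α δ k 0 (X + t * I) * exp ((X + t * I) * w)) * I) := by
  rw [contourIntegral, ← integral_mul_const]
  simp_rw [deriv_verticalLine, ← barnes_eq_mul_exp]

lemma continuous_barnes_verticalLine (δ : Fin M → ℂ) (w : ℂ)
    (hX : ∀ t : ℝ, (X + t * I : ℂ) ∉ gammaLeftPoles α ∧ (X + t * I : ℂ) ∉ gammaRightPoles k) :
    Continuous (fun t : ℝ => barnes α δ k w (X + t * I)) :=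
  continuous_iff_continuousAt.2 fun t =>
    (differentiableAt_barnes w (hX t).1 (hX t).2).continuousAt.comp
      (f := fun t : ℝ => (X + t * I : ℂ)) (by fun_prop)

/-- A bound on a vertical line that is uniform for `w` in a horizontal strip. -/
lemma exists_norm_barnes_verticalLine_le (δ : Fin M → ℂ)
    (hX : ∀ t : ℝ, (X + t * I : ℂ) ∉ gammaLeftPoles α ∧ (X + t * I : ℂ) ∉ gammaRightPoles k)
    {θ : ℝ} (hθ : θ < ((L : ℝ) - M + 1) * Real.pi / 2) :
    ∃ C ε : ℝ, 0 ≤ C ∧ 0 < ε ∧ ∀ (t : ℝ) (w : ℂ), |w.im| ≤ θ →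
      ‖barnes α δ k w (X + t * I)‖ ≤ C * Real.exp (-(ε * |t|)) * Real.exp (X * w.re) := by
  obtain ⟨η, hη₁, hη₂⟩ := exists_between hθ
  obtain ⟨C, T, hC, h⟩ := exists_norm_barnes_le α δ k |X| hη₂
  -- The weight e^{η|t|} puts the compact part |t| ≤ T under the same exponential bound as the ends.
  obtain ⟨C', hC'⟩ := (isCompact_Icc (a := -T) (b := T)).exists_bound_of_continuousOn
    (f := fun t : ℝ => barnes α δ k 0 (X + t * I) * Real.exp (η * |t|))
    ((continuous_barnes_verticalLine δ 0 hX).mul (by fun_prop)).continuousOn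
  have key : ∀ t : ℝ, ‖barnes α δ k 0 (X + t * I)‖ ≤ max C C' * Real.exp (-(η * |t|)) := fun t => by
    rcases le_total T |t| with ht | ht
    · have := h (X + t * I) 0 (by simp) (by simpa using ht)
      simp only [mul_zero, zero_re, Real.exp_zero, mul_one, add_im, ofReal_im, mul_im, ofReal_re,
        I_im, I_re, add_zero, zero_add] at this
      exact this.trans (by gcongr; exact le_max_left _ _)
    · have h1 := hC' t (abs_le.1 ht)
      rw [norm_mul, norm_real, Real.norm_of_nonneg (Real.exp_pos _).le] at h1
      rw [Real.exp_neg, ← div_eq_mul_inv, le_div_iff₀ (Real.exp_pos _)]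
      exact h1.trans (le_max_right _ _)
  refine ⟨max C C', η - θ, hC.trans (le_max_left _ _), by linarith, fun t w hw => ?_⟩
  rw [barnes_eq_mul_exp, norm_mul, norm_exp]
  have h2 : ((X + t * I : ℂ) * w).re ≤ X * w.re + θ * |t| := by
    have h3 : -(t * w.im) ≤ |t| * |w.im| := (neg_le_abs _).trans (abs_mul _ _).le
    have h4 := mul_le_mul_of_nonneg_left hw (abs_nonneg t)
    simp only [mul_re, add_re, ofReal_re, ofReal_im, I_re, I_im, add_im, mul_im]
    linarith
  refine (mul_le_mul (key t) (Real.exp_le_exp.2 h2) (Real.exp_pos _).le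
    (by have := hC.trans (le_max_left C C'); positivity)).trans (le_of_eq ?_)
  rw [mul_assoc, mul_assoc, ← Real.exp_add, ← Real.exp_add]
  congr 2
  ring

/-- The remainder estimate: e^{X Re w} = |e^w|^X is a power of |κx|, and K is uniform in a closed
subsector. -/
lemma exists_norm_contourIntegral_verticalLine_le (δ : Fin M → ℂ)
    (hX : ∀ t : ℝ, (X + t * I : ℂ) ∉ gammaLeftPoles α ∧ (X + t * I : ℂ) ∉ gammaRightPoles k)
    {θ : ℝ} (hθ : θ < ((L : ℝ) - M + 1) * Real.pi / 2) :
    ∃ K : ℝ, 0 ≤ K ∧ ∀ w : ℂ, |w.im| ≤ θ →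
      ‖contourIntegral (barnes α δ k w) (fun t : ℝ => X + t * I)‖ ≤ K * Real.exp (X * w.re) := by
  obtain ⟨C, ε, hC, hε, h⟩ := exists_norm_barnes_verticalLine_le δ hX hθ
  refine ⟨‖(2 * (Real.pi : ℂ) * I)⁻¹‖ * ∫ t : ℝ, C * Real.exp (-(ε * |t|)), by positivity,
    fun w hw => ?_⟩
  rw [contourIntegral, norm_mul, mul_assoc ‖(2 * (Real.pi : ℂ) * I)⁻¹‖, ← integral_mul_const]
  refine mul_le_mul_of_nonneg_left (norm_integral_le_of_norm_le
    (((integrable_exp_neg_mul_abs hε).const_mul C).mul_const _) (.of_forall fun t => ?_))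
    (norm_nonneg _)
  rw [deriv_verticalLine, norm_mul, norm_I, mul_one]
  exact h t w hw

/-- Differentiation under the integral produces the factor X + ti, which half of the exponential
decay absorbs. -/
lemma differentiableAt_contourIntegral_verticalLine (δ : Fin M → ℂ)
    (hX : ∀ t : ℝ, (X + t * I : ℂ) ∉ gammaLeftPoles α ∧ (X + t * I : ℂ) ∉ gammaRightPoles k)
    {w₀ : ℂ} (hw : |w₀.im| < ((L : ℝ) - M + 1) * Real.pi / 2) :
    DifferentiableAt ℂ (fun w => contourIntegral (barnes α δ k w) (fun t : ℝ => X + t * I)) w₀ := by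
  obtain ⟨θ, hθ₁, hθ₂⟩ := exists_between hw
  obtain ⟨C, ε, hC, hε, h⟩ := exists_norm_barnes_verticalLine_le δ hX hθ₂
  simp_rw [contourIntegral_barnes_verticalLine]
  refine DifferentiableAt.const_mul (DifferentiableAt.mul_const ?_ _) _
  set S : Set ℂ := {w | |w.im| < θ} ∩ {w | X * w.re < X * w₀.re + 1} with hS
  have hSo : IsOpen S := (isOpen_lt (by fun_prop) (by fun_prop)).inter
    (isOpen_lt (by fun_prop) (by fun_prop))
  have hφ := continuous_barnes_verticalLine δ 0 hX
  refine differentiableAt_integral_mul_exp hφ.aestronglyMeasurable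
    (Continuous.aestronglyMeasurable (by fun_prop)) (S := S)
    (bound := fun t => C * (|X| + 2 / ε) * Real.exp (X * w₀.re + 1) * Real.exp (-(ε / 2 * |t|)))
    (hSo.mem_nhds ⟨hθ₁, show X * w₀.re < X * w₀.re + 1 from lt_add_one _⟩) (.of_forall fun t w hwS => ?_)
    ((integrable_exp_neg_mul_abs (by positivity)).const_mul _) ?_
  · have h1 := h t w hwS.1.le
    rw [barnes_eq_mul_exp, norm_mul, norm_exp] at h1
    have h2 : ‖(X + t * I : ℂ)‖ ≤ (|X| + 2 / ε) * Real.exp (ε / 2 * |t|) := by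
      have h3 := Real.add_one_le_exp (ε / 2 * |t|)
      have h4 : |t| ≤ 2 / ε * Real.exp (ε / 2 * |t|) := by
        calc |t| = 2 / ε * (ε / 2 * |t|) := by field_simp
          _ ≤ _ := by gcongr; linarith
      have h5 : |X| ≤ |X| * Real.exp (ε / 2 * |t|) :=
        le_mul_of_one_le_right (abs_nonneg _) (Real.one_le_exp (by positivity))
      refine (norm_add_le _ _).trans ?_
      rw [norm_mul, norm_I, mul_one, norm_real, norm_real, Real.norm_eq_abs, Real.norm_eq_abs]
      linarith
    have h6 : Real.exp (-(ε * |t|)) =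
        Real.exp (-(ε / 2 * |t|)) * (Real.exp (ε / 2 * |t|))⁻¹ := by
      rw [← Real.exp_neg, ← Real.exp_add]
      congr 1
      ring
    calc _ = ‖barnes α δ k 0 (X + t * I)‖ * Real.exp ((X + t * I : ℂ) * w).re *
          ‖(X + t * I : ℂ)‖ := by
          ring
      _ ≤ C * Real.exp (-(ε * |t|)) * Real.exp (X * w₀.re + 1) *
          ((|X| + 2 / ε) * Real.exp (ε / 2 * |t|)) := by
        refine mul_le_mul (h1.trans ?_) h2 (norm_nonneg _) (by positivity)
        exact mul_le_mul_of_nonneg_left (Real.exp_le_exp.2 hwS.2.le) (by positivity)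
      _ = _ := by
        rw [h6]
        field_simp
  · simp_rw [← barnes_eq_mul_exp]
    refine ((integrable_exp_neg_mul_abs hε).const_mul C |>.mul_const (Real.exp (X * w₀.re))).mono'
      (continuous_barnes_verticalLine δ w₀ hX).aestronglyMeasurable (.of_forall fun t => ?_)
    exact h t w₀ hθ₁.le

end VerticalLine

/-! ### The Meijer function -/

section Meijer

variable {L M : ℕ} {c : Fin L → ℂ} {d : Fin M → ℂ} {β : ℂ} {k : ℤ}

lemma meijerIntegrand_eq (c : Fin L → ℂ) (d : Fin M → ℂ) (β : ℂ) (k : ℤ) (w : ℂ) :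
    meijerIntegrand 1 L (upperParam c β) (lowerParam d β k) w = barnesIntegrand c d β k w := by
  funext s
  have h1 : ∀ m, 1 - (1 + 1 / (β * d m)) + s = s - 1 / (β * d m) := fun m => by ring
  have h2 : ∀ l, 1 - (1 - 1 / (β * c l)) + s = s + 1 / (β * c l) := fun l => by ring
  simp only [meijerIntegrand, barnesIntegrand, lowerParam, upperParam, Fin.prod_univ_succ,
    Fin.cons_zero, Fin.cons_succ, Fin.val_zero, zero_lt_one, if_true, Fin.is_lt, Fin.val_succ,
    h1, h2]
  simp only [Nat.lt_one_iff, Nat.add_eq_zero_iff, one_ne_zero, and_false, if_false,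
    Finset.prod_inv_distrib]
  ring

lemma meijerLeftPoles_eq (c : Fin L → ℂ) (β : ℂ) :
    meijerLeftPoles L (upperParam c β) = gammaLeftPoles (fun l => 1 / (β * c l)) := by
  have h : ∀ (l : Fin L) (i : ℕ), upperParam c β l - 1 - i = -(1 / (β * c l)) - i := fun l i => by
    rw [upperParam]
    ring
  simp only [meijerLeftPoles, gammaLeftPoles, h, Fin.is_lt, true_and]

lemma meijerRightPoles_eq (d : Fin M → ℂ) (β : ℂ) (k : ℤ) :
    meijerRightPoles 1 (lowerParam d β k) = gammaRightPoles k := by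
  ext s
  simp only [meijerRightPoles, gammaRightPoles, Nat.lt_one_iff, Set.mem_ofPred_eq]
  constructor
  · rintro ⟨j, hj, i, rfl⟩
    obtain rfl : j = 0 := Fin.ext hj
    exact ⟨i, by rw [lowerParam, Fin.cons_zero]⟩
  · rintro ⟨i, rfl⟩
    exact ⟨0, rfl, i, by rw [lowerParam, Fin.cons_zero]⟩

/-- With m = 1, n = p = L and q = M + 1 the general angle (m + n - (p+q)/2)π becomes (L-M+1)π/2, and
q ≥ 1 is automatic. -/
lemma isMeijerContour_iff {w : ℂ} {γ : ℝ → ℂ} :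
    IsMeijerContour 1 L (upperParam c β) (lowerParam d β k) w γ ↔
      (|w.im| < ((L : ℝ) - M + 1) * Real.pi / 2 ∧ IsVerticalContour
        (gammaLeftPoles fun l => 1 / (β * c l)) (gammaRightPoles k) γ) ∨
      ((L ≤ M ∨ (L = M + 1 ∧ w.re < 0)) ∧ IsLoopContour
        (gammaLeftPoles fun l => 1 / (β * c l)) (gammaRightPoles k) γ) := by
  have h : (((1 : ℕ) : ℝ) + L - ((L : ℝ) + (M + 1 : ℕ)) / 2) * Real.pi =
      ((L : ℝ) - M + 1) * Real.pi / 2 := by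
    push_cast
    ring
  rw [IsMeijerContour, meijerLeftPoles_eq, meijerRightPoles_eq, h, Nat.lt_succ_iff]
  simp only [le_add_iff_nonneg_left, zero_le, true_and]

/-- A common pole would make 1/(βc_l) equal to the integer k - 1 - j - i < k. -/
lemma notMem_gammaLeftPoles (hc : ∀ l, ∀ n : ℤ, n < max k 1 → 1 / (β * c l) ≠ (n : ℂ)) (j : ℕ) :
    (1 - k + j : ℂ) ∉ gammaLeftPoles fun l => 1 / (β * c l) := by
  rintro ⟨l, i, h⟩
  refine hc l (k - 1 - j - i) (lt_of_lt_of_le (by omega) (le_max_left _ _)) ?_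
  push_cast
  linear_combination h

lemma contourIntegrable_of_isMeijerContour
    (hc : ∀ l, ∀ n : ℤ, n < max k 1 → 1 / (β * c l) ≠ (n : ℂ)) {w : ℂ} {γ : ℝ → ℂ}
    (hγ : IsMeijerContour 1 L (upperParam c β) (lowerParam d β k) w γ) :
    ContourIntegrable (barnesIntegrand c d β k w) γ := by
  rw [barnesIntegrand_eq]
  have hdisj := notMem_gammaLeftPoles hc
  rcases isMeijerContour_iff.1 hγ with ⟨hw, hv⟩ | ⟨hw, hl⟩
  · obtain ⟨A, hA⟩ := exists_forall_re_lt fun l => 1 / (β * c l)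
    obtain ⟨n, hn⟩ := exists_nat_gt (A + k)
    exact (contourIntegral_vertical hv hdisj hw (n := n) (fun p hp => by linarith [hA p hp])
      rfl).1
  · exact (contourIntegral_loop hl hdisj hw).1

/-- Two vertical contours are compared through the same line, two loops through the same series, and
a vertical contour and a loop through the series, as both are then allowed. -/
lemma contourIntegral_eq_of_isMeijerContour
    (hc : ∀ l, ∀ n : ℤ, n < max k 1 → 1 / (β * c l) ≠ (n : ℂ)) {w : ℂ} {γ γ' : ℝ → ℂ}
    (hγ : IsMeijerContour 1 L (upperParam c β) (lowerParam d β k) w γ)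
    (hγ' : IsMeijerContour 1 L (upperParam c β) (lowerParam d β k) w γ') :
    contourIntegral (barnesIntegrand c d β k w) γ =
      contourIntegral (barnesIntegrand c d β k w) γ' := by
  rw [barnesIntegrand_eq]
  have hdisj := notMem_gammaLeftPoles hc
  rcases isMeijerContour_iff.1 hγ with ⟨hw, hv⟩ | ⟨hw, hl⟩ <;>
    rcases isMeijerContour_iff.1 hγ' with ⟨hw', hv'⟩ | ⟨hw', hl'⟩
  · obtain ⟨A, hA⟩ := exists_forall_re_lt fun l => 1 / (β * c l)
    obtain ⟨n, hn⟩ := exists_nat_gt (A + k)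
    have hX : ∀ p ∈ gammaLeftPoles fun l => 1 / (β * c l), p.re < n - k + 1 / 2 := fun p hp => by
      linarith [hA p hp]
    rw [(contourIntegral_vertical hv hdisj hw hX rfl).2.2,
      (contourIntegral_vertical hv' hdisj hw hX rfl).2.2]
  · rw [contourIntegral_vertical_eq_tsum hv hdisj hw hw', (contourIntegral_loop hl' hdisj hw').2]
  · rw [contourIntegral_vertical_eq_tsum hv' hdisj hw' hw, (contourIntegral_loop hl hdisj hw).2]
  · rw [(contourIntegral_loop hl hdisj hw).2, (contourIntegral_loop hl' hdisj hw).2]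

lemma meijerG_eq_contourIntegral
    (hc : ∀ l, ∀ n : ℤ, n < max k 1 → 1 / (β * c l) ≠ (n : ℂ)) {w : ℂ} {γ : ℝ → ℂ}
    (hγ : IsMeijerContour 1 L (upperParam c β) (lowerParam d β k) w γ) :
    meijerG 1 L (upperParam c β) (lowerParam d β k) w =
      contourIntegral (barnesIntegrand c d β k w) γ := by
  have h : ∃ γ, IsMeijerContour 1 L (upperParam c β) (lowerParam d β k) w γ := ⟨γ, hγ⟩
  rw [meijerG, dif_pos h, meijerIntegrand_eq]
  exact contourIntegral_eq_of_isMeijerContour hc h.choose_spec hγ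

lemma exists_isMeijerContour (d : Fin M → ℂ)
    (hc : ∀ l, ∀ n : ℤ, n < max k 1 → 1 / (β * c l) ≠ (n : ℂ)) {w : ℂ}
    (h : (L ≤ M ∨ (L = M + 1 ∧ w.re < 0)) ∨ |w.im| < ((L : ℝ) - M + 1) * Real.pi / 2) :
    ∃ γ, IsMeijerContour 1 L (upperParam c β) (lowerParam d β k) w γ := by
  have hdisj := notMem_gammaLeftPoles hc
  rcases h with h | h
  · obtain ⟨γ, hγ⟩ := exists_isLoopContour _ k hdisj
    exact ⟨γ, isMeijerContour_iff.2 (Or.inr ⟨h, hγ⟩)⟩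
  · obtain ⟨γ, hγ⟩ := exists_isVerticalContour _ k hdisj
    exact ⟨γ, isMeijerContour_iff.2 (Or.inl ⟨h, hγ⟩)⟩

lemma meijerG_eq_tsum (hc : ∀ l, ∀ n : ℤ, n < max k 1 → 1 / (β * c l) ≠ (n : ℂ)) {w : ℂ}
    (h : L ≤ M ∨ (L = M + 1 ∧ w.re < 0)) :
    meijerG 1 L (upperParam c β) (lowerParam d β k) w =
      ∑' j, barnesTerm (fun l => 1 / (β * c l)) (fun m => 1 / (β * d m)) k w j := by
  have hdisj := notMem_gammaLeftPoles hc
  obtain ⟨γ, hγ⟩ := exists_isLoopContour _ k hdisj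
  rw [meijerG_eq_contourIntegral hc (isMeijerContour_iff.2 (Or.inr ⟨h, hγ⟩)), barnesIntegrand_eq,
    (contourIntegral_loop hγ hdisj h).2]

/-- This representation, with n and X independent of w, yields both holomorphy and the asymptotic
expansion. -/
lemma meijerG_eq_sum_add (hc : ∀ l, ∀ n : ℤ, n < max k 1 → 1 / (β * c l) ≠ (n : ℂ)) {w : ℂ}
    (hw : |w.im| < ((L : ℝ) - M + 1) * Real.pi / 2) {n : ℕ} {X : ℝ}
    (hX : ∀ p ∈ gammaLeftPoles fun l => 1 / (β * c l), p.re < X) (hXn : X = n - k + 1 / 2) :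
    meijerG 1 L (upperParam c β) (lowerParam d β k) w =
      ∑ j ∈ Finset.range n, barnesTerm (fun l => 1 / (β * c l)) (fun m => 1 / (β * d m)) k w j +
      contourIntegral (barnes (fun l => 1 / (β * c l)) (fun m => 1 / (β * d m)) k w)
        (fun t => X + t * I) := by
  have hdisj := notMem_gammaLeftPoles hc
  obtain ⟨γ, hγ⟩ := exists_isVerticalContour _ k hdisj
  rw [meijerG_eq_contourIntegral hc (isMeijerContour_iff.2 (Or.inl ⟨hw, hγ⟩)), barnesIntegrand_eq,
    (contourIntegral_vertical hγ hdisj hw hX hXn).2.2]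

lemma differentiable_barnesTerm (α : Fin L → ℂ) (δ : Fin M → ℂ) (k : ℤ) (j : ℕ) :
    Differentiable ℂ (fun w => barnesTerm α δ k w j) := by
  unfold barnesTerm barnesRegular
  fun_prop

lemma differentiableOn_meijerG (d : Fin M → ℂ)
    (hc : ∀ l, ∀ n : ℤ, n < max k 1 → 1 / (β * c l) ≠ (n : ℂ)) :
    DifferentiableOn ℂ (fun w => meijerG 1 L (upperParam c β) (lowerParam d β k) w)
      {w : ℂ | |w.im| < ((L : ℝ) - M + 1) * Real.pi / 2} := by
  intro w hw
  obtain ⟨A, hA⟩ := exists_forall_re_lt fun l => 1 / (β * c l)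
  obtain ⟨n, hn⟩ := exists_nat_gt (A + k)
  have hX : ∀ p ∈ gammaLeftPoles fun l => 1 / (β * c l), p.re < n - k + 1 / 2 := fun p hp => by
    linarith [hA p hp]
  refine DifferentiableWithinAt.congr (DifferentiableAt.differentiableWithinAt
    (DifferentiableAt.add (DifferentiableAt.fun_sum fun j _ => (differentiable_barnesTerm _ _ k j w))
    (differentiableAt_contourIntegral_verticalLine _ (verticalLine_notMem_poles hX rfl) hw)))
    (fun w hw => meijerG_eq_sum_add hc hw hX rfl) (meijerG_eq_sum_add hc hw hX rfl)

lemma norm_kappa_mul {x w : ℂ} (hw : exp w = -(kappa c d β * x)) :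
    ‖kappa c d β * x‖ = Real.exp w.re := by
  rw [← norm_neg, ← hw, norm_exp]

/-- The line must lie to the right of the left poles, so more than N terms may have to be split off.
The surplus terms and the line integral are all O(|κx|^{1-k+N}) because |κx| ≤ 1. -/
lemma exists_norm_sub_sum_le (hβ : β ≠ 0) (hc0 : ∀ l, c l ≠ 0) (hd0 : ∀ m, d m ≠ 0)
    (hc : ∀ l, ∀ n : ℤ, n < max k 1 → 1 / (β * c l) ≠ (n : ℂ))
    (hd : ∀ m, ∀ n : ℕ, 1 / (β * d m) ≠ (n : ℂ)) {θ : ℝ}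
    (hθ : θ < ((L : ℝ) - M + 1) * Real.pi / 2) (N : ℕ) :
    ∃ K : ℝ, ∀ x w : ℂ,
      exp w = -(kappa c d β * x) → |w.im| ≤ θ → ‖kappa c d β * x‖ ≤ 1 →
      ‖constC c d β k * meijerG 1 L (upperParam c β) (lowerParam d β k) w -
          ∑ j ∈ Finset.range N, phiTerm c d β k x j‖ ≤ K * ‖x ^ (1 - k + (N : ℤ))‖ := by
  set α : Fin L → ℂ := fun l => 1 / (β * c l) with hα
  set δ : Fin M → ℂ := fun m => 1 / (β * d m) with hδ
  obtain ⟨A, hA⟩ := exists_forall_re_lt α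
  obtain ⟨n', hn'⟩ := exists_nat_gt (A + k)
  -- The bound n ≥ N + 1 gives n - k + 1/2 ≥ 1 - k + N, so that the line integral is small enough.
  set n : ℕ := max n' (N + 1) with hn
  have hnN : N + 1 ≤ n := le_max_right _ _
  have hX : ∀ p ∈ gammaLeftPoles α, p.re < n - k + 1 / 2 := fun p hp => by
    have : (n' : ℝ) ≤ n := by exact_mod_cast le_max_left _ _
    linarith [hA p hp]
  obtain ⟨K, hK, hbound⟩ := exists_norm_contourIntegral_verticalLine_le δ
    (verticalLine_notMem_poles hX rfl) hθ
  set e : ℤ := 1 - k + (N : ℤ) with he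
  set D : ℕ → ℝ := fun j => ‖(-1) ^ j / (j.factorial : ℂ) * ((∏ l, Gamma ((1 - k + j : ℂ) + α l)) /
    ∏ m, Gamma ((1 - k + j : ℂ) - δ m))‖ with hD
  have hterm : ∀ j, N ≤ j → ∀ w : ℂ, w.re ≤ 0 →
      ‖barnesTerm α δ k w j‖ ≤ D j * Real.exp (e * w.re) := by
    intro j hj w hw
    have h1 : barnesTerm α δ k w j = (-1) ^ j / (j.factorial : ℂ) *
        ((∏ l, Gamma ((1 - k + j : ℂ) + α l)) / ∏ m, Gamma ((1 - k + j : ℂ) - δ m)) *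
        exp ((1 - k + j) * w) := by
      rw [barnesTerm, barnesRegular]
      ring
    rw [h1, norm_mul, norm_exp]
    refine mul_le_mul_of_nonneg_left (Real.exp_le_exp.2 ?_) (norm_nonneg _)
    have h2 : (N : ℝ) ≤ j := by exact_mod_cast hj
    rw [mul_re, he]
    simp only [add_re, sub_re, one_re, intCast_re, natCast_re, add_im, sub_im, one_im, intCast_im,
      natCast_im, sub_zero, add_zero, zero_mul]
    push_cast
    nlinarith
  -- The power of |κ| converts e^{(1-k+N) Re w} = |κx|^{1-k+N} into |x^{1-k+N}|.
  refine ⟨‖constC c d β k‖ * (∑ j ∈ Finset.Ico N n, D j + K) * ‖kappa c d β‖ ^ e,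
    fun x w hw hwθ hx => ?_⟩
  have hnorm := norm_kappa_mul hw
  have hre : w.re ≤ 0 := by
    rw [hnorm] at hx
    exact Real.exp_le_one_iff.1 hx
  have hexp : Real.exp (e * w.re) = ‖kappa c d β‖ ^ e * ‖x ^ e‖ := by
    rw [norm_zpow, ← mul_zpow, ← norm_mul, hnorm, ← Real.rpow_intCast, ← Real.exp_mul,
      mul_comm]
  have hline : Real.exp ((n - k + 1 / 2 : ℝ) * w.re) ≤ Real.exp (e * w.re) := by
    have h2 : (N : ℝ) + 1 ≤ n := by exact_mod_cast hnN
    refine Real.exp_le_exp.2 ?_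
    rw [he]
    push_cast
    nlinarith
  rw [meijerG_eq_sum_add hc (hwθ.trans_lt hθ) hX rfl,
    Finset.sum_congr rfl fun j _ => phiTerm_eq hβ hc0 hd0 hc hd hw j, ← Finset.mul_sum, ← mul_sub,
    add_sub_right_comm, ← Finset.sum_Ico_eq_sub _ (by omega), norm_mul,
    mul_assoc, ← hexp, mul_assoc, add_mul, Finset.sum_mul]
  refine mul_le_mul_of_nonneg_left ((norm_add_le _ _).trans (add_le_add
    ((norm_sum_le _ _).trans ?_) ((hbound w hwθ).trans ?_))) (norm_nonneg _)
  · exact Finset.sum_le_sum fun j hj => hterm j (Finset.mem_Ico.1 hj).1 w hre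
  · exact mul_le_mul_of_nonneg_left hline hK

end Meijer

end

/-! ### The main theorem -/

theorem mainTheorem1 (L M : ℕ) (c : Fin L → ℂ) (d : Fin M → ℂ) (β : ℂ) (k : ℤ)
    (hβ : β ≠ 0) (hc0 : ∀ l, c l ≠ 0) (hd0 : ∀ m, d m ≠ 0)
    (hc : ∀ l, ∀ n : ℤ, n < max k 1 → 1 / (β * c l) ≠ (n : ℂ))
    (hd : ∀ m, ∀ n : ℕ, 1 / (β * d m) ≠ (n : ℂ)) :
    -- separating contours exist, and along each of them the explicit integral converges to `G`
    (∀ x w : ℂ, exp w = -(kappa c d β * x) →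
      (L ≤ M ∨ (L = M + 1 ∧ ‖kappa c d β * x‖ < 1) ∨
        |w.im| < ((L : ℝ) - M + 1) * Real.pi / 2) →
      (∃ γ, IsMeijerContour 1 L (upperParam c β) (lowerParam d β k) w γ) ∧
      ∀ γ, IsMeijerContour 1 L (upperParam c β) (lowerParam d β k) w γ →
        ContourIntegrable (barnesIntegrand c d β k w) γ ∧
        meijerG 1 L (upperParam c β) (lowerParam d β k) w =
          contourIntegral (barnesIntegrand c d β k w) γ) ∧
    -- where the series of `φ_k` converges, it is `C_k G`
    (∀ x w : ℂ, exp w = -(kappa c d β * x) →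
      (L ≤ M ∨ (L = M + 1 ∧ ‖kappa c d β * x‖ < 1)) →
      Summable (phiTerm c d β k x) ∧
      phi c d β k x =
        constC c d β k * meijerG 1 L (upperParam c β) (lowerParam d β k) w) ∧
    -- for `L ≥ M + 1`, `G` is holomorphic in the sector of convergence
    (M + 1 ≤ L →
      DifferentiableOn ℂ (fun w => meijerG 1 L (upperParam c β) (lowerParam d β k) w)
        {w : ℂ | |w.im| < ((L : ℝ) - M + 1) * Real.pi / 2}) ∧
    -- for `L > M + 1`, the series of `φ_k` is the asymptotic series of `C_k G` at `x = 0`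
    (M + 1 < L → ∀ θ : ℝ, θ < ((L : ℝ) - M + 1) * Real.pi / 2 → ∀ N : ℕ, ∃ K : ℝ, ∀ x w : ℂ,
      exp w = -(kappa c d β * x) → |w.im| ≤ θ → ‖kappa c d β * x‖ ≤ 1 →
      ‖constC c d β k * meijerG 1 L (upperParam c β) (lowerParam d β k) w -
          ∑ j ∈ Finset.range N, phiTerm c d β k x j‖ ≤ K * ‖x ^ (1 - k + (N : ℤ))‖) ∧
    -- the series of `φ_k` is a multiple of a generalized hypergeometric series
    ((∀ m, ∀ n : ℕ, 1 - (k : ℂ) - 1 / (β * d m) ≠ -(n : ℂ)) → ∀ (x : ℂ) (j : ℕ),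
      phiTerm c d β k x j =
        β * rho c d β (-k) * x ^ (1 - k) *
          hypergeometricTerm (fun l => 1 - (k : ℂ) + 1 / (β * c l))
            (fun m => 1 - (k : ℂ) - 1 / (β * d m)) (kappa c d β * x) j) := by
  have hlt : ∀ x w : ℂ, exp w = -(kappa c d β * x) → ‖kappa c d β * x‖ < 1 → w.re < 0 :=
    fun x w hw hx => by
      rw [norm_kappa_mul hw] at hx
      exact Real.exp_lt_one_iff.1 hx
  refine ⟨fun x w hw h => ⟨exists_isMeijerContour d hc ?_, fun γ hγ =>
    ⟨contourIntegrable_of_isMeijerContour hc hγ, meijerG_eq_contourIntegral hc hγ⟩⟩,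
    fun x w hw h => ?_, fun _ => differentiableOn_meijerG d hc, fun _ θ hθ N =>
    exists_norm_sub_sum_le hβ hc0 hd0 hc hd hθ N, fun hk x j =>
    phiTerm_eq_hypergeometricTerm hβ hc0 hd0 hc hd hk x j⟩
  · rcases h with h | ⟨h, hx⟩ | h
    · exact Or.inl (Or.inl h)
    · exact Or.inl (Or.inr ⟨h, hlt x w hw hx⟩)
    · exact Or.inr h
  · have h' : L ≤ M ∨ (L = M + 1 ∧ w.re < 0) := h.imp_right fun h => ⟨h.1, hlt x w hw h.2⟩
    have e : phiTerm c d β k x = fun j => constC c d β k *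
        barnesTerm (fun l => 1 / (β * c l)) (fun m => 1 / (β * d m)) k w j :=
      funext fun j => phiTerm_eq hβ hc0 hd0 hc hd hw j
    rw [phi, e, meijerG_eq_tsum hc h', tsum_mul_left]
    exact ⟨(summable_barnesTerm _ _ k h').mul_left _, rfl⟩
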